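/- Let $n\ge 0$. An edge-labelled triangulation of a convex $(n+3)$-gon is a maximal set of pairwise non-crossing diagonals (its $n$ edges; sides of the polygon are not edges), together with a bijection from it to a fixed set of $n$ labels. Flipping an edge $e$ replaces it by the other diagonal of the quadrilateral formed by the two triangles at $e$; the new edge receives the label of $e$. A flip sequence is given by the list of labels of the edges that are flipped successively. The flip distance $d(\mathscr T_1,\mathscr T_2)$ is the least length of a flip sequence that transforms $\mathscr T_1$ into $\mathscr T_2$, labels included. For two edge-labelled triangulations $\mathscr T_1,\mathscr T_2$ of the same polygon, call an edge fixed if it occurs in both, has the same label in both, and the set of labels occurring to its left is the same in both. The fixed edges cut the polygon into subpolygons; all edges in the interior of a subpolygon are non-fixed. There are a polynomial-time algorithm (a random access machine program with unit-cost addition and truncated subtraction of natural numbers and indirect addressing, whose number of elementary steps is bounded by a polynomial in $n$) and a constant $C$ such that for all $n$ and all edge-labelled triangulations $\mathscr T_1,\mathscr T_2$ of a convex $(n+3)$-gon the following holds. 1. Given $\mathscr T_1,\mathscr T_2$, the algorithm outputs a flip sequence that transforms $\mathscr T_1$ into $\mathscr T_2$, that never flips a fixed edge, that makes at most $C\, n_i\log(n_i+1)$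 flips in each subpolygon with $n_i\ge 1$ edges in its interior, and whose length $L$ satisfies $$d(\mathscr T_1,\mathscr T_2)\le L\le C\,\log(n+1)\; d(\mathscr T_1,\mathscr T_2).$$ 2. Every flip sequence that transforms $\mathscr T_1$ into $\mathscr T_2$ flips each non-fixed edge at least once; hence it makes at least $n_i$ flips of edges whose labels belong to a subpolygon with $n_i$ edges in its interior. -/

import Mathlib

/-! ### Machine model: random access machine programs with unit-cost steps

The memory consists of arrays of natural numbers; an array is named by a numeral of the program and
its cells are addressed indirectly, by computed indices.  The only arithmetic is addition
and truncated subtraction (no multiplication), so that the uniform cost measure is polynomially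
equivalent to Turing machine time. -/

namespace RAM

/-- The contents of the memory: `s A i` is the content of cell `i` of array `A`. -/
abbrev Store := ℕ → ℕ → ℕ

/-- Expressions: constants, reading a cell `A[e]`, addition, truncated subtraction. -/
inductive Expr where
  | const (c : ℕ) : Expr
  | get (A : ℕ) (e : Expr) : Expr
  | add (e₁ e₂ : Expr) : Expr
  | sub (e₁ e₂ : Expr) : Expr

/-- The value of an expression. -/
def Expr.eval (s : Store) : Expr → ℕ
  | .const c => c
  | .get A e => s A (e.eval s)
  | .add e₁ e₂ => e₁.eval s + e₂.eval s
  | .sub e₁ e₂ => e₁.eval s - e₂.eval s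

/-- The number of elementary steps needed to evaluate an expression. -/
def Expr.cost : Expr → ℕ
  | .const _ => 1
  | .get _ e => e.cost + 1
  | .add e₁ e₂ => e₁.cost + e₂.cost + 1
  | .sub e₁ e₂ => e₁.cost + e₂.cost + 1

/-- Programs: `set A e₁ e₂` is the assignment `A[e₁] := e₂`, `ite e₁ e₂ P Q` is
`if e₁ < e₂ then P else Q`, and `loop e₁ e₂ P` is `while e₁ < e₂ do P`. -/
inductive Program where
  | skip : Program
  | set (A : ℕ) (e₁ e₂ : Expr) : Program
  | seq (P Q : Program) : Program
  | ite (e₁ e₂ : Expr) (P Q : Program) : Program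
  | loop (e₁ e₂ : Expr) (P : Program) : Program

/-- The store after writing `v` into cell `i` of array `A`. -/
def Store.write (s : Store) (A i v : ℕ) : Store :=
  fun B j => if B = A ∧ j = i then v else s B j

/-- `Exec P s t s'`: started on the store `s`, the program `P` halts after exactly `t` elementary
steps with the store `s'`. -/
inductive Exec : Program → Store → ℕ → Store → Prop where
  | skip (s : Store) : Exec .skip s 1 s
  | set (A : ℕ) (e₁ e₂ : Expr) (s : Store) :
      Exec (.set A e₁ e₂) s (e₁.cost + e₂.cost + 1) (s.write A (e₁.eval s) (e₂.eval s))
  | seq {P Q : Program} {s s' s'' : Store} {t t' : ℕ} :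
      Exec P s t s' → Exec Q s' t' s'' → Exec (.seq P Q) s (t + t') s''
  | ite_true {e₁ e₂ : Expr} {P Q : Program} {s s' : Store} {t : ℕ} :
      e₁.eval s < e₂.eval s → Exec P s t s' →
      Exec (.ite e₁ e₂ P Q) s (e₁.cost + e₂.cost + 1 + t) s'
  | ite_false {e₁ e₂ : Expr} {P Q : Program} {s s' : Store} {t : ℕ} :
      ¬ e₁.eval s < e₂.eval s → Exec Q s t s' →
      Exec (.ite e₁ e₂ P Q) s (e₁.cost + e₂.cost + 1 + t) s'
  | loop_true {e₁ e₂ : Expr} {P : Program} {s s' s'' : Store} {t t' : ℕ} :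
      e₁.eval s < e₂.eval s → Exec P s t s' → Exec (.loop e₁ e₂ P) s' t' s'' →
      Exec (.loop e₁ e₂ P) s (e₁.cost + e₂.cost + 1 + t + t') s''
  | loop_false {e₁ e₂ : Expr} {P : Program} {s : Store} :
      ¬ e₁.eval s < e₂.eval s → Exec (.loop e₁ e₂ P) s (e₁.cost + e₂.cost + 1) s

/-- The initial store for the input word `w`: cell `0` of array `0` holds the length of `w`, the
following cells of array `0` hold the entries of `w`, and everything else is `0`. -/
def initialStore (w : List ℕ) : Store :=
  fun A i => if A = 0 then (w.length :: w).getD i 0 else 0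

/-- The word `w` can be read off as output: cell `0` of array `1` holds the length of `w`, and the
following cells of array `1` hold the entries of `w`. -/
def IsOutput (s : Store) (w : List ℕ) : Prop :=
  s 1 0 = w.length ∧ ∀ (i : ℕ) (h : i < w.length), s 1 (i + 1) = w[i]

/-- On input `w`, the program `P` halts within at most `T` steps with output `w'`. -/
def OutputsWithin (P : Program) (w w' : List ℕ) (T : ℕ) : Prop :=
  ∃ (t : ℕ) (s : Store), t ≤ T ∧ Exec P (initialStore w) t s ∧ IsOutput s w'

end RAM

/-! ### Edge-labelled triangulations of a convex polygon

The polygon has `n + 3` vertices, numbered `0, …, n + 2` in cyclic order along the boundary. -/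

/-- A diagonal of the convex `(n + 3)`-gon: a pair of non-adjacent vertices `lo < hi`. -/
@[ext]
structure Diagonal (n : ℕ) where
  lo : ℕ
  hi : ℕ
  lo_add_two_le : lo + 2 ≤ hi
  hi_le : hi ≤ n + 2
  not_side : ¬ (lo = 0 ∧ hi = n + 2)
deriving DecidableEq

/-- Two diagonals of a convex polygon cross (in an interior point of both) iff their endpoints
interleave along the boundary. -/
def Diagonal.Crosses {n : ℕ} (d e : Diagonal n) : Prop :=
  (d.lo < e.lo ∧ e.lo < d.hi ∧ d.hi < e.hi) ∨ (e.lo < d.lo ∧ d.lo < e.hi ∧ e.hi < d.hi)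

/-- An edge-labelled triangulation of the convex `(n + 3)`-gon: a maximal set of pairwise
non-crossing diagonals, which carry distinct labels.  The diagonals of a triangulation are `n` in
number; `diag k` is the one with label `k` (labels are numbered from `0`). -/
@[ext]
structure LabelledTriangulation (n : ℕ) where
  diag : Fin n → Diagonal n
  injective : Function.Injective diag
  not_crosses : ∀ j k, ¬ (diag j).Crosses (diag k)
  maximal : ∀ d : Diagonal n, (∀ j, ¬ d.Crosses (diag j)) → ∃ j, diag j = d

namespace LabelledTriangulation

variable {n : ℕ}

/-- For vertices `x < y`, the segment `xy` is a side of the polygon or an edge of `T`. -/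
def HasSegment (T : LabelledTriangulation n) (x y : ℕ) : Prop :=
  y = x + 1 ∨ (x = 0 ∧ y = n + 2) ∨ ∃ j, (T.diag j).lo = x ∧ (T.diag j).hi = y

/-- `T'` arises from `T` by flipping the edge with label `k`: this edge is a diagonal of a
quadrilateral `abcd` consisting of two triangles of `T`, it is replaced by the other diagonal of
`abcd`, which receives the label `k`, and all other edges and labels stay as they are. -/
def Flip (k : Fin n) (T T' : LabelledTriangulation n) : Prop :=
  (∀ j, j ≠ k → T'.diag j = T.diag j) ∧
  ∃ a b c d : ℕ, a < b ∧ b < c ∧ c < d ∧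
    T.HasSegment a b ∧ T.HasSegment b c ∧ T.HasSegment c d ∧ T.HasSegment a d ∧
    (((T.diag k).lo = a ∧ (T.diag k).hi = c ∧ (T'.diag k).lo = b ∧ (T'.diag k).hi = d) ∨
     ((T.diag k).lo = b ∧ (T.diag k).hi = d ∧ (T'.diag k).lo = a ∧ (T'.diag k).hi = c))

/-- Flipping successively the edges with the labels listed in `l` transforms `T` into `T'`. -/
def FlipSeq : List (Fin n) → LabelledTriangulation n → LabelledTriangulation n → Prop
  | [], T, T' => T = T'
  | k :: l, T, T' => ∃ S, Flip k T S ∧ FlipSeq l S T'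

/-- The flip distance: the least length of a flip sequence transforming `T` into `T'`. -/
noncomputable def flipDist (T T' : LabelledTriangulation n) : ℕ :=
  sInf {m | ∃ l : List (Fin n), FlipSeq l T T' ∧ l.length = m}

/-- The labels of the edges of `T` on one side of the edge with label `k`, namely on the side of the
vertices that lie strictly between its endpoints in the numbering. -/
def leftLabels (T : LabelledTriangulation n) (k : Fin n) : Finset (Fin n) :=
  Finset.univ.filter fun j =>
    j ≠ k ∧ (T.diag k).lo ≤ (T.diag j).lo ∧ (T.diag j).hi ≤ (T.diag k).hi

/-- The edge with label `k` is fixed: it is the same edge in both triangulations, with the same set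
of labels to its left. -/
def Fixed (T₁ T₂ : LabelledTriangulation n) (k : Fin n) : Prop :=
  T₁.diag k = T₂.diag k ∧ T₁.leftLabels k = T₂.leftLabels k

instance (T₁ T₂ : LabelledTriangulation n) (k : Fin n) : Decidable (Fixed T₁ T₂ k) :=
  inferInstanceAs (Decidable (_ ∧ _))

/-- The fixed edges cut the polygon into subpolygons.  This is the set of (labels of) edges of `T₁`
in the interior of the subpolygon that contains the non-fixed edge with label `i`: the non-fixed
edges that are on the same side as `i` of every fixed edge. -/
def subpolygon (T₁ T₂ : LabelledTriangulation n) (i : Fin n) : Finset (Fin n) :=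
  Finset.univ.filter fun j =>
    ¬ Fixed T₁ T₂ j ∧ ∀ k, Fixed T₁ T₂ k → (j ∈ T₁.leftLabels k ↔ i ∈ T₁.leftLabels k)

/-- The input word for a pair of triangulations: `n`, followed by the list of smaller endpoints and
the list of larger endpoints of the edges of `T₁`, in the order of their labels, and the same two
lists for `T₂`. -/
def encodePair (T₁ T₂ : LabelledTriangulation n) : List ℕ :=
  n :: (List.ofFn (fun k => (T₁.diag k).lo) ++ List.ofFn (fun k => (T₁.diag k).hi) ++
    List.ofFn (fun k => (T₂.diag k).lo) ++ List.ofFn (fun k => (T₂.diag k).hi))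

end LabelledTriangulation

/-!
A flip of one edge leaves all other edges in place, and does not move the flipped edge to the other
side of another edge. So an edge that is never flipped is fixed (`FlipSeq.fixed_of_not_mem`); this
is the second half of the theorem, and it bounds the flip distance from below by the number of
non-fixed edges (`card_not_fixed_le_flipDist`). It remains to find, in polynomial time, a flip
sequence with `O(m log m)` flips in a subpolygon with `m` edges; summing up over the subpolygons
gives the approximation factor (`length_le_of_countP_le`).

Number the vertices of a subpolygon, apart from the two endpoints of its base, by `r = 1, 2, …` and
give the `r`-th one the priority `1 + ν₂(r)`. The level of an edge is the largest priority of a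
vertex of its subpolygon strictly between its endpoints; it is at most `1 + log₂ (m + 1)`. Starting
from `T₁`, and likewise from `T₂`, flip non-fixed edges as long as this decreases their level; each
edge is flipped `O(log m)` times. In the resulting stable triangulation the triangle below each
edge, or below the base, has the vertex of highest priority as its apex (`Stable.apex_spec`): this
vertex is unique, since between two numbers of the same `2`-adic valuation there is one of higher
valuation. Hence both searches end with the same edges (`Stable.exists_diag_eq`), and only the
labels may differ.

The labels of two edges that share a triangle are exchanged by five flips in the pentagon around
them (`Adjacent.exists_swap`). Move the labels to their places in the order of increasing lengths of
the target edges, each of them by exchanges with neighbours along the path of the dual tree. Levels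
decrease strictly from an edge to those below it (`Stable.level_lt`), so the dual tree has depth
`O(log m)`, and `O(log m)` exchanges suffice for a label (`Stable.card_route_le`). Labels that are
at their places stay there (`Advances.placed`): an edge passed on the way separates the present
place of the label from its goal, so it is above one of them and longer than it, whereas the edges
that already carry their final labels are at most as long as either. The flips from `T₂` are
performed last, in reverse order.

The algorithm is written in a language of for programs, whose loops have `n + c` rounds; such
programs compile to the random access machine, with a polynomial time bound
(`ForProgram.exec_compile`).
-/

/-! ### For programs on the random access machine -/

namespace RAM

/-- Expressions enriched by conditionals and bounded sums: `ite e₁ e₂ e₃ e₄` is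
`if e₁ < e₂ then e₃ else e₄`, and `sum c i e` is the sum of `e` over the values `0, …, n + c - 1` of
the variable `i`. Here `n` is the content of cell `1` of array `0`, and the variable `i` is cell `0` of
array `i`. -/
inductive SExpr where
  | const (c : ℕ) : SExpr
  | get (A : ℕ) (e : SExpr) : SExpr
  | add (e₁ e₂ : SExpr) : SExpr
  | sub (e₁ e₂ : SExpr) : SExpr
  | ite (e₁ e₂ e₃ e₄ : SExpr) : SExpr
  | sum (c i : ℕ) (e : SExpr) : SExpr

/-- For programs: all loops are of the form `for i = 0, …, n + c - 1`, with `n` the content of cell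
`1` of array `0`; so every such program halts, in polynomial time. -/
inductive ForProgram where
  | set (A : ℕ) (e₁ e₂ : SExpr) : ForProgram
  | seq (P Q : ForProgram) : ForProgram
  | cond (e : SExpr) (P : ForProgram) : ForProgram
  | loop (c i : ℕ) (P : ForProgram) : ForProgram

/-- The value of an enriched expression. -/
def SExpr.eval : SExpr → Store → ℕ
  | .const c, _ => c
  | .get A e, s => s A (e.eval s)
  | .add e₁ e₂, s => e₁.eval s + e₂.eval s
  | .sub e₁ e₂, s => e₁.eval s - e₂.eval s
  | .ite e₁ e₂ e₃ e₄, s => if e₁.eval s < e₂.eval s then e₃.eval s else e₄.eval s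
  | .sum c i e, s => ∑ v ∈ Finset.range (s 0 1 + c), e.eval (s.write i 0 v)

/-- The store after the rounds `0, …, m - 1` of a loop with variable `i`, whose body acts as `f`. -/
def loopStore (f : Store → Store) (i : ℕ) (s : Store) : ℕ → Store
  | 0 => s
  | m + 1 => f ((loopStore f i s m).write i 0 m)

/-- The effect of a for program on the store; `cond e P` executes `P` if the value of `e` is not
zero. -/
def ForProgram.run : ForProgram → Store → Store
  | .set A e₁ e₂, s => s.write A (e₁.eval s) (e₂.eval s)
  | .seq P Q, s => Q.run (P.run s)
  | .cond e P, s => if 0 < e.eval s then P.run s else s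
  | .loop c i P, s => loopStore P.run i s (s 0 1 + c)

/-- A bound for the names of the arrays that occur in an expression. -/
def SExpr.bound : SExpr → ℕ
  | .const _ => 1
  | .get A e => max (A + 1) e.bound
  | .add e₁ e₂ => max e₁.bound e₂.bound
  | .sub e₁ e₂ => max e₁.bound e₂.bound
  | .ite e₁ e₂ e₃ e₄ => max (max e₁.bound e₂.bound) (max e₃.bound e₄.bound)
  | .sum _ i e => max (i + 1) e.bound

/-- A bound for the names of the arrays that occur in a for program. -/
def ForProgram.bound : ForProgram → ℕ
  | .set A e₁ e₂ => max (A + 1) (max e₁.bound e₂.bound)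
  | .seq P Q => max P.bound Q.bound
  | .cond e P => max e.bound P.bound
  | .loop _ i P => max (i + 1) P.bound

/-- `Writes P A`: the program `P` may write into the array `A`. -/
def ForProgram.Writes : ForProgram → ℕ → Prop
  | .set A _ _, B => B = A
  | .seq P Q, B => P.Writes B ∨ Q.Writes B
  | .cond _ P, B => P.Writes B
  | .loop _ i P, B => B = i ∨ P.Writes B

/-- The variable `i`, as an expression of the machine. -/
def reg (i : ℕ) : Expr := .get i (.const 0)

/-- The number of rounds of a loop, as an expression. -/
def rounds (c : ℕ) : Expr := .add (.get 0 (.const 1)) (.const c)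

/-- `e.compile t` leaves the value of `e` in the variable `t`; it uses the arrays from `t` on as
scratch memory.  For a sum, `t` holds the partial sum, `t + 1` the value of the summation variable
before the loop, which is restored at its end, and `t + 2` the counter. -/
def SExpr.compile : SExpr → ℕ → Program
  | .const c, t => .set t (.const 0) (.const c)
  | .get A e, t => .seq (e.compile t) (.set t (.const 0) (.get A (reg t)))
  | .add e₁ e₂, t => .seq (e₁.compile t) (.seq (e₂.compile (t + 1))
      (.set t (.const 0) (.add (reg t) (reg (t + 1)))))
  | .sub e₁ e₂, t => .seq (e₁.compile t) (.seq (e₂.compile (t + 1))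
      (.set t (.const 0) (.sub (reg t) (reg (t + 1)))))
  | .ite e₁ e₂ e₃ e₄, t => .seq (e₁.compile t) (.seq (e₂.compile (t + 1))
      (.ite (reg t) (reg (t + 1)) (e₃.compile t) (e₄.compile t)))
  | .sum c i e, t =>
      .seq (.set (t + 1) (.const 0) (reg i)) <| .seq (.set t (.const 0) (.const 0)) <|
      .seq (.set (t + 2) (.const 0) (.const 0)) <| .seq
        (.loop (reg (t + 2)) (rounds c) <|
          .seq (.set i (.const 0) (reg (t + 2))) <| .seq (e.compile (t + 3)) <|
          .seq (.set t (.const 0) (.add (reg t) (reg (t + 3)))) <|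
          .set (t + 2) (.const 0) (.add (reg (t + 2)) (.const 1)))
        (.set i (.const 0) (reg (t + 1)))

/-- The translation of a for program; it uses the arrays from `t` on as scratch memory. -/
def ForProgram.compile : ForProgram → ℕ → Program
  | .set A e₁ e₂, t => .seq (e₁.compile t) (.seq (e₂.compile (t + 1))
      (.set A (reg t) (reg (t + 1))))
  | .seq P Q, t => .seq (P.compile t) (Q.compile t)
  | .cond e P, t => .seq (e.compile t) (.ite (.const 0) (reg t) (P.compile t) .skip)
  | .loop c i P, t =>
      .seq (.set t (.const 0) (.const 0)) <|
        .loop (reg t) (rounds c) <|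
          .seq (.set i (.const 0) (reg t)) <| .seq (P.compile (t + 1)) <|
          .set t (.const 0) (.add (reg t) (.const 1))

open Polynomial in
/-- A bound, as a polynomial in `n`, for the time needed to evaluate an expression; the constants
are not optimal. -/
noncomputable def SExpr.cost : SExpr → ℕ[X]
  | .const _ => C 3
  | .get _ e => e.cost + C 5
  | .add e₁ e₂ => e₁.cost + e₂.cost + C 7
  | .sub e₁ e₂ => e₁.cost + e₂.cost + C 7
  | .ite e₁ e₂ e₃ e₄ => e₁.cost + e₂.cost + e₃.cost + e₄.cost + C 5
  | .sum c _ e => (X + C c) * (e.cost + C 24) + C 30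

open Polynomial in
/-- A bound, as a polynomial in `n`, for the running time of a for program. -/
noncomputable def ForProgram.cost : ForProgram → ℕ[X]
  | .set _ e₁ e₂ => e₁.cost + e₂.cost + C 5
  | .seq P Q => P.cost + Q.cost
  | .cond e P => e.cost + P.cost + C 5
  | .loop c _ P => (X + C c) * (P.cost + C 24) + C 30

@[simp] lemma Store.write_same (s : Store) (A i v : ℕ) : s.write A i v A i = v := by
  simp [Store.write]

lemma Store.write_array_of_ne (s : Store) {A B : ℕ} (i v : ℕ) (h : B ≠ A) :
    s.write A i v B = s B := by
  funext j
  simp [Store.write, h]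

lemma Store.write_cell_of_ne (s : Store) {i j : ℕ} (A B v : ℕ) (h : j ≠ i) :
    s.write A i v B j = s B j := by
  simp [Store.write, h]

/-- The value of an expression depends only on the arrays that occur in it. -/
lemma SExpr.eval_congr (e : SExpr) : ∀ {s s' : Store}, (∀ A < e.bound, s A = s' A) →
    s 0 1 = s' 0 1 → e.eval s = e.eval s' := by
  induction e with
  | const c => intros; rfl
  | get A e ih =>
    intro s s' h h0
    simp only [SExpr.eval, SExpr.bound] at *
    rw [h A (by simp), ih (fun B hB => h B (lt_max_of_lt_right hB)) h0]
  | add a b iha ihb =>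
    intro s s' h h0
    simp only [SExpr.eval, SExpr.bound] at *
    rw [iha (fun B hB => h B (lt_max_of_lt_left hB)) h0,
      ihb (fun B hB => h B (lt_max_of_lt_right hB)) h0]
  | sub a b iha ihb =>
    intro s s' h h0
    simp only [SExpr.eval, SExpr.bound] at *
    rw [iha (fun B hB => h B (lt_max_of_lt_left hB)) h0,
      ihb (fun B hB => h B (lt_max_of_lt_right hB)) h0]
  | ite a b c d iha ihb ihc ihd =>
    intro s s' h h0
    simp only [SExpr.eval, SExpr.bound] at *
    rw [iha (fun B hB => h B (by omega)) h0, ihb (fun B hB => h B (by omega)) h0,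
      ihc (fun B hB => h B (by omega)) h0, ihd (fun B hB => h B (by omega)) h0]
  | sum c i e ih =>
    intro s s' h h0
    simp only [SExpr.eval, SExpr.bound] at *
    rw [h0]
    refine Finset.sum_congr rfl fun v _ => ih (fun B hB => ?_) ?_
    · funext j
      simp only [Store.write]
      rw [h B (lt_max_of_lt_right hB)]
    · simp [Store.write, h0]

lemma eval_reg (s : Store) (i : ℕ) : (reg i).eval s = s i 0 := rfl

lemma eval_rounds (s : Store) (c : ℕ) : (rounds c).eval s = s 0 1 + c := rfl

/-- Execution of a counting loop with counter `r`, whose body preserves the invariant `I` and takes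
at most `K` steps. -/
lemma exec_counting_loop {P : Program} {r c n K : ℕ} (I : ℕ → Store → Prop)
    (hI : ∀ v s, I v s → s r 0 = v ∧ s 0 1 = n)
    (hP : ∀ v < n + c, ∀ s, I v s → ∃ t s', Exec P s t s' ∧ I (v + 1) s' ∧ t ≤ K)
    {s : Store} (h : I 0 s) :
    ∃ t s', Exec (.loop (reg r) (rounds c) P) s t s' ∧ I (n + c) s' ∧
      t ≤ (n + c) * (K + 7) + 7 := by
  suffices H : ∀ d v, v + d = n + c → ∀ s, I v s → ∃ t s',
      Exec (.loop (reg r) (rounds c) P) s t s' ∧ I (n + c) s' ∧ t ≤ d * (K + 7) + 7 from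
    H (n + c) 0 (by omega) s h
  intro d
  induction d with
  | zero =>
    intro v hv s hs
    obtain ⟨h1, h2⟩ := hI v s hs
    refine ⟨_, s, Exec.loop_false ?_, ?_, ?_⟩
    · rw [eval_reg, eval_rounds]; omega
    · rwa [← hv]
    · simp [reg, rounds, Expr.cost]
  | succ d ih =>
    intro v hv s hs
    obtain ⟨h1, h2⟩ := hI v s hs
    obtain ⟨t, s', hx, hs', ht⟩ := hP v (by omega) s hs
    obtain ⟨t', s'', hx', hs'', ht'⟩ := ih (v + 1) (by omega) s' hs'
    refine ⟨_, s'', Exec.loop_true ?_ hx hx', hs'', ?_⟩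
    · rw [eval_reg, eval_rounds]; omega
    · simp only [reg, rounds, Expr.cost]
      rw [add_mul]
      omega

/-- The compiled expression computes the value of the expression, within the time bound, and leaves
the arrays below `t` as they were. -/
lemma SExpr.exec_compile (e : SExpr) : ∀ (t : ℕ) (s : Store), e.bound ≤ t → 0 < t →
    ∃ m s', Exec (e.compile t) s m s' ∧ s' t 0 = e.eval s ∧ (∀ A < t, s' A = s A) ∧
      m ≤ e.cost.eval (s 0 1) := by
  induction e with
  | const c =>
    intro t s _ _
    refine ⟨_, _, Exec.set _ _ _ _, by simp [SExpr.eval, Expr.eval], fun A hA => ?_, ?_⟩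
    · exact Store.write_array_of_ne _ _ _ hA.ne
    · simp [SExpr.cost, Expr.cost]
  | get A e ih =>
    intro t s hb h0
    simp only [SExpr.bound, max_le_iff] at hb
    obtain ⟨m, s', hx, hv, hs, hm⟩ := ih t s hb.2 h0
    refine ⟨_, _, Exec.seq hx (Exec.set _ _ _ _), ?_, fun B hB => ?_, ?_⟩
    · simp [SExpr.eval, Expr.eval, eval_reg, hv, hs A (by omega)]
    · rw [Store.write_array_of_ne _ _ _ hB.ne, hs B hB]
    · simp [SExpr.cost, Expr.cost, reg]; omega
  | add a b iha ihb =>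
    intro t s hb h0
    simp only [SExpr.bound, max_le_iff] at hb
    obtain ⟨m, s', hx, hv, hs, hm⟩ := iha t s hb.1 h0
    obtain ⟨m', s'', hx', hv', hs', hm'⟩ := ihb (t + 1) s' (by omega) (by omega)
    refine ⟨_, _, Exec.seq hx (Exec.seq hx' (Exec.set _ _ _ _)), ?_, fun B hB => ?_, ?_⟩
    · have := b.eval_congr (fun B hB => hs B (by omega)) (by rw [hs 0 h0])
      simp [SExpr.eval, Expr.eval, eval_reg, hv', hs' t (by omega), hv, this]
    · rw [Store.write_array_of_ne _ _ _ hB.ne, hs' B (by omega), hs B hB]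
    · rw [hs 0 h0] at hm'
      simp [SExpr.cost, Expr.cost, reg]; omega
  | sub a b iha ihb =>
    intro t s hb h0
    simp only [SExpr.bound, max_le_iff] at hb
    obtain ⟨m, s', hx, hv, hs, hm⟩ := iha t s hb.1 h0
    obtain ⟨m', s'', hx', hv', hs', hm'⟩ := ihb (t + 1) s' (by omega) (by omega)
    refine ⟨_, _, Exec.seq hx (Exec.seq hx' (Exec.set _ _ _ _)), ?_, fun B hB => ?_, ?_⟩
    · have := b.eval_congr (fun B hB => hs B (by omega)) (by rw [hs 0 h0])
      simp [SExpr.eval, Expr.eval, eval_reg, hv', hs' t (by omega), hv, this]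
    · rw [Store.write_array_of_ne _ _ _ hB.ne, hs' B (by omega), hs B hB]
    · rw [hs 0 h0] at hm'
      simp [SExpr.cost, Expr.cost, reg]; omega
  | ite a b c d iha ihb ihc ihd =>
    intro t s hb h0
    simp only [SExpr.bound, max_le_iff] at hb
    obtain ⟨m, s', hx, hv, hs, hm⟩ := iha t s hb.1.1 h0
    obtain ⟨m', s'', hx', hv', hs', hm'⟩ := ihb (t + 1) s' (by omega) (by omega)
    have hss : ∀ A < t, s'' A = s A := fun A hA => by rw [hs' A (by omega), hs A hA]
    have hbe := b.eval_congr (fun B hB => hs B (by omega)) (by rw [hs 0 h0])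
    have h1 : s'' t 0 = a.eval s := by rw [hs' t (by omega), hv]
    rw [hs 0 h0] at hm'
    by_cases hlt : a.eval s < b.eval s
    · obtain ⟨m₃, s₃, hx₃, hv₃, hs₃, hm₃⟩ := ihc t s'' hb.2.1 h0
      rw [hss 0 h0] at hm₃
      refine ⟨_, _, Exec.seq hx (Exec.seq hx' (Exec.ite_true ?_ hx₃)), ?_, fun B hB => ?_, ?_⟩
      · rw [eval_reg, eval_reg, h1, hv', hbe]; exact hlt
      · rw [hv₃, c.eval_congr (fun B hB => hss B (by omega)) (by rw [hss 0 h0])]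
        simp [SExpr.eval, hlt]
      · rw [hs₃ B hB, hss B hB]
      · simp [SExpr.cost, Expr.cost, reg]; omega
    · obtain ⟨m₃, s₃, hx₃, hv₃, hs₃, hm₃⟩ := ihd t s'' hb.2.2 h0
      rw [hss 0 h0] at hm₃
      refine ⟨_, _, Exec.seq hx (Exec.seq hx' (Exec.ite_false ?_ hx₃)), ?_, fun B hB => ?_, ?_⟩
      · rw [eval_reg, eval_reg, h1, hv', hbe]; exact hlt
      · rw [hv₃, d.eval_congr (fun B hB => hss B (by omega)) (by rw [hss 0 h0])]
        simp [SExpr.eval, hlt]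
      · rw [hs₃ B hB, hss B hB]
      · simp [SExpr.cost, Expr.cost, reg]; omega
  | sum c i e ih =>
    intro t s hb h0
    simp only [SExpr.bound, max_le_iff] at hb
    obtain ⟨hi, hb⟩ := hb
    -- the invariant of the loop: partial sum in `t`, saved value of `i` in `t + 1`, counter in
    -- `t + 2`
    let I : ℕ → Store → Prop := fun v s' =>
      s' (t + 2) 0 = v ∧ s' (t + 1) 0 = s i 0 ∧
      s' t 0 = ∑ u ∈ Finset.range v, e.eval (s.write i 0 u) ∧
      (∀ A < t, A ≠ i → s' A = s A) ∧ (∀ j, j ≠ 0 → s' i j = s i j)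
    have h01 : ∀ v s', I v s' → s' 0 1 = s 0 1 := by
      intro v s' h
      by_cases hi0 : i = 0
      · subst hi0; exact h.2.2.2.2 1 one_ne_zero
      · rw [h.2.2.2.1 0 h0 (Ne.symm hi0)]
    have hloop := exec_counting_loop (P := .seq (.set i (.const 0) (reg (t + 2))) <|
        .seq (e.compile (t + 3)) <| .seq (.set t (.const 0) (.add (reg t) (reg (t + 3)))) <|
          .set (t + 2) (.const 0) (.add (reg (t + 2)) (.const 1)))
        (r := t + 2) (c := c) (n := s 0 1) (K := e.cost.eval (s 0 1) + 17) I
        (fun v s' h => ⟨h.1, h01 v s' h⟩) ?_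
        (s := ((s.write (t + 1) 0 (s i 0)).write t 0 0).write (t + 2) 0 0) ?_
    · obtain ⟨m, s', hx, hs', hm⟩ := hloop
      refine ⟨_, _, Exec.seq (Exec.set _ _ _ _) (Exec.seq (Exec.set _ _ _ _)
        (Exec.seq (Exec.set _ _ _ _) (Exec.seq hx (Exec.set _ _ _ _)))), ?_, fun B hB => ?_, ?_⟩
      · simp only [Expr.eval, eval_reg]
        rw [Store.write_array_of_ne _ _ _ (by omega : t ≠ i), hs'.2.2.1]
        rfl
      · simp only [Expr.eval, eval_reg]
        by_cases hBi : B = i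
        · subst hBi
          funext j
          by_cases hj : j = 0
          · subst hj; rw [Store.write_same, hs'.2.1]
          · rw [Store.write_cell_of_ne _ _ _ _ hj, hs'.2.2.2.2 j hj]
        · rw [Store.write_array_of_ne _ _ _ hBi, hs'.2.2.2.1 B hB hBi]
      · simp only [SExpr.cost, Expr.cost, reg, Polynomial.eval_add, Polynomial.eval_mul,
          Polynomial.eval_X, Polynomial.eval_C]
        rw [show Polynomial.eval (s 0 1) e.cost + 24 = Polynomial.eval (s 0 1) e.cost + 17 + 7 by
          rfl]
        omega
    · intro v hv s' hs'
      have hagree : ∀ A < e.bound, (s'.write i 0 v) A = (s.write i 0 v) A := by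
        intro A hA
        by_cases hAi : A = i
        · subst hAi
          funext j
          by_cases hj : j = 0
          · subst hj; simp
          · rw [Store.write_cell_of_ne _ _ _ _ hj, Store.write_cell_of_ne _ _ _ _ hj,
              hs'.2.2.2.2 j hj]
        · rw [Store.write_array_of_ne _ _ _ hAi, Store.write_array_of_ne _ _ _ hAi,
            hs'.2.2.2.1 A (by omega) hAi]
      have h0' : (s'.write i 0 v) 0 1 = s 0 1 := by
        rw [Store.write_cell_of_ne _ _ _ _ one_ne_zero, h01 v s' hs']
      obtain ⟨m, s₁, hx, hv₁, hs₁, hm⟩ := ih (t + 3) (s'.write i 0 v) (by omega) (by omega)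
      rw [h0'] at hm
      have hev : e.eval (s'.write i 0 v) = e.eval (s.write i 0 v) :=
        e.eval_congr hagree (by rw [h0', Store.write_cell_of_ne _ _ _ _ one_ne_zero])
      have hst : s₁ t 0 = s' t 0 := by
        rw [hs₁ t (by omega), Store.write_array_of_ne _ _ _ (by omega)]
      have hst1 : s₁ (t + 1) 0 = s' (t + 1) 0 := by
        rw [hs₁ _ (by omega), Store.write_array_of_ne _ _ _ (by omega)]
      have hst2 : s₁ (t + 2) 0 = s' (t + 2) 0 := by
        rw [hs₁ _ (by omega), Store.write_array_of_ne _ _ _ (by omega)]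
      have hx' : Exec (e.compile (t + 3))
          (s'.write i ((Expr.const 0).eval s') ((reg (t + 2)).eval s')) m s₁ := by
        rw [show (reg (t + 2)).eval s' = v from hs'.1]; exact hx
      refine ⟨_, _, Exec.seq (Exec.set _ _ _ _) (Exec.seq hx' (Exec.seq (Exec.set _ _ _ _)
        (Exec.set _ _ _ _))), ⟨?_, ?_, ?_, fun A hA hAi => ?_, fun j hj => ?_⟩, ?_⟩
      · simp only [Expr.eval, eval_reg]
        rw [Store.write_same, Store.write_array_of_ne _ _ _ (by omega), hst2, hs'.1]
      · rw [Store.write_array_of_ne _ _ _ (by omega), Store.write_array_of_ne _ _ _ (by omega),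
          hst1, hs'.2.1]
      · rw [Store.write_array_of_ne _ _ _ (by omega)]
        simp only [Expr.eval, eval_reg]
        rw [Store.write_same, hst, hv₁, hev, hs'.2.2.1, Finset.sum_range_succ]
      · rw [Store.write_array_of_ne _ _ _ (by omega), Store.write_array_of_ne _ _ _ (by omega),
          hs₁ A (by omega), Store.write_array_of_ne _ _ _ hAi, hs'.2.2.2.1 A hA hAi]
      · rw [Store.write_array_of_ne _ _ _ (by omega), Store.write_array_of_ne _ _ _ (by omega),
          hs₁ i (by omega), Store.write_cell_of_ne _ _ _ _ hj, hs'.2.2.2.2 j hj]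
      · simp [Expr.cost, reg]; omega
    · refine ⟨by simp, ?_, ?_, fun A hA hAi => ?_, fun j hj => ?_⟩
      · simp [Store.write]
      · simp [Store.write]
      · rw [Store.write_array_of_ne _ _ _ (by omega), Store.write_array_of_ne _ _ _ (by omega),
          Store.write_array_of_ne _ _ _ (by omega)]
      · rw [Store.write_cell_of_ne _ _ _ _ hj, Store.write_cell_of_ne _ _ _ _ hj,
          Store.write_cell_of_ne _ _ _ _ hj]

lemma loopStore_of_not_writes {f : Store → Store} {i A : ℕ} (hi : A ≠ i)
    (hf : ∀ s, f s A = s A) (s : Store) (m : ℕ) : loopStore f i s m A = s A := by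
  induction m with
  | zero => rfl
  | succ m ih => rw [loopStore, hf, Store.write_array_of_ne _ _ _ hi, ih]

lemma ForProgram.lt_bound_of_writes (P : ForProgram) {A : ℕ} (h : P.Writes A) : A < P.bound := by
  induction P with
  | set B e₁ e₂ => simp only [ForProgram.Writes, ForProgram.bound] at *; omega
  | seq P Q ihP ihQ =>
    simp only [ForProgram.Writes, ForProgram.bound] at *
    rcases h with h | h
    · exact lt_max_of_lt_left (ihP h)
    · exact lt_max_of_lt_right (ihQ h)
  | cond e P ih => exact lt_max_of_lt_right (ih h)
  | loop c i P ih =>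
    simp only [ForProgram.Writes, ForProgram.bound] at *
    rcases h with h | h
    · omega
    · exact lt_max_of_lt_right (ih h)

/-- A program leaves the arrays alone into which it does not write. -/
lemma ForProgram.run_of_not_writes (P : ForProgram) {A : ℕ} :
    ∀ s, ¬ P.Writes A → P.run s A = s A := by
  induction P with
  | set B e₁ e₂ =>
    intro s h
    exact Store.write_array_of_ne _ _ _ h
  | seq P Q ihP ihQ =>
    intro s h
    simp only [ForProgram.Writes, not_or] at h
    rw [ForProgram.run, ihQ _ h.2, ihP _ h.1]
  | cond e P ih =>
    intro s h
    rw [ForProgram.run]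
    split_ifs
    · exact ih s h
    · rfl
  | loop c i P ih =>
    intro s h
    simp only [ForProgram.Writes, not_or] at h
    exact loopStore_of_not_writes h.1 (fun s => ih s h.2) s _

lemma ForProgram.run_input_size (P : ForProgram) (h : ¬ P.Writes 0) (s : Store) :
    P.run s 0 1 = s 0 1 := by
  rw [P.run_of_not_writes s h]

/-- The effect of a program depends only on the arrays that occur in it. -/
lemma ForProgram.run_congr (P : ForProgram) {t : ℕ} (h0 : 0 < t) : ∀ {s s' : Store},
    P.bound ≤ t → (∀ A < t, s A = s' A) → ∀ A < t, P.run s A = P.run s' A := by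
  induction P with
  | set A e₁ e₂ =>
    intro s s' hb h B hB
    simp only [ForProgram.bound, max_le_iff] at hb
    funext j
    simp only [ForProgram.run, Store.write]
    rw [e₁.eval_congr (fun B hB => h B (by omega)) (by rw [h 0 h0]),
      e₂.eval_congr (fun B hB => h B (by omega)) (by rw [h 0 h0]), h B hB]
  | seq P Q ihP ihQ =>
    intro s s' hb h
    simp only [ForProgram.bound, max_le_iff] at hb
    exact ihQ hb.2 (ihP hb.1 h)
  | cond e P ih =>
    intro s s' hb h
    simp only [ForProgram.bound, max_le_iff] at hb
    simp only [ForProgram.run]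
    rw [e.eval_congr (fun B hB => h B (by omega)) (by rw [h 0 h0])]
    split_ifs
    · exact ih hb.2 h
    · exact h
  | loop c i P ih =>
    intro s s' hb h
    simp only [ForProgram.bound, max_le_iff] at hb
    simp only [ForProgram.run]
    rw [h 0 h0]
    generalize s' 0 1 + c = m
    induction m with
    | zero => exact h
    | succ m ihm =>
      refine ih hb.2 fun A hA => ?_
      funext j
      simp only [Store.write]
      rw [ihm A hA]

/-- The compiled program acts on the arrays below `t` as the for program does, within the time
bound. The arrays from `t` on are scratch memory, so only the arrays below `t` of the store `s` have
to agree with the given store `σ`.  Programs must not write into array `0`, as it contains the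
number `n` on which the numbers of rounds depend. -/
lemma ForProgram.exec_compile (P : ForProgram) : ∀ (t : ℕ) (s σ : Store), P.bound ≤ t → 0 < t →
    ¬ P.Writes 0 → (∀ A < t, s A = σ A) →
    ∃ m s', Exec (P.compile t) s m s' ∧ (∀ A < t, s' A = P.run σ A) ∧
      m ≤ P.cost.eval (σ 0 1) := by
  induction P with
  | set A e₁ e₂ =>
    intro t s σ hb h0 hw h
    simp only [ForProgram.bound, max_le_iff] at hb
    obtain ⟨m, s', hx, hv, hs, hm⟩ := e₁.exec_compile t s hb.2.1 h0
    obtain ⟨m', s'', hx', hv', hs', hm'⟩ := e₂.exec_compile (t + 1) s' (by omega) (by omega)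
    have hσ₁ : e₁.eval s = e₁.eval σ := e₁.eval_congr (fun B hB => h B (by omega)) (by rw [h 0 h0])
    have hσ₂ : e₂.eval s' = e₂.eval σ := e₂.eval_congr
      (fun B hB => by rw [hs B (by omega), h B (by omega)]) (by rw [hs 0 h0, h 0 h0])
    refine ⟨_, _, Exec.seq hx (Exec.seq hx' (Exec.set _ _ _ _)), fun B hB => ?_, ?_⟩
    · rw [eval_reg, eval_reg, hv', hs' t (by omega), hv, hσ₁, hσ₂]
      funext j
      simp only [Store.write, ForProgram.run]
      rw [hs' B (by omega), hs B hB, h B hB]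
    · rw [hs 0 h0, h 0 h0] at hm'
      rw [h 0 h0] at hm
      simp [ForProgram.cost, Expr.cost, reg]; omega
  | seq P Q ihP ihQ =>
    intro t s σ hb h0 hw h
    simp only [ForProgram.bound, max_le_iff] at hb
    simp only [ForProgram.Writes, not_or] at hw
    obtain ⟨m, s', hx, hs, hm⟩ := ihP t s σ hb.1 h0 hw.1 h
    obtain ⟨m', s'', hx', hs', hm'⟩ := ihQ t s' _ hb.2 h0 hw.2 hs
    refine ⟨_, _, Exec.seq hx hx', hs', ?_⟩
    rw [P.run_input_size hw.1] at hm'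
    simp [ForProgram.cost]; omega
  | cond e P ih =>
    intro t s σ hb h0 hw h
    simp only [ForProgram.bound, max_le_iff] at hb
    obtain ⟨m, s', hx, hv, hs, hm⟩ := e.exec_compile t s hb.1 h0
    have hσ : e.eval s = e.eval σ := e.eval_congr (fun B hB => h B (by omega)) (by rw [h 0 h0])
    have hs'σ : ∀ A < t, s' A = σ A := fun A hA => by rw [hs A hA, h A hA]
    rw [h 0 h0] at hm
    by_cases hlt : 0 < e.eval σ
    · obtain ⟨m', s'', hx', hs', hm'⟩ := ih t s' σ hb.2 h0 hw hs'σ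
      refine ⟨_, _, Exec.seq hx (Exec.ite_true ?_ hx'), fun B hB => ?_, ?_⟩
      · rw [eval_reg, hv, hσ]; exact hlt
      · rw [hs' B hB, ForProgram.run, if_pos hlt]
      · simp [ForProgram.cost, Expr.cost, reg]; omega
    · refine ⟨_, _, Exec.seq hx (Exec.ite_false ?_ (Exec.skip _)), fun B hB => ?_, ?_⟩
      · rw [eval_reg, hv, hσ]; exact hlt
      · rw [hs'σ B hB, ForProgram.run, if_neg hlt]
      · simp [ForProgram.cost, Expr.cost, reg]; omega
  | loop c i P ih =>
    intro t s σ hb h0 hw h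
    simp only [ForProgram.bound, max_le_iff] at hb
    simp only [ForProgram.Writes, not_or] at hw
    obtain ⟨hi, hb⟩ := hb
    let I : ℕ → Store → Prop := fun v s' => s' t 0 = v ∧ ∀ A < t, s' A = loopStore P.run i σ v A
    have h01 : ∀ v, loopStore P.run i σ v 0 = σ 0 := fun v =>
      loopStore_of_not_writes hw.1 (fun s => P.run_of_not_writes s hw.2) σ v
    have hloop := exec_counting_loop (P := .seq (.set i (.const 0) (reg t)) <|
        .seq (P.compile (t + 1)) <| .set t (.const 0) (.add (reg t) (.const 1)))
        (r := t) (c := c) (n := σ 0 1) (K := P.cost.eval (σ 0 1) + 17) I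
        (fun v s' h => ⟨h.1, by rw [h.2 0 h0, h01]⟩) ?_ (s := s.write t 0 0) ?_
    · obtain ⟨m, s', hx, hs', hm⟩ := hloop
      refine ⟨_, _, Exec.seq (Exec.set _ _ _ _) hx, hs'.2, ?_⟩
      simp only [ForProgram.cost, Expr.cost, Polynomial.eval_add, Polynomial.eval_mul,
          Polynomial.eval_X, Polynomial.eval_C]
      rw [show Polynomial.eval (σ 0 1) P.cost + 24 = Polynomial.eval (σ 0 1) P.cost + 17 + 7 by rfl]
      omega
    · intro v hv s' hs'
      obtain ⟨m, s₁, hx, hs₁, hm⟩ := ih (t + 1) (s'.write i 0 v) (s'.write i 0 v) (by omega)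
        (by omega) hw.2 (fun _ _ => rfl)
      have h0' : (s'.write i 0 v) 0 1 = σ 0 1 := by
        rw [Store.write_cell_of_ne _ _ _ _ one_ne_zero, hs'.2 0 h0, h01]
      rw [h0'] at hm
      -- the body does not know the counter, which is in the scratch variable `t`
      have hst : s₁ t = s' t := by
        rw [hs₁ t (by omega), P.run_of_not_writes _ (fun hc => ?_),
          Store.write_array_of_ne _ _ _ (by omega)]
        exact absurd (P.lt_bound_of_writes hc) (by omega)
      have hx' : Exec (P.compile (t + 1)) (s'.write i ((Expr.const 0).eval s') ((reg t).eval s'))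
          m s₁ := by
        rw [show (reg t).eval s' = v from hs'.1]; exact hx
      refine ⟨_, _, Exec.seq (Exec.set _ _ _ _) (Exec.seq hx' (Exec.set _ _ _ _)),
        ⟨?_, fun A hA => ?_⟩, ?_⟩
      · simp only [Expr.eval, eval_reg]
        rw [Store.write_same, hst, hs'.1]
      · rw [Store.write_array_of_ne _ _ _ (by omega), hs₁ A (by omega)]
        refine P.run_congr h0 hb (fun B hB => ?_) A hA
        funext j
        simp only [Store.write]
        rw [hs'.2 B hB]
      · simp [Expr.cost, reg]; omega
    · refine ⟨by simp, fun A hA => ?_⟩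
      rw [Store.write_array_of_ne _ _ _ hA.ne, h A hA]
      rfl

end RAM

/-! ### Geometry of triangulations and flips -/

namespace LabelledTriangulation

variable {n : ℕ}

/-- The segments `xy` and `uv`, where `x < y` and `u < v`, cross. -/
def Cross (x y u v : ℕ) : Prop :=
  (x < u ∧ u < y ∧ y < v) ∨ (u < x ∧ x < v ∧ v < y)

lemma eq_of_lo_hi (T : LabelledTriangulation n) {j k : Fin n}
    (h₁ : (T.diag j).lo = (T.diag k).lo) (h₂ : (T.diag j).hi = (T.diag k).hi) : j = k :=
  T.injective (Diagonal.ext h₁ h₂)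

lemma not_cross (T : LabelledTriangulation n) (j k : Fin n) :
    ¬ Cross (T.diag j).lo (T.diag j).hi (T.diag k).lo (T.diag k).hi :=
  T.not_crosses j k

lemma exists_diag (T : LabelledTriangulation n) {x y : ℕ} (h : x + 2 ≤ y) (hy : y ≤ n + 2)
    (h0 : ¬ (x = 0 ∧ y = n + 2))
    (hc : ∀ j, ¬ Cross x y (T.diag j).lo (T.diag j).hi) :
    ∃ j, (T.diag j).lo = x ∧ (T.diag j).hi = y := by
  obtain ⟨j, hj⟩ := T.maximal ⟨x, y, h, hy, h0⟩ hc
  exact ⟨j, by rw [hj], by rw [hj]⟩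

lemma hasSegment_diag (T : LabelledTriangulation n) (k : Fin n) :
    T.HasSegment (T.diag k).lo (T.diag k).hi :=
  Or.inr (Or.inr ⟨k, rfl, rfl⟩)

lemma HasSegment.lt {T : LabelledTriangulation n} {x y : ℕ} (h : T.HasSegment x y) : x < y := by
  rcases h with h | h | ⟨j, h₁, h₂⟩
  · omega
  · omega
  · have := (T.diag j).lo_add_two_le; omega

/-- A segment of `T` crosses no chord of the polygon that the edges of `T` different from it do not
cross. -/
lemma HasSegment.not_cross_of {T : LabelledTriangulation n} {x y u v : ℕ} {k : Fin n}
    (h : T.HasSegment x y) (hne : ¬ ((T.diag k).lo = x ∧ (T.diag k).hi = y)) (hv : v ≤ n + 2)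
    (hc : ∀ j, j ≠ k → ¬ Cross u v (T.diag j).lo (T.diag j).hi) : ¬ Cross u v x y := by
  rcases h with h | h | ⟨j, h₁, h₂⟩
  · unfold Cross; omega
  · unfold Cross; omega
  · have := hc j (by rintro rfl; exact hne ⟨h₁, h₂⟩)
    rwa [h₁, h₂] at this

lemma HasSegment.not_cross {T : LabelledTriangulation n} {x y : ℕ} (h : T.HasSegment x y)
    (j : Fin n) : ¬ Cross (T.diag j).lo (T.diag j).hi x y := by
  have := (T.diag j).hi_le
  rcases h with h | h | ⟨i, h₁, h₂⟩
  · unfold Cross; omega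
  · unfold Cross; omega
  · rw [← h₁, ← h₂]; exact T.not_cross j i

/-- Every segment other than the sides `x(x + 1)` is the base of a triangle. -/
lemma HasSegment.exists_apex {T : LabelledTriangulation n} {x y : ℕ} (h : T.HasSegment x y)
    (hxy : x + 2 ≤ y) : ∃ z, x < z ∧ z < y ∧ T.HasSegment x z ∧ T.HasSegment z y := by
  classical
  have hy : y ≤ n + 2 := by
    rcases h with h | h | ⟨j, h₁, h₂⟩
    · omega
    · omega
    · have := (T.diag j).hi_le; omega
  -- the apex is the last vertex before `y` that is joined to `x`
  let s := (Finset.Ioo x y).filter (T.HasSegment x)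
  have hs : s.Nonempty := ⟨x + 1, by simp [s, HasSegment]; omega⟩
  have hz := s.max'_mem hs
  have hmax := s.le_max'
  set z := s.max' hs
  simp only [s, Finset.mem_filter, Finset.mem_Ioo] at hz hmax
  refine ⟨z, hz.1.1, hz.1.2, hz.2, ?_⟩
  by_cases hzy : y = z + 1
  · exact Or.inl hzy
  refine Or.inr (Or.inr (T.exists_diag (by omega) hy (by omega) fun j hj => ?_))
  have h1 := h.not_cross j
  have h2 := hz.2.not_cross j
  have h3 : (T.diag j).lo = x → (T.diag j).hi < y → (T.diag j).hi ≤ z := fun e₁ e₂ =>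
    hmax _ ⟨⟨by have := (T.diag j).lo_add_two_le; omega, e₂⟩, Or.inr (Or.inr ⟨j, e₁, rfl⟩)⟩
  have := (T.diag j).hi_le
  unfold Cross at *
  omega

/-- The triangle at an edge on the side away from the vertices between its endpoints. -/
lemma exists_outer_apex (T : LabelledTriangulation n) (k : Fin n) :
    ∃ r, (r < (T.diag k).lo ∧ T.HasSegment r (T.diag k).lo ∧ T.HasSegment r (T.diag k).hi) ∨
      ((T.diag k).hi < r ∧ T.HasSegment (T.diag k).lo r ∧ T.HasSegment (T.diag k).hi r) := by
  classical
  set p := (T.diag k).lo with hp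
  set q := (T.diag k).hi with hq
  have hpq := (T.diag k).lo_add_two_le
  have hqn := (T.diag k).hi_le
  have h0 := (T.diag k).not_side
  -- the shortest segment that spans the edge is the base of this triangle
  have hex : ∃ m x y, T.HasSegment x y ∧ x ≤ p ∧ q ≤ y ∧ ¬ (x = p ∧ y = q) ∧ y - x = m :=
    ⟨_, 0, n + 2, Or.inr (Or.inl ⟨rfl, rfl⟩), by omega, hqn, by omega, rfl⟩
  obtain ⟨x, y, hxy, hx, hy, hne, hm⟩ := Nat.find_spec hex
  have hmin := fun m => Nat.find_min (m := m) hex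
  rw [← hm] at hmin
  obtain ⟨z, hxz, hzy, h1, h2⟩ := hxy.exists_apex (by omega)
  have c1 := h1.not_cross k
  have c2 := h2.not_cross k
  rw [← hp, ← hq] at c1 c2
  unfold Cross at c1 c2
  rcases (by omega : z ≤ p ∨ q ≤ z) with hz | hz
  · have : z = p ∧ y = q := by
      by_contra hc
      exact hmin (y - z) (by omega) ⟨z, y, h2, hz, hy, hc, rfl⟩
    obtain ⟨rfl, rfl⟩ := this
    exact ⟨x, Or.inl ⟨hxz, h1, hxy⟩⟩
  · have : x = p ∧ z = q := by
      by_contra hc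
      exact hmin (z - x) (by omega) ⟨x, z, h1, hx, hz, hc, rfl⟩
    obtain ⟨rfl, rfl⟩ := this
    exact ⟨y, Or.inr ⟨hzy, hxy, h2⟩⟩

/-- Every edge is a diagonal of a quadrilateral that consists of two triangles. -/
lemma exists_quadrilateral (T : LabelledTriangulation n) (k : Fin n) :
    ∃ a b c d : ℕ, a < b ∧ b < c ∧ c < d ∧ d ≤ n + 2 ∧
      T.HasSegment a b ∧ T.HasSegment b c ∧ T.HasSegment c d ∧ T.HasSegment a d ∧
      (((T.diag k).lo = a ∧ (T.diag k).hi = c) ∨ ((T.diag k).lo = b ∧ (T.diag k).hi = d)) := by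
  have hqn := (T.diag k).hi_le
  obtain ⟨z, h1, h2, h3, h4⟩ := (T.hasSegment_diag k).exists_apex (T.diag k).lo_add_two_le
  obtain ⟨r, ⟨h5, h6, h7⟩ | ⟨h5, h6, h7⟩⟩ := T.exists_outer_apex k
  · exact ⟨r, _, z, _, h5, h1, h2, hqn, h6, h3, h4, h7, Or.inr ⟨rfl, rfl⟩⟩
  · refine ⟨_, z, _, r, h1, h2, h5, ?_, h3, h4, h7, h6, Or.inl ⟨rfl, rfl⟩⟩
    rcases h6 with h | h | ⟨j, -, h⟩
    · omega
    · omega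
    · have := (T.diag j).hi_le; omega

/-- The only chord that crosses one edge of `T` and no other is the other diagonal of the
quadrilateral around this edge. -/
lemma eq_of_cross_only {T : LabelledTriangulation n} {k : Fin n} {a b c d u v : ℕ}
    (hab : T.HasSegment a b) (hbc : T.HasSegment b c) (hcd : T.HasSegment c d)
    (had : T.HasSegment a d) (hv : v ≤ n + 2)
    (hk : ((T.diag k).lo = a ∧ (T.diag k).hi = c) ∨ ((T.diag k).lo = b ∧ (T.diag k).hi = d))
    (hx : Cross u v (T.diag k).lo (T.diag k).hi)
    (hc : ∀ j, j ≠ k → ¬ Cross u v (T.diag j).lo (T.diag j).hi) :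
    ((T.diag k).lo = a ∧ (T.diag k).hi = c ∧ u = b ∧ v = d) ∨
      ((T.diag k).lo = b ∧ (T.diag k).hi = d ∧ u = a ∧ v = c) := by
  have l1 := hab.lt
  have l2 := hbc.lt
  have l3 := hcd.lt
  have c1 := hab.not_cross_of (k := k) (by omega) hv hc
  have c2 := hbc.not_cross_of (k := k) (by omega) hv hc
  have c3 := hcd.not_cross_of (k := k) (by omega) hv hc
  have c4 := had.not_cross_of (k := k) (by omega) hv hc
  generalize (T.diag k).lo = p at *
  generalize (T.diag k).hi = q at *
  clear hc hab hbc hcd had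
  unfold Cross at *
  rcases hk with ⟨rfl, rfl⟩ | ⟨rfl, rfl⟩ <;> rcases hx with hx | hx <;> omega

/-- If a chord crosses exactly one edge of a triangulation, then this edge can be flipped, and the
flip replaces it by the chord. -/
lemma exists_flip_of_cross_only (T : LabelledTriangulation n) (k : Fin n) (d : Diagonal n)
    (hx : Cross d.lo d.hi (T.diag k).lo (T.diag k).hi)
    (hc : ∀ j, j ≠ k → ¬ Cross d.lo d.hi (T.diag j).lo (T.diag j).hi) :
    ∃ T', Flip k T T' ∧ T'.diag k = d := by
  obtain ⟨a, b, c, e, hab, hbc, hce, hen, s1, s2, s3, s4, hk⟩ := T.exists_quadrilateral k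
  have key := fun (u v : ℕ) hv h h' => eq_of_cross_only (u := u) (v := v) s1 s2 s3 s4 hv hk h h'
  have hd := key d.lo d.hi d.hi_le hx hc
  have hupd : ∀ j, j ≠ k → Function.update T.diag k d j = T.diag j := fun j hj =>
    Function.update_of_ne hj _ _
  refine ⟨⟨Function.update T.diag k d, ?_, ?_, ?_⟩, ⟨hupd, a, b, c, e, hab, hbc, hce, s1, s2, s3,
    s4, ?_⟩, by simp⟩
  · intro i j hij
    by_contra hne
    have aux : ∀ j, j ≠ k → T.diag j ≠ d := fun j hj h => by
      have := T.not_cross j k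
      rw [h] at this
      exact this hx
    by_cases hi : i = k
    · subst hi
      rw [hupd j (Ne.symm hne), Function.update_self] at hij
      exact aux j (Ne.symm hne) hij.symm
    · by_cases hj : j = k
      · subst hj
        rw [hupd i hi, Function.update_self] at hij
        exact aux i hi hij
      · rw [hupd i hi, hupd j hj] at hij
        exact hne (T.injective hij)
  · intro i j
    by_cases hi : i = k
    · by_cases hj : j = k
      · rw [hi, hj]; unfold Diagonal.Crosses; omega
      · rw [hi, hupd j hj, Function.update_self]
        exact hc j hj
    · by_cases hj : j = k
      · rw [hj, hupd i hi, Function.update_self]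
        have := hc i hi
        unfold Cross at this
        unfold Diagonal.Crosses
        omega
      · rw [hupd i hi, hupd j hj]
        exact T.not_crosses i j
  · intro f hf
    have hfj : ∀ j, j ≠ k → ¬ Cross f.lo f.hi (T.diag j).lo (T.diag j).hi := fun j hj => by
      have := hf j
      rwa [hupd j hj] at this
    have hfd : ¬ Cross f.lo f.hi d.lo d.hi := by
      have := hf k
      rwa [Function.update_self] at this
    by_cases hfk : Cross f.lo f.hi (T.diag k).lo (T.diag k).hi
    · refine ⟨k, ?_⟩
      rw [Function.update_self]
      have := key f.lo f.hi f.hi_le hfk hfj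
      exact Diagonal.ext (by omega) (by omega)
    · obtain ⟨j, hj⟩ := T.maximal f fun j => by
        by_cases hj : j = k
        · rw [hj]; exact hfk
        · exact hfj j hj
      refine ⟨j, ?_⟩
      rw [hupd j, hj]
      rintro rfl
      rw [hj] at hx
      unfold Cross at hfd hx
      omega
  · simp only [Function.update_self]
    omega

lemma Flip.diag_of_ne {T T' : LabelledTriangulation n} {j k : Fin n} (h : Flip k T T')
    (hj : j ≠ k) : T'.diag j = T.diag j :=
  h.1 j hj

/-- The two diagonals that are exchanged by a flip cross. -/
lemma Flip.cross {T T' : LabelledTriangulation n} {k : Fin n} (h : Flip k T T') :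
    Cross (T'.diag k).lo (T'.diag k).hi (T.diag k).lo (T.diag k).hi := by
  obtain ⟨-, a, b, c, d, h1, h2, h3, -, -, -, -, h⟩ := h
  unfold Cross
  omega

lemma Flip.symm {T T' : LabelledTriangulation n} {k : Fin n} (h : Flip k T T') : Flip k T' T := by
  have hx := h.cross
  obtain ⟨S, hS, hSk⟩ := T'.exists_flip_of_cross_only k (T.diag k)
    (by unfold Cross at *; omega) fun j hj => by rw [h.diag_of_ne hj]; exact T.not_cross k j
  suffices S = T by rwa [this] at hS
  ext j : 2
  by_cases hj : j = k
  · rw [hj, hSk]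
  · rw [hS.diag_of_ne hj, h.diag_of_ne hj]

lemma mem_leftLabels {T : LabelledTriangulation n} {j k : Fin n} : j ∈ T.leftLabels k ↔
    j ≠ k ∧ (T.diag k).lo ≤ (T.diag j).lo ∧ (T.diag j).hi ≤ (T.diag k).hi := by
  simp [leftLabels]

/-- A chord that does not cross the sides of a quadrilateral, and that is none of its diagonals,
has both diagonals on the same side. -/
lemma spans_diagonals_iff {a b c d u v : ℕ} (l1 : a < b) (l2 : b < c) (l3 : c < d)
    (c1 : ¬ Cross u v a b) (c2 : ¬ Cross u v c d) (c3 : ¬ Cross u v a d)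
    (h : ¬ (a = u ∧ c = v)) (h' : ¬ (b = u ∧ d = v)) :
    (u ≤ a ∧ c ≤ v ↔ u ≤ b ∧ d ≤ v) := by
  unfold Cross at *
  constructor <;> intro h <;> omega

/-- A flip does not move the flipped edge to the other side of another edge. -/
lemma Flip.leftLabels_eq {T T' : LabelledTriangulation n} {j k : Fin n} (h : Flip k T T')
    (hj : j ≠ k) : T'.leftLabels j = T.leftLabels j := by
  ext i
  rw [mem_leftLabels, mem_leftLabels, h.diag_of_ne hj]
  by_cases hi : i = k
  · subst hi
    have h1 : ¬ ((T.diag i).lo = (T.diag j).lo ∧ (T.diag i).hi = (T.diag j).hi) :=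
      fun hh => hj (T.eq_of_lo_hi hh.1 hh.2).symm
    have h2 : ¬ ((T'.diag i).lo = (T.diag j).lo ∧ (T'.diag i).hi = (T.diag j).hi) := by
      rw [← h.diag_of_ne hj]
      exact fun hh => hj (T'.eq_of_lo_hi hh.1 hh.2).symm
    obtain ⟨-, a, b, c, d, l1, l2, l3, s1, -, s3, s4, hq⟩ := h
    have key := fun h h' => spans_diagonals_iff l1 l2 l3 (s1.not_cross j) (s3.not_cross j)
      (s4.not_cross j) h h'
    refine and_congr_right fun _ => ?_
    rcases hq with ⟨e1, e2, e3, e4⟩ | ⟨e1, e2, e3, e4⟩ <;> rw [e1, e2] at h1 <;>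
      rw [e3, e4] at h2 <;> rw [e1, e2, e3, e4]
    · exact (key h1 h2).symm
    · exact key h2 h1
  · rw [h.diag_of_ne hi]

lemma FlipSeq.append {T T' T'' : LabelledTriangulation n} {l l' : List (Fin n)}
    (h : FlipSeq l T T') (h' : FlipSeq l' T' T'') : FlipSeq (l ++ l') T T'' := by
  induction l generalizing T with
  | nil => obtain rfl : T = T' := h; exact h'
  | cons k l ih =>
    obtain ⟨S, hS, hl⟩ := h
    exact ⟨S, hS, ih hl⟩

lemma Flip.flipSeq {T T' : LabelledTriangulation n} {k : Fin n} (h : Flip k T T') :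
    FlipSeq [k] T T' :=
  ⟨T', h, rfl⟩

lemma FlipSeq.reverse {T T' : LabelledTriangulation n} {l : List (Fin n)} (h : FlipSeq l T T') :
    FlipSeq l.reverse T' T := by
  induction l generalizing T with
  | nil => exact Eq.symm h
  | cons k l ih =>
    obtain ⟨S, hS, hl⟩ := h
    rw [List.reverse_cons]
    exact (ih hl).append hS.symm.flipSeq

/-- An edge that is never flipped keeps its place and the set of labels to its left. -/
lemma FlipSeq.fixed_of_not_mem {T T' : LabelledTriangulation n} {l : List (Fin n)}
    (h : FlipSeq l T T') {k : Fin n} (hk : k ∉ l) : Fixed T T' k := by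
  induction l generalizing T with
  | nil => obtain rfl : T = T' := h; exact ⟨rfl, rfl⟩
  | cons j l ih =>
    obtain ⟨S, hS, hl⟩ := h
    rw [List.mem_cons, not_or] at hk
    obtain ⟨h1, h2⟩ := ih hl hk.2
    exact ⟨by rw [← h1, hS.diag_of_ne hk.1], by rw [← h2, hS.leftLabels_eq hk.1]⟩

end LabelledTriangulation

/-! ### Exchanging the labels of neighbouring edges -/

namespace LabelledTriangulation

variable {n : ℕ}

/-- The diagonals of the pentagon `abcde`, in the cyclic order in which neighbours do not cross. -/
def pentagon (a b c d e : ℕ) (h : a < b ∧ b < c ∧ c < d ∧ d < e ∧ e ≤ n + 2) :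
    Fin 5 → Diagonal n :=
  ![⟨a, c, by omega, by omega, by omega⟩, ⟨a, d, by omega, by omega, by omega⟩,
    ⟨b, d, by omega, by omega, by omega⟩, ⟨b, e, by omega, by omega, by omega⟩,
    ⟨c, e, by omega, by omega, by omega⟩]

/-- Two edges share a triangle if no other edge separates them. -/
def Adjacent (T : LabelledTriangulation n) (j k : Fin n) : Prop :=
  j ≠ k ∧ ∀ g, g ≠ j → g ≠ k → (j ∈ T.leftLabels g ↔ k ∈ T.leftLabels g)

lemma Adjacent.symm {T : LabelledTriangulation n} {j k : Fin n} (h : T.Adjacent j k) :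
    T.Adjacent k j :=
  ⟨h.1.symm, fun g h₁ h₂ => (h.2 g h₂ h₁).symm⟩

lemma HasSegment.exists_edge {T : LabelledTriangulation n} {x y : ℕ} (h : T.HasSegment x y)
    (h₁ : x + 2 ≤ y) (h₂ : ¬ (x = 0 ∧ y = n + 2)) :
    ∃ g, (T.diag g).lo = x ∧ (T.diag g).hi = y := by
  rcases h with h | h | h
  · omega
  · exact absurd h h₂
  · exact h

lemma HasSegment.le {T : LabelledTriangulation n} {x y : ℕ} (h : T.HasSegment x y)
    (h₁ : x + 2 ≤ y) : y ≤ n + 2 := by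
  rcases h with h | h | ⟨j, -, rfl⟩
  · omega
  · omega
  · exact (T.diag j).hi_le

/-- The edges `j` and `k` of `T` are the two diagonals inside a pentagon that consists of three
triangles of `T`. -/
def InPentagon (T : LabelledTriangulation n) (j k : Fin n) : Prop :=
  ∃ a b c d e, ∃ h : a < b ∧ b < c ∧ c < d ∧ d < e ∧ e ≤ n + 2,
    T.HasSegment a b ∧ T.HasSegment b c ∧ T.HasSegment c d ∧ T.HasSegment d e ∧ T.HasSegment a e ∧
    ∃ i : Fin 5,
      (T.diag k = pentagon a b c d e h i ∧ T.diag j = pentagon a b c d e h (i + 1)) ∨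
      (T.diag j = pentagon a b c d e h i ∧ T.diag k = pentagon a b c d e h (i + 1))

lemma InPentagon.symm {T : LabelledTriangulation n} {j k : Fin n} (h : T.InPentagon j k) :
    T.InPentagon k j := by
  obtain ⟨a, b, c, d, e, h, s1, s2, s3, s4, s5, i, hi⟩ := h
  exact ⟨a, b, c, d, e, h, s1, s2, s3, s4, s5, i, hi.symm⟩

lemma Adjacent.inPentagon_of_mem {T : LabelledTriangulation n} {j k : Fin n}
    (h : T.Adjacent j k) (hjk : j ∈ T.leftLabels k) : T.InPentagon j k := by
  obtain ⟨hne, h⟩ := h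
  simp only [mem_leftLabels] at h hjk
  obtain ⟨-, hlo, hhi⟩ := hjk
  have hk2 := (T.diag k).lo_add_two_le
  have hj2 := (T.diag j).lo_add_two_le
  have hkn := (T.diag k).hi_le
  have hk0 := (T.diag k).not_side
  obtain ⟨z, hxz, hzy, s1, s2⟩ := (T.hasSegment_diag k).exists_apex hk2
  obtain ⟨w, hjw, hwj, t1, t2⟩ := (T.hasSegment_diag j).exists_apex hj2
  have c1 := s1.not_cross j
  have c2 := s2.not_cross j
  have hjk : ¬ ((T.diag j).lo = (T.diag k).lo ∧ (T.diag j).hi = (T.diag k).hi) :=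
    fun hh => hne (T.eq_of_lo_hi hh.1 hh.2)
  have hj : ((T.diag j).lo = (T.diag k).lo ∧ (T.diag j).hi = z) ∨
      ((T.diag j).lo = z ∧ (T.diag j).hi = (T.diag k).hi) := by
    unfold Cross at c1 c2
    -- otherwise a side of the triangle below `k` separates `j` from `k`
    rcases (by omega : (T.diag j).hi ≤ z ∨ z ≤ (T.diag j).lo) with hz | hz
    · by_contra hc
      obtain ⟨g, hg1, hg2⟩ := s1.exists_edge (by omega) (by omega)
      have hgj : g ≠ j := by rintro rfl; omega
      have hgk : g ≠ k := by rintro rfl; omega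
      have := (h g hgj hgk).1 ⟨hgj.symm, by omega, by omega⟩
      omega
    · by_contra hc
      obtain ⟨g, hg1, hg2⟩ := s2.exists_edge (by omega) (by omega)
      have hgj : g ≠ j := by rintro rfl; omega
      have hgk : g ≠ k := by rintro rfl; omega
      have := (h g hgj hgk).1 ⟨hgj.symm, by omega, by omega⟩
      omega
  obtain ⟨r, ⟨hr, r1, r2⟩ | ⟨hr, r1, r2⟩⟩ := T.exists_outer_apex k
  · rcases hj with ⟨hj1, hj2⟩ | ⟨hj1, hj2⟩
    · rw [hj1] at t1 hjw
      rw [hj2] at t2 hwj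
      exact ⟨r, _, w, z, _, ⟨hr, hjw, hwj, hzy, hkn⟩, r1, t1, t2, s2, r2, 2,
        Or.inr ⟨Diagonal.ext hj1 hj2, Diagonal.ext rfl rfl⟩⟩
    · rw [hj1] at t1 hjw
      rw [hj2] at t2 hwj
      exact ⟨r, _, z, w, _, ⟨hr, hxz, hjw, hwj, hkn⟩, r1, s1, t1, t2, r2, 3,
        Or.inl ⟨Diagonal.ext rfl rfl, Diagonal.ext hj1 hj2⟩⟩
  · have hrn := r1.le (by omega)
    rcases hj with ⟨hj1, hj2⟩ | ⟨hj1, hj2⟩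
    · rw [hj1] at t1 hjw
      rw [hj2] at t2 hwj
      exact ⟨_, w, z, _, r, ⟨hjw, hwj, hzy, hr, hrn⟩, t1, t2, s2, r2, r1, 0,
        Or.inr ⟨Diagonal.ext hj1 hj2, Diagonal.ext rfl rfl⟩⟩
    · rw [hj1] at t1 hjw
      rw [hj2] at t2 hwj
      exact ⟨_, z, w, _, r, ⟨hxz, hjw, hwj, hr, hrn⟩, s1, t1, t2, r2, r1, 1,
        Or.inl ⟨Diagonal.ext rfl rfl, Diagonal.ext hj1 hj2⟩⟩

lemma Adjacent.inPentagon_of_le {T : LabelledTriangulation n} {j k : Fin n}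
    (h : T.Adjacent j k) (hjk : (T.diag j).hi ≤ (T.diag k).lo) : T.InPentagon j k := by
  obtain ⟨hne, h⟩ := h
  simp only [mem_leftLabels] at h
  have hk2 := (T.diag k).lo_add_two_le
  have hj2 := (T.diag j).lo_add_two_le
  have hkn := (T.diag k).hi_le
  obtain ⟨w, hjw, hwj, t1, t2⟩ := (T.hasSegment_diag j).exists_apex hj2
  obtain ⟨z, hkz, hzk, s1, s2⟩ := (T.hasSegment_diag k).exists_apex hk2
  obtain ⟨r, ⟨hr, r1, r2⟩ | ⟨hr, r1, r2⟩⟩ := T.exists_outer_apex j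
  · exfalso
    obtain ⟨g, hg1, hg2⟩ := r2.exists_edge (by omega) (by omega)
    have hgj : g ≠ j := by rintro rfl; omega
    have hgk : g ≠ k := by rintro rfl; omega
    have := (h g hgj hgk).1 ⟨hgj.symm, by omega, by omega⟩
    omega
  · have hrn := r1.le (by omega)
    have hkr : (T.diag k).hi ≤ r := by
      by_contra hc
      obtain ⟨g, hg1, hg2⟩ := r1.exists_edge (by omega) (by omega)
      have hgj : g ≠ j := by rintro rfl; omega
      have hgk : g ≠ k := by rintro rfl; omega
      have := (h g hgj hgk).1 ⟨hgj.symm, by omega, by omega⟩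
      omega
    have hk : (T.diag k).lo = (T.diag j).hi ∧ (T.diag k).hi = r := by
      by_contra hc
      obtain ⟨g, hg1, hg2⟩ := r2.exists_edge (by omega) (by omega)
      have hgj : g ≠ j := by rintro rfl; omega
      have hgk : g ≠ k := by rintro rfl; omega
      have := (h g hgj hgk).2 ⟨hgk.symm, by omega, by omega⟩
      omega
    rw [hk.1] at s1 hkz
    rw [hk.2] at s2 hzk
    exact ⟨_, w, _, z, r, ⟨hjw, hwj, hkz, hzk, hrn⟩, t1, t2, s1, s2, r1, 4,
      Or.inl ⟨Diagonal.ext hk.1 hk.2, Diagonal.ext rfl rfl⟩⟩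

/-- Two edges that share a triangle are the diagonals inside a pentagon: one of them is below the
other, or their spans are side by side. -/
lemma Adjacent.inPentagon {T : LabelledTriangulation n} {j k : Fin n}
    (h : T.Adjacent j k) : T.InPentagon j k := by
  have hc := T.not_cross j k
  have hk2 := (T.diag k).lo_add_two_le
  have hj2 := (T.diag j).lo_add_two_le
  rcases (by unfold Cross at hc; omega : (T.diag j).hi ≤ (T.diag k).lo ∨
      (T.diag k).hi ≤ (T.diag j).lo ∨
      ((T.diag k).lo ≤ (T.diag j).lo ∧ (T.diag j).hi ≤ (T.diag k).hi) ∨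
      ((T.diag j).lo ≤ (T.diag k).lo ∧ (T.diag k).hi ≤ (T.diag j).hi)) with h' | h' | h' | h'
  · exact h.inPentagon_of_le h'
  · exact (h.symm.inPentagon_of_le h').symm
  · exact h.inPentagon_of_mem (mem_leftLabels.2 ⟨h.1, h'⟩)
  · exact (h.symm.inPentagon_of_mem (mem_leftLabels.2 ⟨h.1.symm, h'⟩)).symm

lemma pentagon_cross (a b c d e : ℕ) (h : a < b ∧ b < c ∧ c < d ∧ d < e ∧ e ≤ n + 2) (i : Fin 5) :
    Cross (pentagon a b c d e h i).lo (pentagon a b c d e h i).hi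
      (pentagon a b c d e h (i + 2)).lo (pentagon a b c d e h (i + 2)).hi := by
  fin_cases i <;> (simp [pentagon, Cross]; omega)

lemma pentagon_not_cross (a b c d e : ℕ) (h : a < b ∧ b < c ∧ c < d ∧ d < e ∧ e ≤ n + 2)
    (i : Fin 5) :
    ¬ Cross (pentagon a b c d e h i).lo (pentagon a b c d e h i).hi
      (pentagon a b c d e h (i + 1)).lo (pentagon a b c d e h (i + 1)).hi := by
  fin_cases i <;> simp [pentagon, Cross]
  omega

/-- A chord that crosses a diagonal of a pentagon, but none of its sides, is a diagonal of the
pentagon. -/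
lemma eq_of_cross_pentagon {a b c d e : ℕ} (h : a < b ∧ b < c ∧ c < d ∧ d < e ∧ e ≤ n + 2)
    (f : Diagonal n) (c1 : ¬ Cross f.lo f.hi a b) (c2 : ¬ Cross f.lo f.hi b c)
    (c3 : ¬ Cross f.lo f.hi c d) (c4 : ¬ Cross f.lo f.hi d e) (c5 : ¬ Cross f.lo f.hi a e)
    (i : Fin 5) (hi : Cross (pentagon a b c d e h i).lo (pentagon a b c d e h i).hi f.lo f.hi) :
    f = pentagon a b c d e h (i + 2) ∨ f = pentagon a b c d e h (i + 3) := by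
  simp only [Diagonal.ext_iff]
  unfold Cross at *
  fin_cases i <;> simp [pentagon] at hi ⊢ <;> rcases hi with hi | hi <;> omega

/-- One of five flips in a pentagon: the label `x` moves from the diagonal `p` to the diagonal `r`,
while the label `y` stays at `q`. -/
lemma exists_flip_of_pentagon {T S : LabelledTriangulation n} {x y : Fin n}
    (hS : ∀ g, g ≠ x → g ≠ y → S.diag g = T.diag g) {q r : Diagonal n}
    (hq : S.diag y = q) (h₁ : Cross r.lo r.hi (S.diag x).lo (S.diag x).hi)
    (h₂ : ¬ Cross r.lo r.hi q.lo q.hi)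
    (h₃ : ∀ g, g ≠ x → g ≠ y → ¬ Cross r.lo r.hi (T.diag g).lo (T.diag g).hi) :
    ∃ S', Flip x S S' ∧ S'.diag x = r ∧ (y ≠ x → S'.diag y = q) ∧
      ∀ g, g ≠ x → g ≠ y → S'.diag g = T.diag g := by
  obtain ⟨S', hf, hr⟩ := S.exists_flip_of_cross_only x r h₁ fun j hj => by
    by_cases hy : j = y
    · rw [hy, hq]; exact h₂
    · rw [hS j hj hy]; exact h₃ j hj hy
  exact ⟨S', hf, hr, fun hyx => by rw [hf.diag_of_ne hyx, hq],
    fun g h h' => by rw [hf.diag_of_ne h, hS g h h']⟩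

lemma Cross.symm {x y u v : ℕ} (h : Cross x y u v) : Cross u v x y := by
  unfold Cross at *; omega

/-- Flipping the two diagonals inside a pentagon alternately, five times in all, leads back to the
same diagonals, with the labels exchanged. -/
lemma exists_swap_of_cycle {T : LabelledTriangulation n} {j k : Fin n} (hjk : j ≠ k)
    (P : Fin 5 → Diagonal n) (hP : ∀ i, Cross (P i).lo (P i).hi (P (i + 2)).lo (P (i + 2)).hi)
    (hP' : ∀ i, ¬ Cross (P i).lo (P i).hi (P (i + 1)).lo (P (i + 1)).hi)
    (hk : T.diag k = P 0) (hj : T.diag j = P 1)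
    (h : ∀ g, g ≠ k → g ≠ j → ∀ i, ¬ Cross (P i).lo (P i).hi (T.diag g).lo (T.diag g).hi) :
    ∃ T', FlipSeq [k, j, k, j, k] T T' ∧ T'.diag k = T.diag j ∧ T'.diag j = T.diag k ∧
      ∀ g, g ≠ k → g ≠ j → T'.diag g = T.diag g := by
  have h' : ∀ g, g ≠ j → g ≠ k → ∀ i, ¬ Cross (P i).lo (P i).hi (T.diag g).lo (T.diag g).hi :=
    fun g h1 h2 => h g h2 h1
  obtain ⟨S₁, f₁, k₁, j₁, o₁⟩ := exists_flip_of_pentagon (x := k) (y := j) (r := P 2)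
    (fun g _ _ => rfl) hj (by rw [hk]; exact (hP 0).symm) (fun hc => hP' 1 hc.symm)
    fun g h1 h2 => h g h1 h2 2
  obtain ⟨S₂, f₂, j₂, k₂, o₂⟩ := exists_flip_of_pentagon (x := j) (y := k) (r := P 3)
    (fun g h1 h2 => o₁ g h2 h1) k₁ (by rw [j₁ hjk]; exact (hP 1).symm) (fun hc => hP' 2 hc.symm)
    fun g h1 h2 => h' g h1 h2 3
  obtain ⟨S₃, f₃, k₃, j₃, o₃⟩ := exists_flip_of_pentagon (x := k) (y := j) (r := P 4)
    (fun g h1 h2 => o₂ g h2 h1) j₂ (by rw [k₂ hjk.symm]; exact (hP 2).symm)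
    (fun hc => hP' 3 hc.symm) fun g h1 h2 => h g h1 h2 4
  obtain ⟨S₄, f₄, j₄, k₄, o₄⟩ := exists_flip_of_pentagon (x := j) (y := k) (r := P 0)
    (fun g h1 h2 => o₃ g h2 h1) k₃ (by rw [j₃ hjk]; exact (hP 3).symm) (fun hc => hP' 4 hc.symm)
    fun g h1 h2 => h' g h1 h2 0
  obtain ⟨S₅, f₅, k₅, j₅, o₅⟩ := exists_flip_of_pentagon (x := k) (y := j) (r := P 1)
    (fun g h1 h2 => o₄ g h2 h1) j₄ (by rw [k₄ hjk.symm]; exact (hP 4).symm)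
    (fun hc => hP' 0 hc.symm) fun g h1 h2 => h g h1 h2 1
  exact ⟨S₅, ⟨S₁, f₁, S₂, f₂, S₃, f₃, S₄, f₄, S₅, f₅, rfl⟩, by rw [k₅, hj],
    by rw [j₅ hjk, hk], o₅⟩

/-- The labels of two edges that share a triangle can be exchanged by five flips. -/
lemma Adjacent.exists_swap {T : LabelledTriangulation n} {j k : Fin n} (h : T.Adjacent j k) :
    ∃ T', FlipSeq [k, j, k, j, k] T T' ∧ T'.diag k = T.diag j ∧ T'.diag j = T.diag k ∧
      ∀ g, g ≠ k → g ≠ j → T'.diag g = T.diag g := by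
  obtain ⟨a, b, c, d, e, ho, s1, s2, s3, s4, s5, i, hi⟩ := h.inPentagon
  set P := pentagon a b c d e ho with hPdef
  have hP := pentagon_cross a b c d e ho
  have hP' := pentagon_not_cross a b c d e ho
  have hq : ∀ g m, Cross (P m).lo (P m).hi (T.diag g).lo (T.diag g).hi →
      T.diag g = P (m + 2) ∨ T.diag g = P (m + 3) := fun g m =>
    eq_of_cross_pentagon ho (T.diag g) (s1.not_cross g) (s2.not_cross g) (s3.not_cross g)
      (s4.not_cross g) (s5.not_cross g) m
  rw [← hPdef] at hP hP'
  -- a third edge cannot be a diagonal of the pentagon, as it crosses neither `j` nor `k`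
  have hother : ∀ g, g ≠ k → g ≠ j → ∀ m, T.diag g ≠ P m := by
    intro g hgk hgj m hm
    have e1 : ∀ m, T.diag k = P m → T.diag g ≠ P m ∧ T.diag g ≠ P (m + 2) ∧
        T.diag g ≠ P (m + 3) := fun m hk => by
      refine ⟨fun hh => hgk (T.injective (by rw [hh, hk])), fun hh => ?_, fun hh => ?_⟩
      · have := T.not_cross k g
        rw [hk, hh] at this
        exact this (hP m)
      · have := T.not_cross g k
        rw [hk, hh] at this
        have h2 := hP (m + 3)
        rw [show m + 3 + 2 = m by rw [add_assoc]; simp] at h2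
        exact this h2
    have e2 : ∀ m, T.diag j = P m → T.diag g ≠ P m ∧ T.diag g ≠ P (m + 2) ∧
        T.diag g ≠ P (m + 3) := fun m hk => by
      refine ⟨fun hh => hgj (T.injective (by rw [hh, hk])), fun hh => ?_, fun hh => ?_⟩
      · have := T.not_cross j g
        rw [hk, hh] at this
        exact this (hP m)
      · have := T.not_cross g j
        rw [hk, hh] at this
        have h2 := hP (m + 3)
        rw [show m + 3 + 2 = m by rw [add_assoc]; simp] at h2
        exact this h2
    have key : ∀ i m : Fin 5, m = i ∨ m = i + 2 ∨ m = i + 3 ∨ m = i + 1 ∨ m = i + 1 + 2 ∨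
        m = i + 1 + 3 := by decide
    rcases hi with ⟨h1, h2⟩ | ⟨h1, h2⟩
    · have := e1 i h1
      have := e2 _ h2
      rcases key i m with rfl | rfl | rfl | rfl | rfl | rfl <;> tauto
    · have := e2 i h1
      have := e1 _ h2
      rcases key i m with rfl | rfl | rfl | rfl | rfl | rfl <;> tauto
  have hnc : ∀ g, g ≠ k → g ≠ j → ∀ m, ¬ Cross (P m).lo (P m).hi (T.diag g).lo (T.diag g).hi :=
    fun g h1 h2 m hm => by
      rcases hq g m hm with hh | hh
      · exact hother g h1 h2 _ hh
      · exact hother g h1 h2 _ hh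
  rcases hi with ⟨h1, h2⟩ | ⟨h1, h2⟩
  · refine exists_swap_of_cycle h.1 (fun m => P (i + m)) (fun m => ?_) (fun m => ?_) (by simpa)
      h2 fun g hg hg' m => hnc g hg hg' _
    · rw [← add_assoc]; exact hP _
    · rw [← add_assoc]; exact hP' _
  · refine exists_swap_of_cycle h.1 (fun m => P (i + 1 - m)) (fun m => ?_) (fun m => ?_) (by simpa)
      (by simpa) fun g hg hg' m => hnc g hg hg' _
    · have := hP (i + 1 - (m + 2))
      rw [show i + 1 - (m + 2) + 2 = i + 1 - m by abel] at this
      exact this.symm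
    · have := hP' (i + 1 - (m + 1))
      rw [show i + 1 - (m + 1) + 1 = i + 1 - m by abel] at this
      exact fun hc => this hc.symm

end LabelledTriangulation

/-! ### Levels, and the canonical triangulation -/

namespace LabelledTriangulation

variable {n : ℕ}

lemma HasSegment.not_cross_segment {T : LabelledTriangulation n} {x y u v : ℕ}
    (h : T.HasSegment x y) (h' : T.HasSegment u v) : ¬ Cross u v x y := by
  rcases h' with h' | h' | ⟨j, rfl, rfl⟩
  · unfold Cross; omega
  · rcases h with h | h | ⟨i, rfl, rfl⟩
    · unfold Cross; omega
    · unfold Cross; omega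
    · have := (T.diag i).hi_le
      unfold Cross; omega
  · exact h.not_cross j

/-- In a quadrilateral that consists of two triangles, the diagonal can be flipped. -/
lemma exists_flip_of_quadrilateral {T : LabelledTriangulation n} {k : Fin n} {a b c d : ℕ}
    (hab : T.HasSegment a b) (hbc : T.HasSegment b c) (hcd : T.HasSegment c d)
    (had : T.HasSegment a d)
    (hk : ((T.diag k).lo = a ∧ (T.diag k).hi = c) ∨ ((T.diag k).lo = b ∧ (T.diag k).hi = d)) :
    ∃ T', Flip k T T' ∧
      (((T.diag k).lo = a ∧ (T.diag k).hi = c ∧ (T'.diag k).lo = b ∧ (T'.diag k).hi = d) ∨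
        ((T.diag k).lo = b ∧ (T.diag k).hi = d ∧ (T'.diag k).lo = a ∧ (T'.diag k).hi = c)) := by
  have l1 := hab.lt
  have l2 := hbc.lt
  have l3 := hcd.lt
  have l4 := had.le (by omega)
  have key : ∀ j, j ≠ k → ∀ u v, Cross u v (T.diag j).lo (T.diag j).hi →
      ((T.diag k).lo = a ∧ (T.diag k).hi = c → ¬ (u = b ∧ v = d)) ∧
      ((T.diag k).lo = b ∧ (T.diag k).hi = d → ¬ (u = a ∧ v = c)) := by
    intro j hj u v hx
    have c1 := hab.not_cross j
    have c2 := hbc.not_cross j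
    have c3 := hcd.not_cross j
    have c4 := had.not_cross j
    have c5 : ¬ ((T.diag j).lo = (T.diag k).lo ∧ (T.diag j).hi = (T.diag k).hi) :=
      fun hh => hj (T.eq_of_lo_hi hh.1 hh.2)
    have := (T.diag j).lo_add_two_le
    unfold Cross at *
    constructor
    · rintro ⟨e1, e2⟩ ⟨rfl, rfl⟩
      rw [e1, e2] at c5
      rcases hx with hx | hx <;> omega
    · rintro ⟨e1, e2⟩ ⟨rfl, rfl⟩
      rw [e1, e2] at c5
      rcases hx with hx | hx <;> omega
  rcases hk with ⟨h1, h2⟩ | ⟨h1, h2⟩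
  · obtain ⟨T', hf, hd⟩ := T.exists_flip_of_cross_only k
      ⟨b, d, by omega, by omega, by omega⟩ (by simp only [Cross]; omega)
      fun j hj hx => (key j hj _ _ hx).1 ⟨h1, h2⟩ ⟨rfl, rfl⟩
    exact ⟨T', hf, Or.inl ⟨h1, h2, by rw [hd], by rw [hd]⟩⟩
  · obtain ⟨T', hf, hd⟩ := T.exists_flip_of_cross_only k
      ⟨a, c, by omega, by omega, by omega⟩ (by simp only [Cross]; omega)
      fun j hj hx => (key j hj _ _ hx).2 ⟨h1, h2⟩ ⟨rfl, rfl⟩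
    exact ⟨T', hf, Or.inr ⟨h1, h2, by rw [hd], by rw [hd]⟩⟩

/-- The triangulation `S` contains the fixed edges of `T₁` and `T₂`, with the same labels to their
left. -/
def Compatible (T₁ T₂ S : LabelledTriangulation n) : Prop :=
  ∀ f, Fixed T₁ T₂ f → Fixed T₁ S f

/-- The labels `i` and `j` are on the same side of every fixed edge. -/
def SameRegion (T₁ T₂ : LabelledTriangulation n) (i j : Fin n) : Prop :=
  ∀ f, Fixed T₁ T₂ f → (j ∈ T₁.leftLabels f ↔ i ∈ T₁.leftLabels f)

/-- The vertices of the subpolygon of the edge with label `k`, except for the two endpoints of its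
base: the base is the side that separates the subpolygon from the polygon side `0(n + 2)`, or is
this side. -/
def regionVertices (T₁ T₂ : LabelledTriangulation n) (k : Fin n) : Finset ℕ :=
  (Finset.Ioo 0 (n + 2)).filter fun v => ∀ f, Fixed T₁ T₂ f →
    ((T₁.diag f).lo < v ∧ v < (T₁.diag f).hi ↔ k ∈ T₁.leftLabels f)

/-- The priority of the `r`-th vertex of a subpolygon is `1 + ν₂(r)`, where the endpoints of the
base are not counted.  So chords that span no vertex of the subpolygon have a level below all
priorities. -/
def priority (T₁ T₂ : LabelledTriangulation n) (k : Fin n) (v : ℕ) : ℕ :=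
  1 + padicValNat 2 ((regionVertices T₁ T₂ k).filter (· ≤ v)).card

/-- The level of a chord `xy` in the subpolygon of `k`: the largest priority of a vertex of the
subpolygon strictly between `x` and `y`. -/
def level (T₁ T₂ : LabelledTriangulation n) (k : Fin n) (x y : ℕ) : ℕ :=
  ((regionVertices T₁ T₂ k).filter fun v => x < v ∧ v < y).sup (priority T₁ T₂ k)

/-- No flip of a non-fixed edge decreases the level of this edge. -/
def Stable (T₁ T₂ S : LabelledTriangulation n) : Prop :=
  ∀ k, ¬ Fixed T₁ T₂ k → ∀ S', Flip k S S' →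
    ¬ level T₁ T₂ k (S'.diag k).lo (S'.diag k).hi < level T₁ T₂ k (S.diag k).lo (S.diag k).hi

/-- The chord `xy` is spanned by the same fixed edges as the subpolygon of `k` is.  For a segment of
a compatible triangulation this means that the triangle with base `xy` is in this subpolygon. -/
def FacesRegion (T₁ T₂ : LabelledTriangulation n) (k : Fin n) (x y : ℕ) : Prop :=
  ∀ f, Fixed T₁ T₂ f →
    (k ∈ T₁.leftLabels f ↔ (T₁.diag f).lo ≤ x ∧ y ≤ (T₁.diag f).hi)

section

variable {T₁ T₂ S : LabelledTriangulation n} {i j k : Fin n}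

lemma Fixed.refl (T : LabelledTriangulation n) (f : Fin n) : Fixed T T f := ⟨rfl, rfl⟩

lemma compatible_left (T₁ T₂ : LabelledTriangulation n) : Compatible T₁ T₂ T₁ :=
  fun f _ => Fixed.refl T₁ f

lemma compatible_right (T₁ T₂ : LabelledTriangulation n) : Compatible T₁ T₂ T₂ :=
  fun _ h => h

lemma Compatible.flip {S' : LabelledTriangulation n} (h : Compatible T₁ T₂ S)
    (hk : ¬ Fixed T₁ T₂ k) (hf : Flip k S S') : Compatible T₁ T₂ S' := fun f hf' => by
  have hne : f ≠ k := by rintro rfl; exact hk hf'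
  exact ⟨by rw [hf.diag_of_ne hne, (h f hf').1], by rw [hf.leftLabels_eq hne, (h f hf').2]⟩

lemma mem_subpolygon :
    j ∈ subpolygon T₁ T₂ i ↔ ¬ Fixed T₁ T₂ j ∧ SameRegion T₁ T₂ i j := by
  simp [subpolygon, SameRegion]

lemma SameRegion.symm (h : SameRegion T₁ T₂ i j) : SameRegion T₁ T₂ j i :=
  fun f hf => (h f hf).symm

lemma SameRegion.trans (h : SameRegion T₁ T₂ i j) (h' : SameRegion T₁ T₂ j k) :
    SameRegion T₁ T₂ i k :=
  fun f hf => (h' f hf).trans (h f hf)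

lemma SameRegion.regionVertices_eq (h : SameRegion T₁ T₂ i j) :
    regionVertices T₁ T₂ j = regionVertices T₁ T₂ i := by
  ext v
  simp only [regionVertices, Finset.mem_filter]
  refine and_congr_right fun _ => forall₂_congr fun f hf => ?_
  rw [h f hf]

lemma SameRegion.priority_eq (h : SameRegion T₁ T₂ i j) :
    priority T₁ T₂ j = priority T₁ T₂ i := by
  funext v
  rw [priority, priority, h.regionVertices_eq]

lemma SameRegion.level_eq (h : SameRegion T₁ T₂ i j) : level T₁ T₂ j = level T₁ T₂ i := by
  funext x y
  rw [level, level, h.regionVertices_eq, h.priority_eq]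

lemma mem_regionVertices {v : ℕ} : v ∈ regionVertices T₁ T₂ k ↔ (0 < v ∧ v < n + 2) ∧
    ∀ f, Fixed T₁ T₂ f → ((T₁.diag f).lo < v ∧ v < (T₁.diag f).hi ↔ k ∈ T₁.leftLabels f) := by
  simp [regionVertices]

lemma priority_pos (v : ℕ) : 0 < priority T₁ T₂ k v := by
  unfold priority; omega

lemma le_level {x y v : ℕ} (hv : v ∈ regionVertices T₁ T₂ k) (h₁ : x < v) (h₂ : v < y) :
    priority T₁ T₂ k v ≤ level T₁ T₂ k x y :=
  Finset.le_sup (f := priority T₁ T₂ k) (Finset.mem_filter.2 ⟨hv, h₁, h₂⟩)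

lemma level_lt {x y m : ℕ} (hm : 0 < m)
    (h : ∀ v ∈ regionVertices T₁ T₂ k, x < v → v < y → priority T₁ T₂ k v < m) :
    level T₁ T₂ k x y < m := by
  rw [level, Finset.sup_lt_iff hm]
  intro v hv
  simp only [Finset.mem_filter] at hv
  exact h v hv.1 hv.2.1 hv.2.2

/-- Between two numbers of the same `2`-adic valuation there is one of higher valuation: if `a` is
`2 ^ m` times an odd number `s`, take `2 ^ m * (s + 1)`. -/
lemma exists_padicValNat_gt {a b : ℕ} (ha : 0 < a) (hab : a < b)
    (h : padicValNat 2 a = padicValNat 2 b) :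
    ∃ c, a < c ∧ c < b ∧ padicValNat 2 a < padicValNat 2 c := by
  obtain ⟨s, hs⟩ : 2 ^ padicValNat 2 a ∣ a := pow_padicValNat_dvd
  obtain ⟨t, ht⟩ : 2 ^ padicValNat 2 b ∣ b := pow_padicValNat_dvd
  rw [← h] at ht
  set m := padicValNat 2 a with hm
  have h2 : 0 < 2 ^ m := by positivity
  have hs2 : ¬ 2 ∣ s := fun ⟨u, hu⟩ => pow_succ_padicValNat_not_dvd (p := 2) ha.ne'
    ⟨u, by rw [← hm, pow_succ, mul_assoc, ← hu, ← hs]⟩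
  have ht2 : ¬ 2 ∣ t := fun ⟨u, hu⟩ => pow_succ_padicValNat_not_dvd (p := 2) (by omega : b ≠ 0)
    ⟨u, by rw [← h, pow_succ, mul_assoc, ← hu, ← ht]⟩
  have hst : s < t := by
    rw [hs, ht] at hab
    exact lt_of_mul_lt_mul_left hab h2.le
  refine ⟨2 ^ m * (s + 1), ?_, ?_, ?_⟩
  · rw [hs, mul_add]; omega
  · rw [ht]; exact Nat.mul_lt_mul_of_pos_left (by omega) h2
  · obtain ⟨u, hu⟩ : 2 ∣ s + 1 := by omega
    refine (padicValNat_dvd_iff_le (p := 2) (by positivity)).1 ⟨u, ?_⟩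
    rw [pow_succ, hu, mul_assoc]

/-- Between two vertices of the same priority there is one of higher priority. -/
lemma exists_priority_gt {u v : ℕ} (hu : u ∈ regionVertices T₁ T₂ k)
    (hv : v ∈ regionVertices T₁ T₂ k) (huv : u < v)
    (h : priority T₁ T₂ k u = priority T₁ T₂ k v) :
    ∃ w ∈ regionVertices T₁ T₂ k, u < w ∧ w < v ∧ priority T₁ T₂ k u < priority T₁ T₂ k w := by
  set V := regionVertices T₁ T₂ k with hV
  let r : ℕ → ℕ := fun v => (V.filter (· ≤ v)).card
  have hr0 : 0 < r u := Finset.card_pos.2 ⟨u, by simp [hu]⟩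
  have hmono : ∀ {a b}, b ∈ V → a < b → r a < r b := fun {a b} hb hab =>
    Finset.card_lt_card ⟨fun w hw => by
      simp only [Finset.mem_filter] at *; exact ⟨hw.1, by omega⟩, fun hc => by
      have := hc (Finset.mem_filter.2 ⟨hb, le_rfl⟩)
      simp only [Finset.mem_filter] at this
      omega⟩
  -- the ranks of the vertices are the numbers from `1` on
  have hsucc : ∀ a b, a < b → b ∈ V → ∀ c, r a < c → c ≤ r b →
      ∃ w ∈ V, a < w ∧ w ≤ b ∧ r w = c := by
    intro a b hab hb c hac hcb
    have hex : ∃ w, c ≤ r w := ⟨b, hcb⟩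
    have h1 := Nat.find_spec hex
    have h2 : ∀ m, m < Nat.find hex → ¬ c ≤ r m := fun m hm => Nat.find_min hex hm
    set w := Nat.find hex
    have haw : a < w := by
      by_contra hc
      have : r w ≤ r a := Finset.card_le_card fun x hx => by
        simp only [Finset.mem_filter] at *; exact ⟨hx.1, by omega⟩
      omega
    have h3 := h2 (w - 1) (by omega)
    have hwV : w ∈ V := by
      by_contra hw
      refine h3 (h1.trans (Finset.card_le_card fun x hx => ?_))
      simp only [Finset.mem_filter] at *
      have : x ≠ w := by rintro rfl; exact hw hx.1
      exact ⟨hx.1, by omega⟩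
    have h4 : r w ≤ r (w - 1) + 1 := by
      refine (Finset.card_le_card (t := insert w (V.filter (· ≤ w - 1))) fun x hx => ?_).trans
        (Finset.card_insert_le _ _)
      simp only [Finset.mem_filter, Finset.mem_insert] at *
      by_cases x = w
      · left; assumption
      · right; exact ⟨hx.1, by omega⟩
    exact ⟨w, hwV, haw, Nat.find_min' hex hcb, by omega⟩
  simp only [priority] at *
  obtain ⟨c, h1, h2, h3⟩ := exists_padicValNat_gt hr0 (hmono hv huv) (Nat.add_left_cancel h)
  obtain ⟨w, hw, h4, h5, rfl⟩ := hsucc u v huv hv c h1 h2.le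
  refine ⟨w, hw, h4, lt_of_le_of_ne h5 ?_, Nat.add_lt_add_left h3 1⟩
  rintro rfl
  exact lt_irrefl _ h2

lemma priority_le (v : ℕ) :
    priority T₁ T₂ k v ≤ 1 + Nat.log 2 (regionVertices T₁ T₂ k).card := by
  unfold priority
  refine Nat.add_le_add_left ((padicValNat_le_nat_log _).trans
    (Nat.log_mono_right (Finset.card_le_card (Finset.filter_subset _ _)))) 1

lemma level_le (x y : ℕ) :
    level T₁ T₂ k x y ≤ 1 + Nat.log 2 (regionVertices T₁ T₂ k).card :=
  Finset.sup_le fun v _ => priority_le v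

lemma Compatible.diag_eq (h : Compatible T₁ T₂ S) {f : Fin n} (hf : Fixed T₁ T₂ f) :
    S.diag f = T₁.diag f := (h f hf).1.symm

lemma Compatible.mem_leftLabels_iff (h : Compatible T₁ T₂ S) {f : Fin n} (hf : Fixed T₁ T₂ f) :
    j ∈ T₁.leftLabels f ↔ j ≠ f ∧ (T₁.diag f).lo ≤ (S.diag j).lo ∧
      (S.diag j).hi ≤ (T₁.diag f).hi := by
  rw [(h f hf).2, LabelledTriangulation.mem_leftLabels, h.diag_eq hf]

/-- A non-fixed edge of the subpolygon of `k` faces this subpolygon. -/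
lemma Compatible.facesRegion (h : Compatible T₁ T₂ S) (hj : ¬ Fixed T₁ T₂ j)
    (hjk : SameRegion T₁ T₂ k j) : FacesRegion T₁ T₂ k (S.diag j).lo (S.diag j).hi := by
  intro f hf
  rw [← hjk f hf, h.mem_leftLabels_iff hf]
  exact and_iff_right (by rintro rfl; exact hj hf)

/-- An edge within a chord that faces the subpolygon of `k`, with a vertex of this subpolygon
below it, is an edge of the subpolygon. -/
lemma Compatible.mem_subpolygon_of_spans (h : Compatible T₁ T₂ S) {x y v : ℕ} {g : Fin n}
    (hB : FacesRegion T₁ T₂ k x y) (hx : x ≤ (S.diag g).lo) (hy : (S.diag g).hi ≤ y)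
    (hne : ¬ ((S.diag g).lo = x ∧ (S.diag g).hi = y))
    (hv : v ∈ regionVertices T₁ T₂ k) (h₁ : (S.diag g).lo < v) (h₂ : v < (S.diag g).hi) :
    ¬ Fixed T₁ T₂ g ∧ SameRegion T₁ T₂ k g := by
  rw [mem_regionVertices] at hv
  have hg : ¬ Fixed T₁ T₂ g := fun hf => by
    rw [h.diag_eq hf] at *
    have := (hB g hf).1 ((hv.2 g hf).1 ⟨h₁, h₂⟩)
    omega
  refine ⟨hg, fun f hf => ⟨fun hgf => ?_, fun hkf => ?_⟩⟩
  · rw [h.mem_leftLabels_iff hf] at hgf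
    exact (hv.2 f hf).1 ⟨by omega, by omega⟩
  · rw [h.mem_leftLabels_iff hf]
    have := (hB f hf).1 hkf
    exact ⟨by rintro rfl; exact hg hf, by omega, by omega⟩

/-- The base of the subpolygon of `k`. -/
lemma exists_base (T₁ T₂ : LabelledTriangulation n) (k : Fin n) : ∃ x y, x + 2 ≤ y ∧ y ≤ n + 2 ∧
    FacesRegion T₁ T₂ k x y ∧ (∀ S, Compatible T₁ T₂ S → S.HasSegment x y) ∧
    (∀ v ∈ regionVertices T₁ T₂ k, x < v ∧ v < y) ∧
    (∀ S, Compatible T₁ T₂ S → ∀ j, SameRegion T₁ T₂ k j →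
      x ≤ (S.diag j).lo ∧ (S.diag j).hi ≤ y) := by
  classical
  let s := Finset.univ.filter fun f => Fixed T₁ T₂ f ∧ k ∈ T₁.leftLabels f
  by_cases hs : s.Nonempty
  · obtain ⟨f, hf, hmin⟩ := s.exists_min_image (fun f => (T₁.diag f).hi - (T₁.diag f).lo) hs
    simp only [s, Finset.mem_filter, Finset.mem_univ, true_and] at hf hmin
    obtain ⟨hf, hk⟩ := hf
    refine ⟨_, _, (T₁.diag f).lo_add_two_le, (T₁.diag f).hi_le, fun g hg => ⟨fun hkg => ?_,
      fun hg' => ?_⟩, fun S hS => ?_, fun v hv => ?_, fun S hS j hj => ?_⟩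
    · have h1 := hmin g ⟨hg, hkg⟩
      have h2 := T₁.not_cross f g
      rw [mem_leftLabels] at hk hkg
      have h3 := (T₁.diag k).lo_add_two_le
      unfold Cross at h2
      omega
    · rw [mem_leftLabels] at *
      refine ⟨?_, by omega, by omega⟩
      rintro rfl
      exact hk.1 (T₁.eq_of_lo_hi (by omega) (by omega))
    · rw [← hS.diag_eq hf]; exact S.hasSegment_diag f
    · exact ((mem_regionVertices.1 hv).2 f hf).2 hk
    · exact ((hS.mem_leftLabels_iff hf).1 ((hj f hf).2 hk)).2
  · have hno : ∀ f, Fixed T₁ T₂ f → k ∉ T₁.leftLabels f := fun f hf hk =>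
      hs ⟨f, by simp [s, hf, hk]⟩
    refine ⟨0, n + 2, by omega, le_rfl, fun f hf => ?_, fun S hS => Or.inr (Or.inl ⟨rfl, rfl⟩),
      fun v hv => (mem_regionVertices.1 hv).1, fun S _ j _ => ⟨by omega, (S.diag j).hi_le⟩⟩
    have := hno f hf
    have := (T₁.diag f).not_side
    have := (T₁.diag f).hi_le
    constructor
    · intro h; contradiction
    · intro h; omega

/-- In a stable triangulation, the triangle below a segment that faces the subpolygon of `k` has as
apex the vertex of the subpolygon of highest priority. -/
lemma Stable.apex_spec (hS : Compatible T₁ T₂ S) (hst : Stable T₁ T₂ S) {x y z : ℕ}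
    (hxy : S.HasSegment x y) (hB : FacesRegion T₁ T₂ k x y) (hxz : x < z) (hzy : z < y)
    (s1 : S.HasSegment x z) (s2 : S.HasSegment z y) :
    z ∈ regionVertices T₁ T₂ k ∧ ∀ v ∈ regionVertices T₁ T₂ k, x < v → v < y → v ≠ z →
      priority T₁ T₂ k v < priority T₁ T₂ k z := by
  classical
  have hyn := hxy.le (by omega)
  have hz : z ∈ regionVertices T₁ T₂ k := by
    refine mem_regionVertices.2 ⟨⟨by omega, by omega⟩, fun f hf => ?_⟩
    rw [hB f hf, ← hS.diag_eq hf]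
    have c1 := s1.not_cross f
    have c2 := s2.not_cross f
    unfold Cross at c1 c2
    omega
  refine ⟨hz, ?_⟩
  obtain ⟨c, hc, hmax⟩ := ((regionVertices T₁ T₂ k).filter fun v => x < v ∧ v < y).exists_max_image
    (priority T₁ T₂ k) ⟨z, by simp [hz, hxz, hzy]⟩
  simp only [Finset.mem_filter] at hc hmax
  have hlt : ∀ v ∈ regionVertices T₁ T₂ k, x < v → v < y → v ≠ c →
      priority T₁ T₂ k v < priority T₁ T₂ k c := by
    intro v hv h1 h2 hne
    refine lt_of_le_of_ne (hmax v ⟨hv, h1, h2⟩) fun heq => ?_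
    rcases lt_or_gt_of_ne hne with hvc | hvc
    · obtain ⟨w, hw, h3, h4, h5⟩ := exists_priority_gt hv hc.1 hvc heq
      have := hmax w ⟨hw, by omega, by omega⟩
      omega
    · obtain ⟨w, hw, h3, h4, h5⟩ := exists_priority_gt hc.1 hv hvc heq.symm
      have := hmax w ⟨hw, by omega, by omega⟩
      omega
  suffices z = c by rw [this]; exact hlt
  by_contra hne
  -- the shortest edge above `c` could be flipped to an edge at `c`
  let s := Finset.univ.filter fun g => (x ≤ (S.diag g).lo ∧ (S.diag g).hi ≤ y) ∧
    ¬ ((S.diag g).lo = x ∧ (S.diag g).hi = y) ∧ (S.diag g).lo < c ∧ c < (S.diag g).hi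
  have hs : s.Nonempty := by
    rcases lt_or_gt_of_ne hne with h | h
    · obtain ⟨g, h1, h2⟩ := s2.exists_edge (by omega) (by omega)
      exact ⟨g, by simp only [s, Finset.mem_filter, Finset.mem_univ, true_and]; omega⟩
    · obtain ⟨g, h1, h2⟩ := s1.exists_edge (by omega) (by omega)
      exact ⟨g, by simp only [s, Finset.mem_filter, Finset.mem_univ, true_and]; omega⟩
  obtain ⟨g, hg, hmin⟩ := s.exists_min_image (fun f => (S.diag f).hi - (S.diag f).lo) hs
  simp only [s, Finset.mem_filter, Finset.mem_univ, true_and] at hg hmin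
  obtain ⟨⟨hg1, hg2⟩, hg3, hg4, hg5⟩ := hg
  obtain ⟨hgf, hgk⟩ := hS.mem_subpolygon_of_spans hB hg1 hg2 hg3 hc.1 hg4 hg5
  obtain ⟨w, hw1, hw2, t1, t2⟩ := (S.hasSegment_diag g).exists_apex (S.diag g).lo_add_two_le
  have hwc : w = c := by
    by_contra hwc
    rcases lt_or_gt_of_ne hwc with h | h
    · obtain ⟨g', h1, h2⟩ := t2.exists_edge (by omega) (by omega)
      have := hmin g' (by omega)
      omega
    · obtain ⟨g', h1, h2⟩ := t1.exists_edge (by omega) (by omega)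
      have := hmin g' (by omega)
      omega
  subst hwc
  have hflip : ∃ S', Flip g S S' ∧ x ≤ (S'.diag g).lo ∧ (S'.diag g).hi ≤ y ∧
      ((S'.diag g).lo = w ∨ (S'.diag g).hi = w) := by
    obtain ⟨r, ⟨hr, r1, r2⟩ | ⟨hr, r1, r2⟩⟩ := S.exists_outer_apex g
    · obtain ⟨S', hf, hd⟩ := exists_flip_of_quadrilateral r1 t1 t2 r2 (Or.inr ⟨rfl, rfl⟩)
      have c1 := hxy.not_cross_segment r1
      have c2 := hxy.not_cross_segment r2
      unfold Cross at c1 c2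
      exact ⟨S', hf, by omega, by omega, by omega⟩
    · obtain ⟨S', hf, hd⟩ := exists_flip_of_quadrilateral t1 t2 r2 r1 (Or.inl ⟨rfl, rfl⟩)
      have c1 := hxy.not_cross_segment r1
      have c2 := hxy.not_cross_segment r2
      unfold Cross at c1 c2
      exact ⟨S', hf, by omega, by omega, by omega⟩
  obtain ⟨S', hf, h1, h2, h3⟩ := hflip
  refine hst g hgf S' hf ?_
  rw [hgk.level_eq]
  refine (level_lt (priority_pos w) fun v hv h4 h5 => ?_).trans_le (le_level hc.1 hg4 hg5)
  exact hlt v hv (by omega) (by omega) (by omega)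

/-- In a stable triangulation, levels strictly decrease from an edge to the edges below it. -/
lemma Stable.level_lt (hS : Compatible T₁ T₂ S) (hst : Stable T₁ T₂ S) (hj : ¬ Fixed T₁ T₂ j)
    (hjk : SameRegion T₁ T₂ k j) (hij : i ∈ S.leftLabels j) :
    level T₁ T₂ k (S.diag i).lo (S.diag i).hi < level T₁ T₂ k (S.diag j).lo (S.diag j).hi := by
  obtain ⟨z, h1, h2, s1, s2⟩ := (S.hasSegment_diag j).exists_apex (S.diag j).lo_add_two_le
  obtain ⟨hz, hmax⟩ := hst.apex_spec hS (S.hasSegment_diag j) (hS.facesRegion hj hjk) h1 h2 s1 s2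
  refine (LabelledTriangulation.level_lt (priority_pos z) fun v hv h4 h5 => ?_).trans_le
    (le_level hz h1 h2)
  rw [mem_leftLabels] at hij
  have c1 := s1.not_cross i
  have c2 := s2.not_cross i
  have h6 : ¬ ((S.diag i).lo = (S.diag j).lo ∧ (S.diag i).hi = (S.diag j).hi) :=
    fun hh => hij.1 (S.eq_of_lo_hi hh.1 hh.2)
  unfold Cross at c1 c2
  exact hmax v hv (by omega) (by omega) (by omega)

/-- Two stable triangulations have the same edges. -/
lemma Stable.exists_diag_eq {S' : LabelledTriangulation n} (hS : Compatible T₁ T₂ S)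
    (hS' : Compatible T₁ T₂ S') (hst : Stable T₁ T₂ S) (hst' : Stable T₁ T₂ S') (g : Fin n) :
    ∃ h, S'.diag h = S.diag g := by
  by_cases hg : Fixed T₁ T₂ g
  · exact ⟨g, by rw [hS.diag_eq hg, hS'.diag_eq hg]⟩
  obtain ⟨x, y, hxy, hyn, hB, hseg, -, hspan⟩ := exists_base T₁ T₂ g
  have hg1 := hspan S hS g (fun f _ => Iff.rfl)
  have hg2 := (S.diag g).lo_add_two_le
  have hg3 := (S.diag g).not_side
  -- descend from the base to `g` along common segments
  have key : ∀ m x y, y - x ≤ m → FacesRegion T₁ T₂ g x y → S.HasSegment x y →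
      S'.HasSegment x y → x ≤ (S.diag g).lo → (S.diag g).hi ≤ y →
      ∃ h, S'.diag h = S.diag g := by
    intro m
    induction m with
    | zero => intro x y; omega
    | succ m ih =>
      intro x y hm hB s s' hx hy
      by_cases heq : x = (S.diag g).lo ∧ y = (S.diag g).hi
      · obtain ⟨rfl, rfl⟩ := heq
        obtain ⟨h, h1, h2⟩ := s'.exists_edge hg2 hg3
        exact ⟨h, Diagonal.ext h1 h2⟩
      · obtain ⟨z, h1, h2, s1, s2⟩ := s.exists_apex (by omega)
        obtain ⟨z', h1', h2', s1', s2'⟩ := s'.exists_apex (by omega)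
        obtain ⟨hz, hmax⟩ := hst.apex_spec hS s hB h1 h2 s1 s2
        obtain ⟨hz', hmax'⟩ := hst'.apex_spec hS' s' hB h1' h2' s1' s2'
        have hzz : z' = z := by
          by_contra hne
          have := hmax z' hz' h1' h2' hne
          have := hmax' z hz h1 h2 (Ne.symm hne)
          omega
        subst hzz
        have hsub : ∀ u v, x ≤ u → v ≤ y → u ≤ (S.diag g).lo → (S.diag g).hi ≤ v →
            FacesRegion T₁ T₂ g u v := fun u v h3 h4 h5 h6 f hf => by
          refine ⟨fun hgf => ?_, fun hh => ?_⟩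
          · have := (hB f hf).1 hgf; omega
          · exact (hS.mem_leftLabels_iff hf).2 ⟨by rintro rfl; exact hg hf, by omega, by omega⟩
        have c1 := s1.not_cross g
        have c2 := s2.not_cross g
        unfold Cross at c1 c2
        rcases (by omega : (S.diag g).hi ≤ z' ∨ z' ≤ (S.diag g).lo) with h | h
        · exact ih x z' (by omega) (hsub _ _ le_rfl h2.le hx h) s1 s1' hx h
        · exact ih z' y (by omega) (hsub _ _ h1.le le_rfl h hy) s2 s2' h hy
  exact key _ x y le_rfl hB (hseg S hS) (hseg S' hS') hg1.1 hg1.2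

/-- A subpolygon with `m` edges in its interior has at most `m + 3` vertices: all vertices but one,
not counting the endpoints of the base, are apices of triangles below an interior edge. -/
lemma card_regionVertices_le (T₁ T₂ : LabelledTriangulation n) (k : Fin n) :
    (regionVertices T₁ T₂ k).card ≤ (subpolygon T₁ T₂ k).card + 1 := by
  classical
  have hS := compatible_left T₁ T₂
  obtain ⟨x, y, hxy, hyn, hB, hseg, hV, hspan⟩ := exists_base T₁ T₂ k
  have hseg := hseg _ hS
  -- every vertex is the apex below the shortest interior edge above it, or of the base
  have key : ∀ v ∈ regionVertices T₁ T₂ k, ∃ o : Option (Fin n),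
      (∀ g, o = some g → g ∈ subpolygon T₁ T₂ k ∧ (T₁.diag g).lo < v ∧ v < (T₁.diag g).hi ∧
        T₁.HasSegment (T₁.diag g).lo v ∧ T₁.HasSegment v (T₁.diag g).hi) ∧
      (o = none → T₁.HasSegment x v ∧ T₁.HasSegment v y) := by
    intro v hv
    obtain ⟨hv1, hv2⟩ := hV v hv
    let s := (subpolygon T₁ T₂ k).filter fun g => (T₁.diag g).lo < v ∧ v < (T₁.diag g).hi
    have haux : ∀ g, x ≤ (T₁.diag g).lo → (T₁.diag g).hi ≤ y →
        ¬ ((T₁.diag g).lo = x ∧ (T₁.diag g).hi = y) →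
        (T₁.diag g).lo < v → v < (T₁.diag g).hi → g ∈ s := fun g h1 h2 h3 h4 h5 =>
      Finset.mem_filter.2 ⟨mem_subpolygon.2 (hS.mem_subpolygon_of_spans hB h1 h2 h3 hv h4 h5),
        h4, h5⟩
    by_cases hs : s.Nonempty
    · obtain ⟨g, hg, hmin⟩ := s.exists_min_image (fun f => (T₁.diag f).hi - (T₁.diag f).lo) hs
      obtain ⟨hgs, hg1, hg2⟩ := Finset.mem_filter.1 hg
      refine ⟨some g, fun _ h => ?_, fun h => by simp at h⟩
      obtain rfl := Option.some.inj h
      have hgx := hspan T₁ hS g (mem_subpolygon.1 hgs).2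
      obtain ⟨w, hw1, hw2, t1, t2⟩ := (T₁.hasSegment_diag g).exists_apex (T₁.diag g).lo_add_two_le
      have hwv : w = v := by
        by_contra hwv
        rcases lt_or_gt_of_ne hwv with h | h
        · obtain ⟨g', h1, h2⟩ := t2.exists_edge (by omega) (by omega)
          have := hmin g' (haux g' (by omega) (by omega) (by omega) (by omega) (by omega))
          omega
        · obtain ⟨g', h1, h2⟩ := t1.exists_edge (by omega) (by omega)
          have := hmin g' (haux g' (by omega) (by omega) (by omega) (by omega) (by omega))
          omega
      subst hwv
      exact ⟨hgs, hg1, hg2, t1, t2⟩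
    · refine ⟨none, fun _ h => by simp at h, fun _ => ?_⟩
      obtain ⟨w, hw1, hw2, t1, t2⟩ := hseg.exists_apex hxy
      have hwv : w = v := by
        by_contra hwv
        rcases lt_or_gt_of_ne hwv with h | h
        · obtain ⟨g', h1, h2⟩ := t2.exists_edge (by omega) (by omega)
          exact hs ⟨g', haux g' (by omega) (by omega) (by omega) (by omega) (by omega)⟩
        · obtain ⟨g', h1, h2⟩ := t1.exists_edge (by omega) (by omega)
          exact hs ⟨g', haux g' (by omega) (by omega) (by omega) (by omega) (by omega)⟩
      subst hwv
      exact ⟨t1, t2⟩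
  choose! o ho1 ho2 using key
  rw [← Finset.card_insertNone]
  refine Finset.card_le_card_of_injOn o (fun v hv => ?_) fun v hv v' hv' heq => ?_
  · rw [Finset.mem_coe, Finset.mem_insertNone]
    exact fun g hg => (ho1 v hv g hg).1
  · have h2 := hV v hv
    have h2' := hV v' hv'
    -- a segment has only one triangle below it
    have aux : ∀ p q, p < v → v < q → p < v' → v' < q → T₁.HasSegment p v → T₁.HasSegment v q →
        T₁.HasSegment p v' → T₁.HasSegment v' q → v = v' := by
      intro p q l1 l2 l3 l4 s1 s2 s3 s4
      have c1 := s1.not_cross_segment s4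
      have c2 := s2.not_cross_segment s3
      unfold Cross at c1 c2
      omega
    rcases hov : o v with _ | g
    · obtain ⟨s1, s2⟩ := ho2 v hv hov
      obtain ⟨s3, s4⟩ := ho2 v' hv' (by rw [← heq, hov])
      exact aux x y h2.1 h2.2 h2'.1 h2'.2 s1 s2 s3 s4
    · obtain ⟨-, l1, l2, s1, s2⟩ := ho1 v hv g hov
      obtain ⟨-, l3, l4, s3, s4⟩ := ho1 v' hv' g (by rw [← heq, hov])
      exact aux _ _ l1 l2 l3 l4 s1 s2 s3 s4

end

end LabelledTriangulation

/-! ### Moving labels to their places -/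

namespace LabelledTriangulation

variable {n : ℕ}

/-- The diagonal `d` is strictly below the diagonal `e`. -/
def Below (d e : Diagonal n) : Prop :=
  ¬ (d.lo = e.lo ∧ d.hi = e.hi) ∧ e.lo ≤ d.lo ∧ d.hi ≤ e.hi

instance (d e : Diagonal n) : Decidable (Below d e) := inferInstanceAs (Decidable (_ ∧ _))

/-- The length of a diagonal, measured along the boundary between its endpoints. -/
def _root_.Diagonal.len (d : Diagonal n) : ℕ := d.hi - d.lo

/-- The edges that a label has to pass on its way from its place in `S` to its place in `R`, where
`S` and `R` have the same edges: those that separate these two places, and its place in `R`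
unless it is there.  The edges are named by their labels in `R`. -/
def route (S R : LabelledTriangulation n) (k : Fin n) : Finset (Fin n) :=
  Finset.univ.filter fun g => R.diag g ≠ S.diag k ∧
    (g = k ∨ ¬ (Below (S.diag k) (R.diag g) ↔ Below (R.diag k) (R.diag g)))

/-- The edge with label `j` is the next one that the label `k` has to pass on its way to its place
in `R`. -/
def Advances (S R : LabelledTriangulation n) (k j : Fin n) : Prop :=
  S.diag k ≠ R.diag k ∧ S.Adjacent j k ∧
    (S.diag j = R.diag k ∨ ¬ (k ∈ S.leftLabels j ↔ Below (R.diag k) (S.diag j)))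

/-- The labels that precede `(m, v)` in the order by the length of their edges in `R`, and by
number in case of equal lengths, are at their places. -/
def Placed (S R : LabelledTriangulation n) (m v : ℕ) : Prop :=
  ∀ i : Fin n, (R.diag i).len < m ∨ ((R.diag i).len = m ∧ (i : ℕ) < v) → S.diag i = R.diag i

section

variable {T₁ T₂ S R : LabelledTriangulation n} {i j k : Fin n}

lemma mem_leftLabels_iff_below : j ∈ S.leftLabels k ↔ Below (S.diag j) (S.diag k) := by
  rw [mem_leftLabels, Below]
  refine and_congr_left fun _ => not_congr ⟨by rintro rfl; simp, fun h => S.eq_of_lo_hi h.1 h.2⟩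

lemma mem_route {g : Fin n} : g ∈ route S R k ↔ R.diag g ≠ S.diag k ∧
    (g = k ∨ ¬ (Below (S.diag k) (R.diag g) ↔ Below (R.diag k) (R.diag g))) := by
  simp [route]

/-- Advancing a label shortens its route. -/
lemma Advances.card_route_lt (hSR : Set.range S.diag = Set.range R.diag) (h : Advances S R k j)
    {S' : LabelledTriangulation n} (hk : S'.diag k = S.diag j) :
    (route S' R k).card < (route S R k).card := by
  obtain ⟨hne, ⟨hjk, hadj⟩, hor⟩ := h
  rw [mem_leftLabels_iff_below] at hor
  simp only [mem_leftLabels_iff_below] at hadj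
  obtain ⟨q, hq⟩ : ∃ q, R.diag q = S.diag j := hSR.subset (Set.mem_range_self j)
  obtain ⟨k', hk'⟩ : ∃ k', S.diag k' = R.diag k := hSR.superset (Set.mem_range_self k)
  refine Finset.card_lt_card (Finset.ssubset_iff_of_subset (fun g hg => ?_) |>.2
    ⟨q, mem_route.2 ⟨?_, ?_⟩, fun hc => ?_⟩)
  · rw [mem_route, hk] at hg
    obtain ⟨hgj, hg⟩ := hg
    rw [mem_route]
    rcases hg with rfl | hg
    · exact ⟨Ne.symm hne, Or.inl rfl⟩
    obtain ⟨g', hg'⟩ : ∃ g', S.diag g' = R.diag g := hSR.superset (Set.mem_range_self g)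
    have hge : R.diag g ≠ S.diag k := by
      intro he
      rw [he] at hg
      rcases hor with hor | hor
      · rw [hor] at hg; exact hg Iff.rfl
      · have c1 := S.not_cross k j
        have c2 := S.not_cross k k'
        have c3 := S.not_cross j k'
        rw [hk'] at c2 c3
        have := (S.diag k).lo_add_two_le
        have := (S.diag j).lo_add_two_le
        have := (R.diag k).lo_add_two_le
        have h4 : ¬ ((S.diag j).lo = (S.diag k).lo ∧ (S.diag j).hi = (S.diag k).hi) :=
          fun hh => hjk (S.eq_of_lo_hi hh.1 hh.2)
        have h5 : ¬ ((R.diag k).lo = (S.diag k).lo ∧ (R.diag k).hi = (S.diag k).hi) :=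
          fun hh => hne (Diagonal.ext hh.1.symm hh.2.symm)
        clear hadj hg' hq
        unfold Below at *
        unfold Cross at *
        by_cases e1 : (S.diag j).lo ≤ (S.diag k).lo ∧ (S.diag k).hi ≤ (S.diag j).hi
        · omega
        · by_cases e2 : (S.diag k).lo ≤ (S.diag j).lo ∧ (S.diag j).hi ≤ (S.diag k).hi
          · omega
          · omega
    refine ⟨hge, Or.inr ?_⟩
    have := hadj g' (by rintro rfl; exact hgj hg'.symm) (by rintro rfl; exact hge hg'.symm)
    rw [hg'] at this
    rwa [← this]
  · rw [hq]; exact fun hh => hjk (S.injective hh)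
  · rw [hq]
    rcases hor with hor | hor
    · exact Or.inl (R.injective (by rw [hq, hor]))
    · exact Or.inr hor
  · rw [mem_route, hk] at hc
    exact hc.1 hq

/-- A label that is not at its place can advance. -/
lemma exists_advances (hSR : Set.range S.diag = Set.range R.diag) (h : S.diag k ≠ R.diag k) :
    ∃ j, Advances S R k j := by
  classical
  obtain ⟨k', hk'⟩ : ∃ k', S.diag k' = R.diag k := hSR.superset (Set.mem_range_self k)
  have hkk : k' ≠ k := by rintro rfl; exact h hk'
  suffices ∃ j, S.Adjacent j k ∧
      (j = k' ∨ ¬ (k ∈ S.leftLabels j ↔ k' ∈ S.leftLabels j)) by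
    obtain ⟨j, hj, hor⟩ := this
    refine ⟨j, h, hj, ?_⟩
    rw [mem_leftLabels_iff_below, mem_leftLabels_iff_below, hk'] at hor
    rw [mem_leftLabels_iff_below]
    refine hor.imp_left ?_
    rintro rfl
    exact hk'
  simp only [Adjacent, mem_leftLabels]
  have hlen : ∀ g : Fin n, (S.diag g).lo + 2 ≤ (S.diag g).hi := fun g => (S.diag g).lo_add_two_le
  have hc : ∀ a b, ¬ Cross (S.diag a).lo (S.diag a).hi (S.diag b).lo (S.diag b).hi := S.not_cross
  have hinj : ∀ a b, a ≠ b → ¬ ((S.diag a).lo = (S.diag b).lo ∧ (S.diag a).hi = (S.diag b).hi) :=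
    fun a b hab hh => hab (S.eq_of_lo_hi hh.1 hh.2)
  have hkk' := hinj _ _ hkk
  unfold Cross at hc
  by_cases hdown : (S.diag k).lo ≤ (S.diag k').lo ∧ (S.diag k').hi ≤ (S.diag k).hi
  · -- down to the longest edge strictly below `k` that contains the goal
    obtain ⟨j, hj, hmax⟩ := (Finset.univ.filter fun g => g ≠ k ∧
      ((S.diag k).lo ≤ (S.diag g).lo ∧ (S.diag g).hi ≤ (S.diag k).hi) ∧
      ((S.diag g).lo ≤ (S.diag k').lo ∧ (S.diag k').hi ≤ (S.diag g).hi)).exists_max_image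
      (fun g => (S.diag g).hi - (S.diag g).lo) ⟨k', by simp [hkk, hdown]⟩
    simp only [Finset.mem_filter, Finset.mem_univ, true_and] at hj hmax
    refine ⟨j, ⟨hj.1, fun g hgj hgk => ?_⟩, ?_⟩
    · have h1 := hc g k
      have h2 := hmax g
      have h3 := hlen k'
      have h4 := hlen k
      have h5 := hlen j
      have h6 := hinj _ _ hgj
      have h7 := hinj _ _ hgk
      refine ⟨fun hh => ⟨hgk.symm, ?_⟩, fun hh => ⟨hgj.symm, by omega, by omega⟩⟩
      by_contra hcon
      have := h2 ⟨hgk, by omega, by omega⟩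
      omega
    · by_cases hjk' : j = k'
      · exact Or.inl hjk'
      · right
        have := hinj _ _ hj.1
        have h9 : k' ≠ j := Ne.symm hjk'
        intro hh
        have := (hh.2 ⟨h9, by omega, by omega⟩).2
        omega
  · by_cases hup : ∃ g, g ≠ k ∧ ((S.diag g).lo ≤ (S.diag k).lo ∧ (S.diag k).hi ≤ (S.diag g).hi) ∧
        ¬ ((S.diag g).lo ≤ (S.diag k').lo ∧ (S.diag k').hi ≤ (S.diag g).hi)
    · -- up to the shortest edge strictly above `k`, if the goal is not below it
      obtain ⟨g₀, hg₀⟩ := hup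
      obtain ⟨j, hj, hmin⟩ := (Finset.univ.filter fun g => g ≠ k ∧
        ((S.diag g).lo ≤ (S.diag k).lo ∧ (S.diag k).hi ≤ (S.diag g).hi) ∧
        ¬ ((S.diag g).lo ≤ (S.diag k').lo ∧ (S.diag k').hi ≤ (S.diag g).hi)).exists_min_image
        (fun g => (S.diag g).hi - (S.diag g).lo) ⟨g₀, by simpa using hg₀⟩
      simp only [Finset.mem_filter, Finset.mem_univ, true_and] at hj hmin
      refine ⟨j, ⟨hj.1, fun g hgj hgk => ?_⟩, Or.inr fun hh => ?_⟩
      · have h1 := hc g j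
        have h2 := hmin g
        have h4 := hlen k
        have h5 := hlen j
        have h6 := hinj _ _ hgj
        have h7 := hinj _ _ hgk
        refine ⟨fun hh => ⟨hgk.symm, by omega, by omega⟩, fun hh => ⟨hgj.symm, ?_⟩⟩
        by_contra hcon
        have := h2 ⟨hgk, by omega, by omega⟩
        omega
      · have := (hh.1 ⟨hj.1.symm, by omega, by omega⟩).2
        omega
    · -- otherwise on to the longest edge above the goal that is not above `k`; this is `k'` if
      -- `k'` is above `k`
      push Not at hup
      by_cases hkk2 : (S.diag k').lo ≤ (S.diag k).lo ∧ (S.diag k).hi ≤ (S.diag k').hi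
      · refine ⟨k', ⟨hkk, fun g hgj hgk => ?_⟩, Or.inl rfl⟩
        have := hup g hgk
        refine ⟨fun hh => ⟨hgk.symm, by omega, by omega⟩, fun hh => ⟨hgj.symm, ?_⟩⟩
        exact this hh.2
      · obtain ⟨j, hj, hmax⟩ := (Finset.univ.filter fun g => g ≠ k ∧
          ¬ ((S.diag g).lo ≤ (S.diag k).lo ∧ (S.diag k).hi ≤ (S.diag g).hi) ∧
          ((S.diag g).lo ≤ (S.diag k').lo ∧ (S.diag k').hi ≤ (S.diag g).hi)).exists_max_image
          (fun g => (S.diag g).hi - (S.diag g).lo) ⟨k', by simp [hkk]; omega⟩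
        simp only [Finset.mem_filter, Finset.mem_univ, true_and] at hj hmax
        refine ⟨j, ⟨hj.1, fun g hgj hgk => ?_⟩, ?_⟩
        · have h1 := hc g j
          have h2 := hmax g
          have h3 := hup g hgk
          have h4 := hlen k'
          have h5 := hlen j
          have h6 := hinj _ _ hgj
          have h7 := hlen k
          have h8 := hlen g
          refine ⟨fun hh => ⟨hgk.symm, ?_⟩, fun hh => ⟨hgj.symm, ?_⟩⟩
          · by_contra hcon
            have := h2 ⟨hgk, hcon, by omega, by omega⟩
            omega
          · have := h3 hh.2
            omega
        · by_cases hjk' : j = k'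
          · exact Or.inl hjk'
          · right
            have h9 : k' ≠ j := Ne.symm hjk'
            intro hh
            have := (hh.2 ⟨h9, by omega, by omega⟩).2
            omega

lemma Compatible.below_iff (hS : Compatible T₁ T₂ S) (hR : Compatible T₁ T₂ R) {f : Fin n}
    (hf : Fixed T₁ T₂ f) (j : Fin n) :
    Below (S.diag j) (S.diag f) ↔ Below (R.diag j) (R.diag f) := by
  rw [← mem_leftLabels_iff_below, ← mem_leftLabels_iff_below, ← (hS f hf).2, (hR f hf).2]

/-- A label advances within its subpolygon. -/
lemma Advances.sameRegion (hS : Compatible T₁ T₂ S) (hR : Compatible T₁ T₂ R)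
    (h : Advances S R k j) :
    ¬ Fixed T₁ T₂ k ∧ ¬ Fixed T₁ T₂ j ∧ SameRegion T₁ T₂ k j := by
  obtain ⟨hne, ⟨hjk, hadj⟩, hor⟩ := h
  have hk : ¬ Fixed T₁ T₂ k := fun hf => hne (by rw [hS.diag_eq hf, hR.diag_eq hf])
  have hj : ¬ Fixed T₁ T₂ j := fun hf => by
    have hSR : S.diag j = R.diag j := by rw [hS.diag_eq hf, hR.diag_eq hf]
    rcases hor with hor | hor
    · exact hjk (R.injective (by rw [← hSR, hor]))
    · rw [mem_leftLabels_iff_below, hS.below_iff hR hf, hSR] at hor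
      exact hor Iff.rfl
  refine ⟨hk, hj, fun f hf => ?_⟩
  rw [(hS f hf).2]
  exact hadj f (by rintro rfl; exact hj hf) (by rintro rfl; exact hk hf)

/-- Labels that precede `k` do not get out of their places when `k` advances. -/
lemma Advances.placed (hSR : Set.range S.diag = Set.range R.diag) (h : Advances S R k j)
    {S' : LabelledTriangulation n} (hP : Placed S R (R.diag k).len k)
    (hS' : ∀ g, g ≠ k → g ≠ j → S'.diag g = S.diag g) : Placed S' R (R.diag k).len k := by
  obtain ⟨hne, ⟨hjk, -⟩, hor⟩ := h
  rw [mem_leftLabels_iff_below] at hor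
  intro i hi
  have hik : i ≠ k := by rintro rfl; omega
  rw [← hP i hi]
  refine hS' i hik ?_
  rintro rfl
  have hSi := hP i hi
  obtain ⟨q, hq⟩ : ∃ q, R.diag q = S.diag k := hSR.subset (Set.mem_range_self k)
  have hqk : q ≠ k := by rintro rfl; exact hne hq.symm
  have hq1 : (R.diag k).len ≤ (S.diag k).len := by
    by_contra hlt
    have := hP q (Or.inl (by rw [hq]; omega))
    exact hqk (S.injective (by rw [this, hq]))
  rcases hor with hor | hor
  · exact hik (R.injective (by rw [← hSi, hor]))
  · rw [hSi] at hor
    have := (S.diag k).lo_add_two_le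
    have := (R.diag k).lo_add_two_le
    have := (R.diag i).lo_add_two_le
    unfold Diagonal.len at *
    unfold Below at hor
    omega

/-- In a stable triangulation only few edges of a subpolygon are above a given edge. -/
lemma Stable.card_above_le (hR : Compatible T₁ T₂ R) (hst : Stable T₁ T₂ R) (d : Diagonal n)
    (s : Finset (Fin n)) (hs : ∀ g ∈ s, ¬ Fixed T₁ T₂ g ∧ SameRegion T₁ T₂ k g ∧
      Below d (R.diag g)) :
    s.card ≤ Nat.log 2 (regionVertices T₁ T₂ k).card + 2 := by
  rw [← Finset.card_range (Nat.log 2 (regionVertices T₁ T₂ k).card + 2)]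
  refine Finset.card_le_card_of_injOn
    (fun g => level T₁ T₂ k (R.diag g).lo (R.diag g).hi) (fun g _ => ?_) fun g hg g' hg' heq => ?_
  · rw [Finset.coe_range, Set.mem_Iio]
    beta_reduce
    have := level_le (T₁ := T₁) (T₂ := T₂) (k := k) (R.diag g).lo (R.diag g).hi
    omega
  · by_contra hne
    have h1 := hs g hg
    have h2 := hs g' hg'
    have c := R.not_cross g g'
    have h3 := h1.2.2
    have h4 := h2.2.2
    have h5 := d.lo_add_two_le
    simp only at heq
    rcases (by unfold Below at h3 h4; unfold Cross at c; omega :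
        ((R.diag g').lo ≤ (R.diag g).lo ∧ (R.diag g).hi ≤ (R.diag g').hi) ∨
        ((R.diag g).lo ≤ (R.diag g').lo ∧ (R.diag g').hi ≤ (R.diag g).hi)) with h | h
    · have := hst.level_lt hR h2.1 h2.2.1 (mem_leftLabels.2 ⟨hne, h⟩)
      omega
    · have := hst.level_lt hR h1.1 h1.2.1 (mem_leftLabels.2 ⟨Ne.symm hne, h⟩)
      omega

/-- In a stable triangulation all routes are short. -/
lemma Stable.card_route_le (hS : Compatible T₁ T₂ S) (hR : Compatible T₁ T₂ R)
    (hst : Stable T₁ T₂ R) :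
    (route S R k).card ≤ 2 * Nat.log 2 (regionVertices T₁ T₂ k).card + 5 := by
  -- an edge that separates the two places of `k` is an interior edge of the subpolygon
  have aux : ∀ d e : Diagonal n,
      (∀ f, Fixed T₁ T₂ f → (Below d (R.diag f) ↔ k ∈ T₁.leftLabels f)) →
      (∀ f, Fixed T₁ T₂ f → (Below e (R.diag f) ↔ k ∈ T₁.leftLabels f)) →
      ∀ g, Below d (R.diag g) → ¬ Below e (R.diag g) →
      ¬ Fixed T₁ T₂ g ∧ SameRegion T₁ T₂ k g := by
    intro d e hd he g h1 h2
    have hg : ¬ Fixed T₁ T₂ g := fun hf => h2 ((he g hf).2 ((hd g hf).1 h1))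
    refine ⟨hg, fun f hf => ?_⟩
    have h3 := hd f hf
    have h4 := he f hf
    have h5 : g ∈ T₁.leftLabels f ↔ Below (R.diag g) (R.diag f) := by
      rw [(hR f hf).2, mem_leftLabels_iff_below]
    rw [h5]
    have hgf : g ≠ f := by rintro rfl; exact hg hf
    have h6 : ¬ ((R.diag g).lo = (R.diag f).lo ∧ (R.diag g).hi = (R.diag f).hi) :=
      fun hh => hgf (R.eq_of_lo_hi hh.1 hh.2)
    have h7 := R.not_cross g f
    have := d.lo_add_two_le
    have := e.lo_add_two_le
    constructor
    · intro hgf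
      rw [← h3]
      unfold Below at *
      omega
    · intro hkf
      have h8 := h3.2 hkf
      have h9 := h4.2 hkf
      clear h3 h4 h5 hd he
      unfold Below at *
      unfold Cross at h7
      omega
  have hd : ∀ S, Compatible T₁ T₂ S → ∀ f, Fixed T₁ T₂ f →
      (Below (S.diag k) (R.diag f) ↔ k ∈ T₁.leftLabels f) := by
    intro S hS f hf
    rw [show R.diag f = S.diag f by rw [hR.diag_eq hf, hS.diag_eq hf], ← mem_leftLabels_iff_below,
      (hS f hf).2]
  have hA := hst.card_above_le (k := k) hR (S.diag k)
    (Finset.univ.filter fun g => Below (S.diag k) (R.diag g) ∧ ¬ Below (R.diag k) (R.diag g))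
    fun g hg => by
      simp only [Finset.mem_filter, Finset.mem_univ, true_and] at hg
      have := aux _ _ (hd S hS) (hd R hR) g hg.1 hg.2
      exact ⟨this.1, this.2, hg.1⟩
  have hB := hst.card_above_le (k := k) hR (R.diag k)
    (Finset.univ.filter fun g => Below (R.diag k) (R.diag g) ∧ ¬ Below (S.diag k) (R.diag g))
    fun g hg => by
      simp only [Finset.mem_filter, Finset.mem_univ, true_and] at hg
      have := aux _ _ (hd R hR) (hd S hS) g hg.1 hg.2
      exact ⟨this.1, this.2, hg.1⟩
  have hsub : route S R k ⊆ insert k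
      ((Finset.univ.filter fun g => Below (S.diag k) (R.diag g) ∧ ¬ Below (R.diag k) (R.diag g)) ∪
      (Finset.univ.filter fun g => Below (R.diag k) (R.diag g) ∧
        ¬ Below (S.diag k) (R.diag g))) := by
    intro g hg
    rw [mem_route] at hg
    simp only [Finset.mem_insert, Finset.mem_union, Finset.mem_filter, Finset.mem_univ, true_and]
    tauto
  have h1 := Finset.card_le_card hsub
  have h2 := Finset.card_insert_le k
    ((Finset.univ.filter fun g => Below (S.diag k) (R.diag g) ∧ ¬ Below (R.diag k) (R.diag g)) ∪
      (Finset.univ.filter fun g => Below (R.diag k) (R.diag g) ∧ ¬ Below (S.diag k) (R.diag g)))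
  have h3 := Finset.card_union_le
    (Finset.univ.filter fun g => Below (S.diag k) (R.diag g) ∧ ¬ Below (R.diag k) (R.diag g))
    (Finset.univ.filter fun g => Below (R.diag k) (R.diag g) ∧ ¬ Below (S.diag k) (R.diag g))
  omega

end

end LabelledTriangulation

/-! ### States of the algorithm, and the number of flips -/

namespace LabelledTriangulation

variable {n : ℕ}

/-- A triangulation, together with the labels of the edges flipped so far. -/
abbrev State (n : ℕ) := LabelledTriangulation n × List (Fin n)

/-- The level of the edge with label `k`. -/
def edgeLevel (T₁ T₂ S : LabelledTriangulation n) (k : Fin n) : ℕ :=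
  level T₁ T₂ k (S.diag k).lo (S.diag k).hi

/-- A flip of a non-fixed edge that decreases its level. -/
def Improve (T₁ T₂ : LabelledTriangulation n) (a b : State n) : Prop :=
  ∃ k, ¬ Fixed T₁ T₂ k ∧ Flip k a.1 b.1 ∧
    edgeLevel T₁ T₂ b.1 k < edgeLevel T₁ T₂ a.1 k ∧ b.2 = a.2 ++ [k]

/-- The label `k` advances to the place of a neighbouring edge, by five flips; the goal `R` has the
same edges as the triangulation. -/
def Advance (R : LabelledTriangulation n) (k : Fin n) (a b : State n) : Prop :=
  Set.range a.1.diag = Set.range R.diag ∧ ∃ j, Advances a.1 R k j ∧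
    b.1.diag k = a.1.diag j ∧ b.1.diag j = a.1.diag k ∧
    (∀ g, g ≠ k → g ≠ j → b.1.diag g = a.1.diag g) ∧ FlipSeq [k, j, k, j, k] a.1 b.1 ∧
    b.2 = a.2 ++ [k, j, k, j, k]

/-- The recorded flips lead from `T` to the present triangulation; none is of a fixed edge. -/
def Recorded (T₁ T₂ T : LabelledTriangulation n) (a : State n) : Prop :=
  FlipSeq a.2 T a.1 ∧ (∀ k ∈ a.2, ¬ Fixed T₁ T₂ k) ∧ Compatible T₁ T₂ a.1

section

variable {T₁ T₂ T R : LabelledTriangulation n} {a b : State n} {k : Fin n}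

lemma FlipSeq.compatible {S S' : LabelledTriangulation n} {l : List (Fin n)}
    (h : FlipSeq l S S') (hl : ∀ k ∈ l, ¬ Fixed T₁ T₂ k) (hS : Compatible T₁ T₂ S) :
    Compatible T₁ T₂ S' := by
  induction l generalizing S with
  | nil => obtain rfl : S = S' := h; exact hS
  | cons k l ih =>
    obtain ⟨S₁, h1, h2⟩ := h
    exact ih h2 (fun j hj => hl j (List.mem_cons_of_mem _ hj))
      (hS.flip (hl k List.mem_cons_self) h1)

lemma Recorded.extend {l : List (Fin n)} (ha : Recorded T₁ T₂ T a) (hf : FlipSeq l a.1 b.1)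
    (hl : ∀ k ∈ l, ¬ Fixed T₁ T₂ k) (hb : b.2 = a.2 ++ l) : Recorded T₁ T₂ T b := by
  refine ⟨by rw [hb]; exact ha.1.append hf, fun k hk => ?_, hf.compatible hl ha.2.2⟩
  rw [hb, List.mem_append] at hk
  exact hk.elim (ha.2.1 k) (hl k)

/-- The flips of each edge are paid for by the decrease of its level. -/
lemma Improve.spec (h : Relation.ReflTransGen (Improve T₁ T₂) a b) (ha : Recorded T₁ T₂ T a) :
    Recorded T₁ T₂ T b ∧ ∀ k, b.2.count k + edgeLevel T₁ T₂ b.1 k ≤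
      a.2.count k + edgeLevel T₁ T₂ a.1 k := by
  induction h with
  | refl => exact ⟨ha, fun _ => le_rfl⟩
  | @tail b c _ hbc ih =>
    obtain ⟨k, hk, hf, hlt, hc⟩ := hbc
    refine ⟨ih.1.extend hf.flipSeq (by simpa using hk) hc, fun j => le_trans ?_ (ih.2 j)⟩
    rw [hc, List.count_append]
    by_cases hj : j = k
    · subst hj
      simp only [List.count_singleton_self]
      omega
    · rw [List.count_singleton, if_neg (by simpa using Ne.symm hj)]
      have : edgeLevel T₁ T₂ c.1 j = edgeLevel T₁ T₂ b.1 j := by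
        rw [edgeLevel, edgeLevel, hf.diag_of_ne hj]
      omega

/-- The potential of the local search. -/
def totalLevel (T₁ T₂ : LabelledTriangulation n) (a : State n) : ℕ :=
  ∑ k, edgeLevel T₁ T₂ a.1 k

lemma Improve.totalLevel_lt (h : Improve T₁ T₂ a b) : totalLevel T₁ T₂ b < totalLevel T₁ T₂ a := by
  obtain ⟨k, hk, hf, hlt, hc⟩ := h
  refine Finset.sum_lt_sum (fun j _ => ?_) ⟨k, Finset.mem_univ k, hlt⟩
  by_cases hj : j = k
  · rw [hj]; exact hlt.le
  · rw [edgeLevel, edgeLevel, hf.diag_of_ne hj]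

lemma reflTransGen_eq_or_lt {α : Type*} {r : α → α → Prop} {μ : α → ℕ}
    (hμ : ∀ a b, r a b → μ b < μ a) {a b : α} (h : Relation.ReflTransGen r a b) :
    a = b ∨ μ b < μ a := by
  induction h with
  | refl => exact Or.inl rfl
  | tail _ hbc ih =>
    right
    have := hμ _ _ hbc
    rcases ih with rfl | ih
    · exact this
    · exact this.trans ih

lemma Stable.eq_of_improve (ha : Stable T₁ T₂ a.1)
    (h : Relation.ReflTransGen (Improve T₁ T₂) a b) : a = b := by
  rcases Relation.ReflTransGen.cases_head h with h | ⟨c, ⟨k, hk, hf, hlt, -⟩, -⟩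
  · exact h
  · exact absurd hlt (ha k hk c.1 hf)

lemma edgeLevel_le (S : LabelledTriangulation n) (k : Fin n) :
    edgeLevel T₁ T₂ S k ≤ 1 + Nat.log 2 (regionVertices T₁ T₂ k).card :=
  level_le _ _

lemma card_regionVertices_le_size : (regionVertices T₁ T₂ k).card ≤ n + 1 :=
  (Finset.card_filter_le _ _).trans (by simp)

lemma totalLevel_lt (a : State n) : totalLevel T₁ T₂ a < (n + 3) * (n + 3) := by
  have : totalLevel T₁ T₂ a ≤ ∑ _k : Fin n, (n + 2) := Finset.sum_le_sum fun k _ => by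
    have h1 := edgeLevel_le (T₁ := T₁) (T₂ := T₂) a.1 k
    have h2 := Nat.log_le_self 2 (regionVertices T₁ T₂ k).card
    have h3 := card_regionVertices_le_size (T₁ := T₁) (T₂ := T₂) (k := k)
    omega
  simp only [Finset.sum_const, Finset.card_univ, Fintype.card_fin, smul_eq_mul] at this
  nlinarith

lemma Advance.range_eq (h : Advance R k a b) : Set.range b.1.diag = Set.range a.1.diag := by
  obtain ⟨-, j, -, hk, hj, ho, -⟩ := h
  ext d
  constructor
  · rintro ⟨g, rfl⟩
    by_cases h1 : g = k
    · exact ⟨j, by rw [h1, hk]⟩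
    · by_cases h2 : g = j
      · exact ⟨k, by rw [h2, hj]⟩
      · exact ⟨g, (ho g h1 h2).symm⟩
  · rintro ⟨g, rfl⟩
    by_cases h1 : g = k
    · exact ⟨j, by rw [h1, hj]⟩
    · by_cases h2 : g = j
      · exact ⟨k, by rw [h2, hk]⟩
      · exact ⟨g, ho g h1 h2⟩

lemma Advance.card_route_lt (h : Advance R k a b) :
    (route b.1 R k).card < (route a.1 R k).card := by
  obtain ⟨hSR, j, hadv, hk, -⟩ := h
  exact hadv.card_route_lt hSR hk

/-- The flips that move `k` to its place are paid for by the length of its route. -/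
lemma Advance.spec (hR : Compatible T₁ T₂ R) (h : Relation.ReflTransGen (Advance R k) a b)
    (ha : Recorded T₁ T₂ T a) (hSR : Set.range a.1.diag = Set.range R.diag)
    (hP : Placed a.1 R (R.diag k).len k) :
    Recorded T₁ T₂ T b ∧ Set.range b.1.diag = Set.range R.diag ∧
      Placed b.1 R (R.diag k).len k ∧
      (∀ i, k ∉ subpolygon T₁ T₂ i → b.2.countP (· ∈ subpolygon T₁ T₂ i) =
        a.2.countP (· ∈ subpolygon T₁ T₂ i)) ∧
      ∀ i, b.2.countP (· ∈ subpolygon T₁ T₂ i) + 5 * (route b.1 R k).card ≤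
        a.2.countP (· ∈ subpolygon T₁ T₂ i) + 5 * (route a.1 R k).card := by
  induction h with
  | refl => exact ⟨ha, hSR, hP, fun _ _ => rfl, fun _ => le_rfl⟩
  | @tail b c _ hbc ih =>
    have hrange := hbc.range_eq
    obtain ⟨-, j, hadv, hk, hj, ho, hf, hc⟩ := hbc
    obtain ⟨i1, i2, i3, i4, i5⟩ := ih
    obtain ⟨r1, r2, r3⟩ := hadv.sameRegion i1.2.2 hR
    have hlt := hadv.card_route_lt i2 hk
    refine ⟨i1.extend hf ?_ hc, hrange.trans i2, hadv.placed i2 i3 ho, fun i hi => ?_,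
      fun i => ?_⟩
    · intro g hg
      simp only [List.mem_cons, List.not_mem_nil, or_false] at hg
      rcases hg with rfl | rfl | rfl | rfl | rfl <;> assumption
    · rw [hc, List.countP_append, i4 i hi]
      have hji : j ∉ subpolygon T₁ T₂ i := fun hj =>
        hi (mem_subpolygon.2 ⟨r1, (mem_subpolygon.1 hj).2.trans r3.symm⟩)
      simp [hi, hji]
    · have h5 : ([k, j, k, j, k] : List (Fin n)).countP (· ∈ subpolygon T₁ T₂ i) ≤ 5 :=
        List.countP_le_length
      rw [hc, List.countP_append]
      have := i5 i
      omega

lemma countP_mem_eq_sum_count (s : Finset (Fin n)) (l : List (Fin n)) :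
    l.countP (· ∈ s) = ∑ k ∈ s, l.count k := by
  induction l with
  | nil => simp
  | cons j l ih =>
    simp only [List.countP_cons, List.count_cons, Finset.sum_add_distrib, ih]
    congr 1
    simp [Finset.sum_ite_eq]

/-- Every flip sequence from `T₁` to `T₂` flips all interior edges of a subpolygon. -/
lemma FlipSeq.card_subpolygon_le {l : List (Fin n)} (h : FlipSeq l T₁ T₂) (i : Fin n) :
    (subpolygon T₁ T₂ i).card ≤ l.countP (· ∈ subpolygon T₁ T₂ i) := by
  rw [countP_mem_eq_sum_count, Finset.card_eq_sum_ones]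
  refine Finset.sum_le_sum fun k hk => ?_
  by_contra hc
  exact (mem_subpolygon.1 hk).1 (h.fixed_of_not_mem fun hkl =>
    hc (List.count_pos_iff.2 hkl))

/-- A bound for the number of flips in each subpolygon sums up to a bound for the whole
sequence. -/
lemma length_le_of_countP_le {l : List (Fin n)} (hl : ∀ k ∈ l, ¬ Fixed T₁ T₂ k) {B : ℝ}
    (hB : ∀ i, ¬ Fixed T₁ T₂ i → (l.countP (· ∈ subpolygon T₁ T₂ i) : ℝ) ≤
      B * (subpolygon T₁ T₂ i).card) :
    (l.length : ℝ) ≤ B * (Finset.univ.filter fun k => ¬ Fixed T₁ T₂ k).card := by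
  classical
  set N := Finset.univ.filter fun k => ¬ Fixed T₁ T₂ k with hN
  let c : Fin n → Finset (Fin n) := subpolygon T₁ T₂
  have hfib : ∀ i ∈ N, N.filter (fun k => c k = c i) = c i := by
    intro i hi
    ext k
    simp only [hN, Finset.mem_filter, Finset.mem_univ, true_and, c]
    constructor
    · rintro ⟨hk, hki⟩
      rw [← hki]
      exact mem_subpolygon.2 ⟨hk, fun f _ => Iff.rfl⟩
    · intro hk
      obtain ⟨hk1, hk2⟩ := mem_subpolygon.1 hk
      refine ⟨hk1, Finset.ext fun g => ?_⟩
      rw [mem_subpolygon, mem_subpolygon]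
      exact and_congr_right fun _ => ⟨fun h => hk2.trans h, fun h => hk2.symm.trans h⟩
  have hlen : l.length = ∑ k ∈ N, l.count k := by
    rw [← countP_mem_eq_sum_count, eq_comm, List.countP_eq_length]
    intro k hk
    simpa [hN] using hl k hk
  have h1 : ∑ k ∈ N, l.count k = ∑ s ∈ N.image c, ∑ k ∈ N.filter (fun k => c k = s), l.count k :=
    (Finset.sum_fiberwise_of_maps_to (fun k hk => Finset.mem_image_of_mem c hk) _).symm
  have h2 : N.card = ∑ s ∈ N.image c, (N.filter (fun k => c k = s)).card :=
    Finset.card_eq_sum_card_fiberwise fun k hk => Finset.mem_image_of_mem c hk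
  rw [hlen, h1, h2]
  push_cast
  rw [Finset.mul_sum]
  refine Finset.sum_le_sum fun s hs => ?_
  obtain ⟨i, hi, rfl⟩ := Finset.mem_image.1 hs
  rw [hfib i hi]
  have := hB i (by simpa [hN] using hi)
  rw [countP_mem_eq_sum_count] at this
  exact_mod_cast this

lemma flipDist_le {l : List (Fin n)} (h : FlipSeq l T₁ T₂) : flipDist T₁ T₂ ≤ l.length :=
  Nat.sInf_le ⟨l, h, rfl⟩

/-- Every non-fixed edge has to be flipped. -/
lemma card_not_fixed_le_flipDist {l : List (Fin n)} (h : FlipSeq l T₁ T₂) :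
    (Finset.univ.filter fun k => ¬ Fixed T₁ T₂ k).card ≤ flipDist T₁ T₂ := by
  obtain ⟨l', h', hl'⟩ := Nat.sInf_mem (s := {m | ∃ l : List (Fin n), FlipSeq l T₁ T₂ ∧
    l.length = m}) ⟨_, l, h, rfl⟩
  rw [flipDist, ← hl']
  refine (Finset.card_le_card (t := l'.toFinset) fun k hk => ?_).trans l'.toFinset_card_le
  rw [List.mem_toFinset]
  by_contra hc
  exact (Finset.mem_filter.1 hk).2 (h'.fixed_of_not_mem hc)

/-- The bound `O(m log m)` in its usual form; the constant `39 = 12 + 27` suffices since `D` and `1`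
are at most `log₂ (m + 1)`. -/
lemma natLog_bound_le {m : ℕ} (hm : 0 < m) {D : ℕ} (hD : D ≤ Nat.log 2 (m + 1)) :
    ((m * (12 * D + 27) : ℕ) : ℝ) ≤ 39 / Real.log 2 * m * Real.log (m + 1) := by
  have h2 : 0 < Real.log 2 := Real.log_pos (by norm_num)
  have h1 : Real.log 2 ≤ Real.log (m + 1) := by
    refine Real.log_le_log (by norm_num) ?_
    have : (1 : ℝ) ≤ m := by exact_mod_cast hm
    linarith
  have h3 : (D : ℝ) ≤ Real.log (m + 1) / Real.log 2 := by
    have := Real.natLog_le_logb (m + 1) 2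
    rw [Real.logb] at this
    push_cast at this
    exact le_trans (by exact_mod_cast hD) this
  have h4 : 1 ≤ Real.log (m + 1) / Real.log 2 := by rwa [le_div_iff₀ h2, one_mul]
  have h5 : (12 * D + 27 : ℝ) ≤ 39 * (Real.log (m + 1) / Real.log 2) := by linarith
  have h6 : (0 : ℝ) ≤ m := by positivity
  push_cast
  calc (m : ℝ) * (12 * D + 27) ≤ m * (39 * (Real.log (m + 1) / Real.log 2)) :=
        mul_le_mul_of_nonneg_left h5 h6
    _ = 39 / Real.log 2 * m * Real.log (m + 1) := by ring

end

end LabelledTriangulation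

/-! ### Boolean expressions, lists and loops of for programs -/

namespace RAM

/-- The scalar variable `i`. -/
def var (i : ℕ) : SExpr := .get i (.const 0)

/-- `e₁ < e₂`.  Boolean expressions are true if their value is positive. -/
def bLt (e₁ e₂ : SExpr) : SExpr := .ite e₁ e₂ (.const 1) (.const 0)

/-- Negation. -/
def bNot (e : SExpr) : SExpr := .ite (.const 0) e (.const 0) (.const 1)

/-- Conjunction. -/
def bAnd (e₁ e₂ : SExpr) : SExpr := .ite (.const 0) e₁ e₂ (.const 0)

/-- Disjunction. -/
def bOr (e₁ e₂ : SExpr) : SExpr := .add e₁ e₂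

/-- `e₁ ≤ e₂`. -/
def bLe (e₁ e₂ : SExpr) : SExpr := bNot (bLt e₂ e₁)

/-- `e₁ = e₂`. -/
def bEq (e₁ e₂ : SExpr) : SExpr := bAnd (bLe e₁ e₂) (bLe e₂ e₁)

/-- Equivalence. -/
def bIff (e₁ e₂ : SExpr) : SExpr := bOr (bAnd e₁ e₂) (bAnd (bNot e₁) (bNot e₂))

/-- Bounded existential quantification over the variable `i`. -/
def bEx (c i : ℕ) (e : SExpr) : SExpr := .sum c i e

/-- Bounded universal quantification over the variable `i`. -/
def bAll (c i : ℕ) (e : SExpr) : SExpr := bNot (.sum c i (bNot e))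

/-- The number of values of the variable `i` for which `e` holds. -/
def countIf (c i : ℕ) (e : SExpr) : SExpr := .sum c i (.ite (.const 0) e (.const 1) (.const 0))

/-- The Boolean expression `e` is true. -/
def Holds (e : SExpr) (s : Store) : Prop := 0 < e.eval s

section

variable (a b : SExpr) (s : Store) (c i : ℕ)

@[simp] lemma eval_var : (var i).eval s = s i 0 := rfl

@[simp] lemma holds_bLt : Holds (bLt a b) s ↔ a.eval s < b.eval s := by
  simp only [Holds, bLt, SExpr.eval]; split_ifs <;> simp_all

@[simp] lemma holds_bNot : Holds (bNot a) s ↔ ¬ Holds a s := by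
  simp only [Holds, bNot, SExpr.eval]; split_ifs <;> simp_all

@[simp] lemma holds_bAnd : Holds (bAnd a b) s ↔ Holds a s ∧ Holds b s := by
  simp only [Holds, bAnd, SExpr.eval]; split_ifs <;> simp_all

@[simp] lemma holds_bOr : Holds (bOr a b) s ↔ Holds a s ∨ Holds b s := by
  simp only [Holds, bOr, SExpr.eval]; omega

@[simp] lemma holds_bLe : Holds (bLe a b) s ↔ a.eval s ≤ b.eval s := by
  simp [bLe]

@[simp] lemma holds_bEq : Holds (bEq a b) s ↔ a.eval s = b.eval s := by
  simp [bEq, le_antisymm_iff]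

@[simp] lemma holds_bIff : Holds (bIff a b) s ↔ (Holds a s ↔ Holds b s) := by
  simp only [bIff, holds_bOr, holds_bAnd, holds_bNot]; tauto

@[simp] lemma holds_bEx : Holds (bEx c i a) s ↔ ∃ v < s 0 1 + c, Holds a (s.write i 0 v) := by
  simp [Holds, bEx, SExpr.eval, Finset.sum_pos_iff]

@[simp] lemma holds_bAll : Holds (bAll c i a) s ↔ ∀ v < s 0 1 + c, Holds a (s.write i 0 v) := by
  have := holds_bEx (bNot a) s c i
  simp only [bEx, holds_bNot] at this
  rw [bAll, holds_bNot, this]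
  push Not
  rfl

lemma eval_countIf [DecidablePred fun v => Holds a (s.write i 0 v)] :
    (countIf c i a).eval s =
      ((Finset.range (s 0 1 + c)).filter fun v => Holds a (s.write i 0 v)).card := by
  rw [Finset.card_filter, countIf, SExpr.eval]
  refine Finset.sum_congr rfl fun v _ => ?_
  by_cases h : 0 < a.eval (s.write i 0 v) <;> simp [Holds, SExpr.eval, h]

end

/-- `Lists s A w`: the array `A` contains the word `w`, preceded by its length. -/
def Lists (s : Store) (A : ℕ) (w : List ℕ) : Prop :=
  s A 0 = w.length ∧ ∀ (i : ℕ) (h : i < w.length), s A (i + 1) = w[i]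

/-- Append the value of `e` to the word in the array `A`. -/
def push (A : ℕ) (e : SExpr) : ForProgram :=
  .seq (.set A (.add (.get A (.const 0)) (.const 1)) e)
    (.set A (.const 0) (.add (.get A (.const 0)) (.const 1)))

lemma push_run (s : Store) (A : ℕ) (e : SExpr) : (push A e).run s =
    (s.write A (s A 0 + 1) (e.eval s)).write A 0 (s A 0 + 1) := by
  simp [push, ForProgram.run, SExpr.eval, Store.write]

lemma Lists.push {s : Store} {A : ℕ} {w : List ℕ} (h : Lists s A w) (e : SExpr) :
    Lists ((push A e).run s) A (w ++ [e.eval s]) := by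
  rw [push_run]
  refine ⟨by simp [h.1], fun i hi => ?_⟩
  rw [List.length_append, List.length_singleton] at hi
  rw [Store.write_cell_of_ne _ _ _ _ (Nat.succ_ne_zero i)]
  by_cases hiw : i < w.length
  · rw [List.getElem_append_left hiw, ← h.2 i hiw, h.1]
    exact Store.write_cell_of_ne _ _ _ _ (by omega)
  · obtain rfl : i = w.length := by omega
    simp [h.1]

lemma push_run_array (s : Store) {A B : ℕ} (e : SExpr) (h : B ≠ A) : (push A e).run s B = s B := by
  rw [push_run, Store.write_array_of_ne _ _ _ h, Store.write_array_of_ne _ _ _ h]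

lemma Lists.congr {s s' : Store} {A : ℕ} {w : List ℕ} (h : Lists s A w) (hs : s' A = s A) :
    Lists s' A w := by
  unfold Lists at *; rwa [hs]

/-- The loop invariant rule. -/
lemma run_loop_induction {c i : ℕ} {P : ForProgram} {n : ℕ} (I : ℕ → Store → Prop) {s : Store}
    (hn : s 0 1 = n) (h0 : I 0 s)
    (h : ∀ v < n + c, ∀ s, I v s → I (v + 1) (P.run (s.write i 0 v))) :
    I (n + c) ((ForProgram.loop c i P).run s) := by
  simp only [ForProgram.run, hn]
  suffices H : ∀ m ≤ n + c, I m (loopStore P.run i s m) from H _ le_rfl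
  intro m
  induction m with
  | zero => exact fun _ => h0
  | succ m ih => exact fun hm => h m (by omega) _ (ih (by omega))

/-- A loop whose rounds act on an abstract state by transitions `r` that decrease `μ`: if it leaves
the state as it was, then so did each round. -/
lemma run_sweep {α : Type*} {c i n : ℕ} {P : ForProgram} (Rep : Store → α → Prop)
    {r : α → α → Prop} {μ : α → ℕ} (hμ : ∀ a b, r a b → μ b < μ a) (Q : ℕ → α → Prop)
    (hn : ∀ s a, Rep s a → s 0 1 = n)
    (h : ∀ v < n + c, ∀ s a, Rep s a → ∃ b, Rep (P.run (s.write i 0 v)) b ∧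
      Relation.ReflTransGen r a b ∧ (b = a → Q v a))
    {s : Store} {a : α} (hs : Rep s a) :
    ∃ b, Rep ((ForProgram.loop c i P).run s) b ∧ Relation.ReflTransGen r a b ∧
      (b = a → ∀ v < n + c, Q v a) := by
  refine run_loop_induction (fun m s' => ∃ b, Rep s' b ∧ Relation.ReflTransGen r a b ∧
    (b = a → ∀ v < m, Q v a)) (hn s a hs) ⟨a, hs, .refl, by simp⟩ ?_
  rintro v hv s' ⟨b, hb, hab, hQ⟩
  obtain ⟨d, hd, hbd, hQ'⟩ := h v hv s' b hb
  refine ⟨d, hd, hab.trans hbd, ?_⟩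
  rintro rfl
  have hbd' : d = b := by
    rcases LabelledTriangulation.reflTransGen_eq_or_lt hμ hab with h1 | h1
    · exact h1
    · rcases LabelledTriangulation.reflTransGen_eq_or_lt hμ hbd with h2 | h2
      · exact h2.symm
      · omega
  subst hbd'
  intro u hu
  rcases Nat.lt_succ_iff_lt_or_eq.1 hu with hu | rfl
  · exact hQ rfl u hu
  · exact hQ' rfl

/-- A loop whose rounds either reach a terminal state or decrease `μ` by `M` at least. -/
lemma run_repeat {α : Type*} {c i n M : ℕ} {P : ForProgram} (Rep : Store → α → Prop)
    {r : α → α → Prop} {μ : α → ℕ} (Q : α → Prop)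
    (hQ : ∀ a b, Q a → Relation.ReflTransGen r a b → a = b)
    (hn : ∀ s a, Rep s a → s 0 1 = n)
    (h : ∀ v < n + c, ∀ s a, Rep s a → ∃ b, Rep (P.run (s.write i 0 v)) b ∧
      Relation.ReflTransGen r a b ∧ (Q b ∨ μ b + M ≤ μ a))
    {s : Store} {a : α} (hs : Rep s a) :
    ∃ b, Rep ((ForProgram.loop c i P).run s) b ∧ Relation.ReflTransGen r a b ∧
      (Q b ∨ μ b + (n + c) * M ≤ μ a) := by
  refine run_loop_induction (fun m s' => ∃ b, Rep s' b ∧ Relation.ReflTransGen r a b ∧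
    (Q b ∨ μ b + m * M ≤ μ a)) (hn s a hs) ⟨a, hs, .refl, by simp⟩ ?_
  rintro v hv s' ⟨b, hb, hab, hb'⟩
  obtain ⟨d, hd, hbd, hd'⟩ := h v hv s' b hb
  refine ⟨d, hd, hab.trans hbd, ?_⟩
  rcases hb' with hb' | hb'
  · exact Or.inl (hQ b d hb' hbd ▸ hb')
  · refine hd'.imp_right fun hd' => ?_
    rw [add_mul, one_mul]
    omega

/-- A sweep that, unless it changes the state, shows the state to be terminal can be repeated. -/
lemma sweep_terminal_or_lt {α : Type*} {r : α → α → Prop} {μ : α → ℕ}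
    (hμ : ∀ a b, r a b → μ b < μ a) {Q : α → Prop} {a b : α} (hab : Relation.ReflTransGen r a b)
    (h : b = a → Q a) : Q b ∨ μ b + 1 ≤ μ a := by
  rcases LabelledTriangulation.reflTransGen_eq_or_lt hμ hab with h1 | h1
  · left; rw [← h1]; exact h h1.symm
  · right; exact h1

end RAM

/-! ### The guards of the algorithm -/

namespace RAM

open LabelledTriangulation

variable {n : ℕ}

/-- The input word is in array `0`. -/
def Input (T₁ T₂ : LabelledTriangulation n) (s : Store) : Prop :=
  ∀ j, s 0 (j + 1) = (encodePair T₁ T₂).getD j 0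

/-- The triangulation `S` is stored in the arrays `A` (smaller endpoints) and `B` (larger
endpoints). -/
def Represents (s : Store) (A B : ℕ) (S : LabelledTriangulation n) : Prop :=
  ∀ k : Fin n, s A k = (S.diag k).lo ∧ s B k = (S.diag k).hi

/-- Array `7` contains the `2`-adic valuations of the numbers from `1` to `2n + 5`. -/
def Ruler (n : ℕ) (s : Store) : Prop :=
  ∀ r, 0 < r → r < 2 * (n + 3) → s 7 r = padicValNat 2 r

/-- The number `n`. -/
def size : SExpr := .get 0 (.const 1)

/-- The smaller endpoint of an edge of the first triangulation of the input. -/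
def inLo₁ (e : SExpr) : SExpr := .get 0 (.add e (.const 2))

/-- The larger endpoint of an edge of the first triangulation of the input. -/
def inHi₁ (e : SExpr) : SExpr := .get 0 (.add e (.add size (.const 2)))

/-- The smaller endpoint of an edge of the second triangulation of the input. -/
def inLo₂ (e : SExpr) : SExpr := .get 0 (.add e (.add size (.add size (.const 2))))

/-- The larger endpoint of an edge of the second triangulation of the input. -/
def inHi₂ (e : SExpr) : SExpr := .get 0 (.add e (.add size (.add size (.add size (.const 2)))))

/-- The edge `j` is to the left of the edge `k`, for given endpoints `lo` and `hi` of the edges. -/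
def leftOf (lo hi : SExpr → SExpr) (j k : SExpr) : SExpr :=
  bAnd (bNot (bEq j k)) (bAnd (bLe (lo k) (lo j)) (bLe (hi j) (hi k)))

/-- The edge with label `k` is fixed. -/
def isFixed (k : SExpr) : SExpr :=
  bAnd (bEq (inLo₁ k) (inLo₂ k)) (bAnd (bEq (inHi₁ k) (inHi₂ k))
    (bAll 0 12 (bIff (leftOf inLo₁ inHi₁ (var 12) k) (leftOf inLo₂ inHi₂ (var 12) k))))

/-- The vertex `v` is in the subpolygon of the edge `k`, and not an endpoint of its base. -/
def inRegion (k v : SExpr) : SExpr :=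
  bAnd (bLt (.const 0) v) (bAnd (bLt v (.add size (.const 2)))
    (bAll 0 11 (bOr (bNot (isFixed (var 11)))
      (bIff (bAnd (bLt (inLo₁ (var 11)) v) (bLt v (inHi₁ (var 11))))
        (leftOf inLo₁ inHi₁ k (var 11))))))

/-- The `2`-adic valuation of the rank of the vertex `v` in the subpolygon of the edge `k`. -/
def rankValuation (k v : SExpr) : SExpr :=
  .get 7 (countIf 3 13 (bAnd (bLe (var 13) v) (inRegion k (var 13))))

/-- The level of the chord `xy` is less than that of the chord `pq`: a vertex between `p` and `q`
has higher priority than all vertices between `x` and `y`. -/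
def levelLess (k x y p q : SExpr) : SExpr :=
  bEx 3 14 (bAnd (bAnd (inRegion k (var 14)) (bAnd (bLt p (var 14)) (bLt (var 14) q)))
    (bAll 3 15 (bOr (bNot (bAnd (inRegion k (var 15)) (bAnd (bLt x (var 15)) (bLt (var 15) y))))
      (bLt (rankValuation k (var 15)) (rankValuation k (var 14))))))

/-- The chords `xy` and `uv` cross. -/
def crosses (x y u v : SExpr) : SExpr :=
  bOr (bAnd (bLt x u) (bAnd (bLt u y) (bLt y v))) (bAnd (bLt u x) (bAnd (bLt x v) (bLt v y)))

/-- In the triangulation in the arrays `A` and `B`, the edge with the label in variable `8` can be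
flipped to the chord that joins the vertices in the variables `9` and `10`, and this decreases its
level.  A chord can be reached by a flip if it crosses this edge and no other. -/
def canImprove (A B : ℕ) : SExpr :=
  bAnd (bNot (isFixed (var 8))) <|
  bAnd (bLe (.add (var 9) (.const 2)) (var 10)) <|
  bAnd (bLe (var 10) (.add size (.const 2))) <|
  bAnd (bNot (bAnd (bEq (var 9) (.const 0)) (bEq (var 10) (.add size (.const 2))))) <|
  bAnd (bAll 0 16 (bIff (crosses (var 9) (var 10) (.get A (var 16)) (.get B (var 16)))
    (bEq (var 16) (var 8)))) <|
  levelLess (var 8) (var 9) (var 10) (.get A (var 8)) (.get B (var 8))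

/-- The label in variable `8` can advance to the place of the label in variable `19`, for the
triangulation in the arrays `2` and `3` and the goal in the arrays `4` and `5`. -/
def canAdvance : SExpr :=
  bAnd (bNot (bAnd (bEq (.get 2 (var 8)) (.get 4 (var 8))) (bEq (.get 3 (var 8)) (.get 5 (var 8)))))
  <| bAnd (bNot (bEq (var 19) (var 8))) <|
  bAnd (bAll 0 16 (bOr (bEq (var 16) (var 19)) (bOr (bEq (var 16) (var 8))
    (bIff (leftOf (.get 2) (.get 3) (var 19) (var 16))
      (leftOf (.get 2) (.get 3) (var 8) (var 16)))))) <|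
  bOr (bAnd (bEq (.get 2 (var 19)) (.get 4 (var 8))) (bEq (.get 3 (var 19)) (.get 5 (var 8)))) <|
  bNot (bIff (leftOf (.get 2) (.get 3) (var 8) (var 19))
    (bAnd (bNot (bAnd (bEq (.get 4 (var 8)) (.get 2 (var 19)))
      (bEq (.get 5 (var 8)) (.get 3 (var 19)))))
      (bAnd (bLe (.get 2 (var 19)) (.get 4 (var 8))) (bLe (.get 5 (var 8)) (.get 3 (var 19))))))

section

variable {T₁ T₂ S R : LabelledTriangulation n} {s : Store}

lemma Input.write (h : Input T₁ T₂ s) (A v : ℕ) : Input T₁ T₂ (s.write A 0 v) := fun j => by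
  rw [Store.write_cell_of_ne _ _ _ _ (Nat.succ_ne_zero j), h j]

lemma Represents.write {A B : ℕ} (h : Represents s A B S) {C : ℕ} (i v : ℕ) (hA : A ≠ C)
    (hB : B ≠ C) : Represents (s.write C i v) A B S := fun k => by
  rw [Store.write_array_of_ne _ _ _ hA, Store.write_array_of_ne _ _ _ hB]
  exact h k

lemma Ruler.write (h : Ruler n s) {C : ℕ} (i v : ℕ) (hC : 7 ≠ C) : Ruler n (s.write C i v) :=
  fun r hr hr' => by rw [Store.write_array_of_ne _ _ _ hC]; exact h r hr hr'

lemma Input.size_eq (h : Input T₁ T₂ s) : s 0 1 = n := h 0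

lemma Input.edge (h : Input T₁ T₂ s) (k : Fin n) :
    s 0 (k + 2) = (T₁.diag k).lo ∧ s 0 (k + (n + 2)) = (T₁.diag k).hi ∧
    s 0 (k + (n + (n + 2))) = (T₂.diag k).lo ∧ s 0 (k + (n + (n + (n + 2)))) = (T₂.diag k).hi := by
  have hk := k.2
  refine ⟨?_, ?_, ?_, ?_⟩
  · rw [show (k : ℕ) + 2 = (k + 1) + 1 by omega, h]
    simp [encodePair, List.getD_eq_getElem?_getD, List.getElem?_append, hk]
  · rw [show (k : ℕ) + (n + 2) = (n + k + 1) + 1 by omega, h]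
    simp [encodePair, List.getD_eq_getElem?_getD, List.getElem?_append, hk]
  · rw [show (k : ℕ) + (n + (n + 2)) = (n + (n + k) + 1) + 1 by omega, h]
    simp [encodePair, List.getD_eq_getElem?_getD, List.getElem?_append, hk]
  · rw [show (k : ℕ) + (n + (n + (n + 2))) = (n + (n + (n + k)) + 1) + 1 by omega, h]
    simp [encodePair, List.getD_eq_getElem?_getD]

lemma Input.eval_endpoints (h : Input T₁ T₂ s) {e : SExpr} {k : Fin n} (he : e.eval s = k) :
    (inLo₁ e).eval s = (T₁.diag k).lo ∧ (inHi₁ e).eval s = (T₁.diag k).hi ∧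
    (inLo₂ e).eval s = (T₂.diag k).lo ∧ (inHi₂ e).eval s = (T₂.diag k).hi := by
  simp only [inLo₁, inHi₁, inLo₂, inHi₂, size, SExpr.eval, he, h.size_eq]
  exact h.edge k

lemma holds_leftOf {lo hi : SExpr → SExpr} {e f : SExpr} {j k : Fin n} (he : e.eval s = j)
    (hf : f.eval s = k) (h₁ : (lo e).eval s = (S.diag j).lo) (h₂ : (hi e).eval s = (S.diag j).hi)
    (h₃ : (lo f).eval s = (S.diag k).lo) (h₄ : (hi f).eval s = (S.diag k).hi) :
    Holds (leftOf lo hi e f) s ↔ j ∈ S.leftLabels k := by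
  simp only [leftOf, holds_bAnd, holds_bNot, holds_bEq, holds_bLe, he, hf, h₁, h₂, h₃, h₄,
    mem_leftLabels, Fin.val_inj, ne_eq]

lemma write_var_of_ne {i j : ℕ} (v : ℕ) (h : i ≠ j) : (var i).eval (s.write j 0 v) = s i 0 := by
  rw [eval_var, Store.write_array_of_ne _ _ _ h]

lemma write_var_same (i v : ℕ) : (var i).eval (s.write i 0 v) = v := by simp

lemma Input.holds_isFixed (h : Input T₁ T₂ s) {i : ℕ} {k : Fin n} (hk : s i 0 = k) (hi : i ≠ 12) :
    Holds (isFixed (var i)) s ↔ Fixed T₁ T₂ k := by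
  obtain ⟨h1, h2, h3, h4⟩ := h.eval_endpoints (e := var i) hk
  simp only [isFixed, holds_bAnd, holds_bEq, holds_bAll, holds_bIff, h1, h2, h3, h4, h.size_eq,
    add_zero]
  rw [Fixed, Diagonal.ext_iff, and_assoc, Finset.ext_iff, Fin.forall_iff]
  refine and_congr_right fun _ => and_congr_right fun _ => forall₂_congr fun v hv => ?_
  have hw := h.write 12 v
  have e1 : (var i).eval (s.write 12 0 v) = k := by rw [write_var_of_ne v hi, hk]
  have e2 : (var 12).eval (s.write 12 0 v) = ((⟨v, hv⟩ : Fin n) : ℕ) := write_var_same 12 v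
  obtain ⟨a1, a2, a3, a4⟩ := hw.eval_endpoints e1
  obtain ⟨b1, b2, b3, b4⟩ := hw.eval_endpoints e2
  rw [holds_leftOf e2 e1 b1 b2 a1 a2, holds_leftOf e2 e1 b3 b4 a3 a4]

lemma Input.holds_inRegion (h : Input T₁ T₂ s) {i m v : ℕ} {k : Fin n} (hk : s i 0 = k)
    (hv : s m 0 = v) (hi : i ≠ 11) (hm : m ≠ 11) :
    Holds (inRegion (var i) (var m)) s ↔ v ∈ regionVertices T₁ T₂ k := by
  simp only [inRegion, holds_bAnd, holds_bLt, holds_bAll, holds_bOr, holds_bNot, holds_bIff,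
    eval_var, hv, h.size_eq, SExpr.eval, size, add_zero]
  rw [mem_regionVertices, and_assoc, Fin.forall_iff]
  refine and_congr_right fun _ => and_congr_right fun _ => forall₂_congr fun f hf => ?_
  have hw := h.write 11 f
  have e1 : (var i).eval (s.write 11 0 f) = k := by rw [write_var_of_ne f hi, hk]
  have e2 : (var 11).eval (s.write 11 0 f) = ((⟨f, hf⟩ : Fin n) : ℕ) := write_var_same 11 f
  obtain ⟨a1, a2, a3, a4⟩ := hw.eval_endpoints e1
  obtain ⟨b1, b2, b3, b4⟩ := hw.eval_endpoints e2
  have e3 : (s.write 11 0 f) m 0 = v := by rw [Store.write_array_of_ne _ _ _ hm, hv]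
  rw [holds_leftOf e1 e2 a1 a2 b1 b2, hw.holds_isFixed (i := 11) e2 (by decide), b1, b2, e3,
    imp_iff_not_or]

lemma Input.eval_rankValuation (h : Input T₁ T₂ s) (hr : Ruler n s) {i m v : ℕ} {k : Fin n}
    (hk : s i 0 = k) (hv : s m 0 = v) (hi : i ≠ 11 ∧ i ≠ 13) (hm : m ≠ 13)
    (hvk : v ∈ regionVertices T₁ T₂ k) :
    1 + (rankValuation (var i) (var m)).eval s = priority T₁ T₂ k v := by
  classical
  rw [priority, rankValuation, SExpr.eval, eval_countIf]
  have heq : ((Finset.range (s 0 1 + 3)).filter fun u =>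
      Holds (bAnd (bLe (var 13) (var m)) (inRegion (var i) (var 13))) (s.write 13 0 u)) =
      (regionVertices T₁ T₂ k).filter (· ≤ v) := by
    ext u
    have hw := h.write 13 u
    simp only [Finset.mem_filter, Finset.mem_range, holds_bAnd, holds_bLe, h.size_eq]
    rw [hw.holds_inRegion (i := i) (m := 13) (v := u) (k := k)
      (by rw [Store.write_array_of_ne _ _ _ hi.2, hk]) (by simp) hi.1 (by decide),
      write_var_same, write_var_of_ne u hm, hv]
    constructor
    · exact fun hh => ⟨hh.2.2, hh.2.1⟩
    · exact fun hh => ⟨by have := (mem_regionVertices.1 hh.1).1; omega, hh.2, hh.1⟩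
  rw [heq, hr]
  · exact Finset.card_pos.2 ⟨v, by simp [hvk]⟩
  · have h1 := Finset.card_filter_le (regionVertices T₁ T₂ k) (· ≤ v)
    have h2 := card_regionVertices_le_size (T₁ := T₁) (T₂ := T₂) (k := k)
    omega

lemma Input.holds_levelLess (h : Input T₁ T₂ s) (hr : Ruler n s) {k : Fin n} (hk : s 8 0 = k)
    {A B : ℕ} (hA : A ≠ 14) (hB : B ≠ 14) {p q : ℕ} (hp : s A k = p) (hq : s B k = q) :
    Holds (levelLess (var 8) (var 9) (var 10) (.get A (var 8)) (.get B (var 8))) s ↔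
      level T₁ T₂ k (s 9 0) (s 10 0) < level T₁ T₂ k p q := by
  rw [level.eq_1 T₁ T₂ k p q, Finset.lt_sup_iff]
  simp only [levelLess, holds_bEx, h.size_eq, Finset.mem_filter]
  refine exists_congr fun w => ?_
  have hw := h.write 14 w
  have k1 : (s.write 14 0 w) 8 0 = k := by rw [Store.write_array_of_ne _ _ _ (by decide), hk]
  have w1 : (s.write 14 0 w) 14 0 = w := by simp
  have e1 : (SExpr.get A (var 8)).eval (s.write 14 0 w) = p := by
    rw [SExpr.eval, eval_var, k1, Store.write_array_of_ne _ _ _ hA, hp]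
  have e2 : (SExpr.get B (var 8)).eval (s.write 14 0 w) = q := by
    rw [SExpr.eval, eval_var, k1, Store.write_array_of_ne _ _ _ hB, hq]
  simp only [holds_bAnd, holds_bLt, holds_bAll, holds_bOr, holds_bNot, hw.size_eq, e1, e2,
    eval_var, w1]
  rw [hw.holds_inRegion k1 w1 (by decide) (by decide)]
  rw [← and_assoc]
  constructor
  · rintro ⟨⟨-, hwk⟩, hall⟩
    refine ⟨hwk, level_lt (priority_pos w) fun u hu h1 h2 => ?_⟩
    have hun := (mem_regionVertices.1 hu).1
    have hw' := hw.write 15 u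
    have k2 : ((s.write 14 0 w).write 15 0 u) 8 0 = k := by
      rw [Store.write_array_of_ne _ _ _ (by decide), k1]
    have u2 : ((s.write 14 0 w).write 15 0 u) 15 0 = u := by simp
    have w2 : ((s.write 14 0 w).write 15 0 u) 14 0 = w := by
      rw [Store.write_array_of_ne _ _ _ (by decide), w1]
    have hr' := (hr.write (C := 14) 0 w (by decide)).write (C := 15) 0 u (by decide)
    have := hall u (by omega)
    rw [hw'.holds_inRegion k2 u2 (by decide) (by decide)] at this
    rw [← hw'.eval_rankValuation hr' k2 u2 (by decide) (by decide) hu,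
      ← hw'.eval_rankValuation hr' k2 w2 (by decide) (by decide) hwk.1]
    refine Nat.add_lt_add_left (this.resolve_left fun hc => hc ⟨hu, ?_, ?_⟩) 1
    · rw [u2]; exact h1
    · rw [u2]; exact h2
  · rintro ⟨hwk, hlt⟩
    have hwn := (mem_regionVertices.1 hwk.1).1
    refine ⟨⟨by omega, hwk⟩, fun u hu => ?_⟩
    have hw' := hw.write 15 u
    have k2 : ((s.write 14 0 w).write 15 0 u) 8 0 = k := by
      rw [Store.write_array_of_ne _ _ _ (by decide), k1]
    have u2 : ((s.write 14 0 w).write 15 0 u) 15 0 = u := by simp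
    have w2 : ((s.write 14 0 w).write 15 0 u) 14 0 = w := by
      rw [Store.write_array_of_ne _ _ _ (by decide), w1]
    have hr' := (hr.write (C := 14) 0 w (by decide)).write (C := 15) 0 u (by decide)
    rw [hw'.holds_inRegion k2 u2 (by decide) (by decide), or_iff_not_imp_left, not_not]
    rintro ⟨hu1, hu2, hu3⟩
    rw [u2] at hu2 hu3
    have := (le_level hu1 hu2 hu3).trans_lt hlt
    rw [← hw'.eval_rankValuation hr' k2 u2 (by decide) (by decide) hu1,
      ← hw'.eval_rankValuation hr' k2 w2 (by decide) (by decide) hwk.1] at this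
    exact Nat.lt_of_add_lt_add_left this

lemma Input.holds_canImprove (h : Input T₁ T₂ s) (hr : Ruler n s) {k : Fin n} (hk : s 8 0 = k)
    {A B x y : ℕ} (hA : A < 7) (hB : B < 7) (hS : Represents s A B S) (hx : s 9 0 = x)
    (hy : s 10 0 = y) :
    Holds (canImprove A B) s ↔ ¬ Fixed T₁ T₂ k ∧ x + 2 ≤ y ∧ y ≤ n + 2 ∧ ¬ (x = 0 ∧ y = n + 2) ∧
      (∀ j, Cross x y (S.diag j).lo (S.diag j).hi ↔ j = k) ∧
      level T₁ T₂ k x y < edgeLevel T₁ T₂ S k := by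
  have hl := h.holds_levelLess hr hk (A := A) (B := B) (by omega) (by omega) (hS k).1 (hS k).2
  rw [hx, hy] at hl
  rw [canImprove, holds_bAnd, holds_bNot, h.holds_isFixed hk (by decide)]
  simp only [holds_bAnd, holds_bNot, holds_bEq, holds_bLe, holds_bAll, holds_bIff, SExpr.eval,
    eval_var, size, h.size_eq, hx, hy, add_zero, hl]
  rw [Fin.forall_iff]
  refine and_congr_right fun _ => and_congr_right fun _ => and_congr_right fun _ =>
    and_congr_right fun _ => and_congr_left fun _ => forall₂_congr fun j hj => ?_
  have e1 := (hS.write (C := 16) 0 j (by omega) (by omega)) ⟨j, hj⟩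
  simp only at e1
  simp only [crosses, holds_bOr, holds_bAnd, holds_bLt, SExpr.eval, eval_var, Store.write_same,
    e1.1, e1.2]
  rw [Store.write_array_of_ne _ _ _ (by decide), Store.write_array_of_ne _ _ _ (by decide),
    Store.write_array_of_ne _ _ _ (by decide), hx, hy, hk, Cross, Fin.ext_iff]

lemma holds_canAdvance (hn : s 0 1 = n) (hS : Represents s 2 3 S) (hR : Represents s 4 5 R)
    {j k : Fin n} (hk : s 8 0 = k) (hj : s 19 0 = j) :
    Holds canAdvance s ↔ Advances S R k j := by
  have hleft : ∀ (s : Store), Represents s 2 3 S → ∀ (e f : SExpr) (a b : Fin n), e.eval s = a →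
      f.eval s = b → (Holds (leftOf (.get 2) (.get 3) e f) s ↔ a ∈ S.leftLabels b) := by
    intro s hS e f a b he hf
    refine holds_leftOf he hf ?_ ?_ ?_ ?_ <;> simp only [SExpr.eval, he, hf]
    exacts [(hS a).1, (hS a).2, (hS b).1, (hS b).2]
  rw [Advances, Adjacent]
  simp only [canAdvance, holds_bAnd, holds_bNot, holds_bOr, holds_bIff, holds_bAll, holds_bEq,
    holds_bLe, SExpr.eval, eval_var, hk, hj, hn, add_zero, (hS _).1, (hS _).2, (hR _).1, (hR _).2]
  rw [hleft s hS (var 8) (var 19) k j hk hj, Fin.forall_iff, ne_eq, Diagonal.ext_iff, ne_eq,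
    Diagonal.ext_iff, Fin.ext_iff, Below]
  rw [and_assoc]
  refine and_congr_right fun _ => and_congr_right fun _ => and_congr_left fun _ =>
    forall₂_congr fun g hg => ?_
  have e1 : (var 16).eval (s.write 16 0 g) = ((⟨g, hg⟩ : Fin n) : ℕ) := write_var_same 16 g
  have e2 : (var 19).eval (s.write 16 0 g) = j := by rw [write_var_of_ne g (by decide), hj]
  have e3 : (var 8).eval (s.write 16 0 g) = k := by rw [write_var_of_ne g (by decide), hk]
  have hS' := hS.write (C := 16) 0 g (by decide) (by decide)
  rw [hleft _ hS' _ _ j _ e2 e1, hleft _ hS' _ _ k _ e3 e1]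
  rw [eval_var] at e1 e2 e3
  rw [e1, e2, e3, ne_eq, ne_eq, Fin.ext_iff, Fin.ext_iff]
  tauto

end

end RAM

/-! ### The algorithm and its parts -/

namespace RAM

open LabelledTriangulation

variable {n : ℕ}

/-- Compute the `2`-adic valuations of the numbers below `2(n + 3)` in array `7`, from
`ν₂(2j) = ν₂(j) + 1`; the cells with odd index remain `0`.  (Cell `0` is not used.) -/
def rulerProgram : ForProgram :=
  .loop 3 8 (.set 7 (.add (var 8) (var 8)) (.add (.get 7 (var 8)) (.const 1)))

/-- Copy the two triangulations of the input to the arrays `2`, `3` and `4`, `5`. -/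
def copyProgram : ForProgram :=
  .loop 0 8 (.seq (.set 2 (var 8) (inLo₁ (var 8))) (.seq (.set 3 (var 8) (inHi₁ (var 8)))
    (.seq (.set 4 (var 8) (inLo₂ (var 8))) (.set 5 (var 8) (inHi₂ (var 8))))))

/-- If the edge in variable `8` can be flipped to the chord in the variables `9` and `10`, and this
decreases its level, then perform and record this flip. -/
def improveStep (A B L : ℕ) : ForProgram :=
  .cond (canImprove A B) (.seq (push L (var 8)) (.seq (.set A (var 8) (var 9))
    (.set B (var 8) (var 10))))

/-- Flip non-fixed edges of the triangulation in the arrays `A`, `B` to edges of smaller level, as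
long as possible, and record the flips in array `L`.  The two outer loops make `(n + 3)²` sweeps,
more than the sum of all levels, so that some sweep finds no flip. -/
def improveProgram (A B L : ℕ) : ForProgram :=
  .loop 3 17 (.loop 3 18 (.loop 0 8 (.loop 3 9 (.loop 3 10 (improveStep A B L)))))

/-- If the label in variable `8` can advance to the place of the label in variable `19`, then
exchange these labels and record the five flips. -/
def advanceStep : ForProgram :=
  .cond canAdvance <| .seq (push 1 (var 8)) <| .seq (push 1 (var 19)) <| .seq (push 1 (var 8)) <|
  .seq (push 1 (var 19)) <| .seq (push 1 (var 8)) <|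
  .seq (.set 21 (.const 0) (.get 2 (var 8))) <| .seq (.set 2 (var 8) (.get 2 (var 19))) <|
  .seq (.set 2 (var 19) (var 21)) <|
  .seq (.set 21 (.const 0) (.get 3 (var 8))) <| .seq (.set 3 (var 8) (.get 3 (var 19))) <|
  .set 3 (var 19) (var 21)

/-- Move the label in variable `8` to its place.  As long as it is not there, each sweep makes it
advance, and it has to pass at most `n` edges. -/
def routeLabel : ForProgram := .loop 3 17 (.loop 0 19 advanceStep)

/-- Move all labels to their places, in the order of the lengths of their edges. -/
def routeProgram : ForProgram :=
  .loop 3 20 (.loop 0 8 (.cond (bEq (.sub (.get 5 (var 8)) (.get 4 (var 8))) (var 20)) routeLabel))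

/-- Append the word in array `6`, in reverse order, to the word in array `1`.  The loops make
`(n + 3)²` rounds, at least as many as there are flips to be appended. -/
def reverseProgram : ForProgram :=
  .loop 3 17 (.loop 3 18 (.cond (bLt (.const 0) (.get 6 (.const 0)))
    (.seq (push 1 (.get 6 (.get 6 (.const 0))))
      (.set 6 (.const 0) (.sub (.get 6 (.const 0)) (.const 1))))))

/-- The whole algorithm.  Array `0` contains the input; `1` collects the output; `2`, `3` contain
the triangulation that arises from `T₁`; `4`, `5` contain the one that arises from `T₂`; `6`
collects its flips; `7` contains `2`-adic valuations; the other arrays are used for scalar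
variables. -/
def mainProgram : ForProgram :=
  .seq rulerProgram <| .seq copyProgram <| .seq (improveProgram 2 3 1) <|
  .seq (improveProgram 4 5 6) <| .seq routeProgram reverseProgram

lemma Input.congr {T₁ T₂ : LabelledTriangulation n} {s s' : Store} (h : Input T₁ T₂ s)
    (hs : s' 0 = s 0) : Input T₁ T₂ s' := fun j => by rw [hs, h j]

lemma Represents.congr {S : LabelledTriangulation n} {A B : ℕ} {s s' : Store}
    (h : Represents s A B S) (hA : s' A = s A) (hB : s' B = s B) : Represents s' A B S :=
  fun k => by rw [hA, hB]; exact h k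

lemma Ruler.congr {s s' : Store} (h : Ruler n s) (hs : s' 7 = s 7) : Ruler n s' :=
  fun r hr hr' => by rw [hs, h r hr hr']

lemma Lists.write {s : Store} {A : ℕ} {w : List ℕ} (h : Lists s A w) {C : ℕ} (i v : ℕ)
    (hC : A ≠ C) : Lists (s.write C i v) A w :=
  h.congr (Store.write_array_of_ne _ _ _ hC)

lemma ruler_run {s : Store} (hn : s 0 1 = n) (h7 : ∀ r, s 7 r = 0) :
    Ruler n (rulerProgram.run s) := by
  have := run_loop_induction (c := 3) (i := 8)
    (P := .set 7 (.add (var 8) (var 8)) (.add (.get 7 (var 8)) (.const 1)))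
    (fun m s => ∀ r, 0 < r → (r < 2 * m ∨ r % 2 = 1) → s 7 r = padicValNat 2 r) hn ?_ ?_
  · exact fun r hr hr' => this r hr (Or.inl hr')
  · intro r hr hr'
    rw [h7, padicValNat.eq_zero_of_not_dvd (by omega)]
  · intro v hv s hs r hr hr'
    simp only [ForProgram.run, SExpr.eval, eval_var, Store.write_same]
    by_cases hrv : r = v + v
    · subst hrv
      rw [Store.write_same, Store.write_array_of_ne _ _ _ (by decide), hs v (by omega) (by omega),
        ← two_mul, padicValNat.mul (by decide) (by omega), padicValNat_self, add_comm]
    · rw [Store.write_cell_of_ne _ _ _ _ hrv, Store.write_array_of_ne _ _ _ (by decide)]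
      exact hs r hr (by omega)

lemma copy_run {T₁ T₂ : LabelledTriangulation n} {s : Store} (h : Input T₁ T₂ s) :
    Represents (copyProgram.run s) 2 3 T₁ ∧ Represents (copyProgram.run s) 4 5 T₂ := by
  have := run_loop_induction (c := 0) (i := 8)
    (P := .seq (.set 2 (var 8) (inLo₁ (var 8))) (.seq (.set 3 (var 8) (inHi₁ (var 8)))
      (.seq (.set 4 (var 8) (inLo₂ (var 8))) (.set 5 (var 8) (inHi₂ (var 8))))))
    (fun m s => Input T₁ T₂ s ∧ ∀ k : Fin n, (k : ℕ) < m → (s 2 k = (T₁.diag k).lo ∧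
      s 3 k = (T₁.diag k).hi) ∧ s 4 k = (T₂.diag k).lo ∧ s 5 k = (T₂.diag k).hi)
    h.size_eq ⟨h, fun k hk => absurd hk (by omega)⟩ ?_
  · exact ⟨fun k => (this.2 k k.2).1, fun k => (this.2 k k.2).2⟩
  · rintro v hv s ⟨hs, hs'⟩
    refine ⟨fun j => ?_, fun k hk => ?_⟩
    · simp only [ForProgram.run]
      rw [Store.write_array_of_ne _ _ _ (by decide), Store.write_array_of_ne _ _ _ (by decide),
        Store.write_array_of_ne _ _ _ (by decide), Store.write_array_of_ne _ _ _ (by decide),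
        Store.write_array_of_ne _ _ _ (by decide), hs j]
    · have hk' := hs' k
      have he := hs.edge k
      have hn := hs.size_eq
      simp only [ForProgram.run, SExpr.eval, inLo₁, inHi₁, inLo₂, inHi₂, size, var, Store.write]
      by_cases hkv : (k : ℕ) = v
      · subst hkv
        simpa [hn] using ⟨⟨he.1, he.2.1⟩, he.2.2⟩
      · simpa [hkv] using hk' (by omega)

section

variable {T₁ T₂ T R : LabelledTriangulation n}

/-- The store represents a state of the local search that started from `T`. -/
def SearchState (T₁ T₂ T : LabelledTriangulation n) (A B L : ℕ) (s : Store) (a : State n) : Prop :=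
  Input T₁ T₂ s ∧ Ruler n s ∧ Represents s A B a.1 ∧ Lists s L (a.2.map Fin.val) ∧
    Recorded T₁ T₂ T a

lemma SearchState.write {A B L : ℕ} {s : Store} {a : State n}
    (h : SearchState T₁ T₂ T A B L s a) {C : ℕ} (v : ℕ) (hA : A ≠ C) (hB : B ≠ C) (hL : L ≠ C)
    (h7 : 7 ≠ C) : SearchState T₁ T₂ T A B L (s.write C 0 v) a :=
  ⟨h.1.write C v, h.2.1.write 0 v h7, h.2.2.1.write 0 v hA hB, h.2.2.2.1.write 0 v hL,
    h.2.2.2.2⟩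

/-- The label `k` can be flipped to the chord `xy`, and this decreases its level. -/
def ImproveCond (T₁ T₂ S : LabelledTriangulation n) (k : Fin n) (x y : ℕ) : Prop :=
  ¬ Fixed T₁ T₂ k ∧ x + 2 ≤ y ∧ y ≤ n + 2 ∧ ¬ (x = 0 ∧ y = n + 2) ∧
    (∀ j, Cross x y (S.diag j).lo (S.diag j).hi ↔ j = k) ∧
    level T₁ T₂ k x y < edgeLevel T₁ T₂ S k

lemma stable_of_not_improveCond {S : LabelledTriangulation n}
    (h : ∀ k, ∀ x < n + 3, ∀ y < n + 3, ¬ ImproveCond T₁ T₂ S k x y) : Stable T₁ T₂ S := by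
  intro k hk S' hf hlt
  have h1 := (S'.diag k).lo_add_two_le
  have h2 := (S'.diag k).hi_le
  refine h k (S'.diag k).lo (by omega) (S'.diag k).hi (by omega)
    ⟨hk, h1, h2, (S'.diag k).not_side, fun j => ⟨fun hx => ?_, ?_⟩, hlt⟩
  · by_contra hj
    rw [← hf.diag_of_ne hj] at hx
    exact S'.not_cross k j hx
  · rintro rfl
    exact hf.cross

/-- The arrays used by the local search are distinct and do not clash with other variables. -/
def Distinct (A B L : ℕ) : Prop :=
  0 < A ∧ A < 7 ∧ 0 < B ∧ B < 7 ∧ 0 < L ∧ L < 7 ∧ A ≠ B ∧ A ≠ L ∧ B ≠ L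

lemma improveStep_run {A B L : ℕ} (hd : Distinct A B L) {s : Store} {a : State n}
    (h : SearchState T₁ T₂ T A B L s a) {k : Fin n} {x y : ℕ} (hk : s 8 0 = k) (hx : s 9 0 = x)
    (hy : s 10 0 = y) :
    ∃ b, SearchState T₁ T₂ T A B L ((improveStep A B L).run s) b ∧
      Relation.ReflTransGen (Improve T₁ T₂) a b ∧ (b = a → ¬ ImproveCond T₁ T₂ a.1 k x y) := by
  obtain ⟨hI, hR, hS, hL, hrec⟩ := h
  obtain ⟨hA0, hA, hB0, hB, hL0, hL7, hAB, hAL, hBL⟩ := hd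
  have hc := hI.holds_canImprove hR hk hA hB hS hx hy
  rw [improveStep, ForProgram.run]
  split_ifs with hif
  · obtain ⟨h1, h2, h3, h4, h5, h6⟩ := hc.1 hif
    obtain ⟨S', hf, hS'⟩ := a.1.exists_flip_of_cross_only k ⟨x, y, h2, h3, h4⟩ ((h5 k).2 rfl)
      fun j hj hx => hj ((h5 j).1 hx)
    have himp : Improve T₁ T₂ a (S', a.2 ++ [k]) :=
      ⟨k, h1, hf, by rw [edgeLevel, hS']; exact h6, rfl⟩
    have hrun : ∀ C, C ≠ L → C ≠ A → C ≠ B → ((ForProgram.seq (push L (var 8))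
        ((ForProgram.set A (var 8) (var 9)).seq (.set B (var 8) (var 10)))).run s) C = s C := by
      intro C h1 h2 h3
      simp only [ForProgram.run]
      rw [Store.write_array_of_ne _ _ _ h3, Store.write_array_of_ne _ _ _ h2,
        push_run_array _ _ h1]
    refine ⟨(S', a.2 ++ [k]), ⟨hI.congr (hrun 0 (by omega) (by omega) (by omega)),
      hR.congr (hrun 7 (by omega) (by omega) (by omega)), fun j => ?_, ?_,
      hrec.extend hf.flipSeq (by simpa using h1) rfl⟩, .single himp, fun hb => ?_⟩
    · simp only [ForProgram.run, eval_var]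
      rw [Store.write_array_of_ne _ _ _ hAB, Store.write_array_of_ne _ _ _ (by omega : 8 ≠ A),
        Store.write_array_of_ne _ _ _ (by omega : 10 ≠ A), push_run_array _ _ (by omega : 8 ≠ L),
        push_run_array _ _ (by omega : 9 ≠ L), push_run_array _ _ (by omega : 10 ≠ L), hk, hx, hy]
      by_cases hj : j = k
      · subst hj
        rw [hS']
        simp
      · have hjk : (j : ℕ) ≠ k := fun hh => hj (Fin.ext hh)
        rw [Store.write_cell_of_ne _ _ _ _ hjk, Store.write_cell_of_ne _ _ _ _ hjk,
          push_run_array _ _ hAL, Store.write_array_of_ne _ _ _ (Ne.symm hAB),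
          push_run_array _ _ hBL, hf.diag_of_ne hj]
        exact hS j
    · have hl := hL.push (var 8)
      rw [eval_var, hk] at hl
      simp only [ForProgram.run, List.map_append, List.map_cons, List.map_nil]
      exact (hl.write _ _ (Ne.symm hAL)).write _ _ (Ne.symm hBL)
    · have := congrArg (fun c => c.2.length) hb
      simp at this
  · exact ⟨a, ⟨hI, hR, hS, hL, hrec⟩, .refl, fun _ hcond => hif (hc.2 hcond)⟩

lemma improveStep_not_writes {A B L C : ℕ} (hd : Distinct A B L) (hC : 7 < C) :
    ¬ (improveStep A B L).Writes C := by
  obtain ⟨hA0, hA, hB0, hB, hL0, hL7, hAB, hAL, hBL⟩ := hd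
  simp only [improveStep, push, ForProgram.Writes]
  omega

/-- The local search ends in a stable triangulation, and flips each edge at most as often as there
are levels. -/
lemma improveProgram_run {A B L : ℕ} (hd : Distinct A B L) {s : Store} (hs : Input T₁ T₂ s)
    (hr : Ruler n s) (hT : Represents s A B T) (hL : Lists s L []) (hc : Compatible T₁ T₂ T) :
    ∃ b, SearchState T₁ T₂ T A B L ((improveProgram A B L).run s) b ∧ Stable T₁ T₂ b.1 ∧
      ∀ k, b.2.count k ≤ 1 + Nat.log 2 (regionVertices T₁ T₂ k).card := by
  have hd' := hd
  obtain ⟨hA0, hA, hB0, hB, hL0, hL7, hAB, hAL, hBL⟩ := hd'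
  have h0 : SearchState T₁ T₂ T A B L s (T, []) :=
    ⟨hs, hr, hT, hL, rfl, by simp, hc⟩
  have hμ := fun a b => Improve.totalLevel_lt (T₁ := T₁) (T₂ := T₂) (a := a) (b := b)
  have hw : ∀ {s a}, SearchState T₁ T₂ T A B L s a → ∀ {C : ℕ} (v : ℕ), 7 < C →
      SearchState T₁ T₂ T A B L (s.write C 0 v) a := fun h C v hC =>
    h.write v (by omega) (by omega) (by omega) (by omega)
  have hy : ∀ (k : Fin n) (x : ℕ) (s : Store) (a : State n),
      (SearchState T₁ T₂ T A B L s a ∧ s 8 0 = k) ∧ s 9 0 = x → ∃ b,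
        ((SearchState T₁ T₂ T A B L ((ForProgram.loop 3 10 (improveStep A B L)).run s) b ∧
          (ForProgram.loop 3 10 (improveStep A B L)).run s 8 0 = k) ∧
          (ForProgram.loop 3 10 (improveStep A B L)).run s 9 0 = x) ∧
        Relation.ReflTransGen (Improve T₁ T₂) a b ∧
        (b = a → ∀ y < n + 3, ¬ ImproveCond T₁ T₂ a.1 k x y) := by
    intro k x s a hsa
    refine run_sweep (c := 3) (i := 10) (P := improveStep A B L)
      (fun s a => (SearchState T₁ T₂ T A B L s a ∧ s 8 0 = k) ∧ s 9 0 = x) hμ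
      (fun y a => ¬ ImproveCond T₁ T₂ a.1 k x y)
      (fun s a h => h.1.1.1.size_eq) (fun y hy s a h => ?_) hsa
    have h8 : (s.write 10 0 y) 8 0 = k := by
      rw [Store.write_array_of_ne _ _ _ (by decide)]; exact h.1.2
    have h9 : (s.write 10 0 y) 9 0 = x := by
      rw [Store.write_array_of_ne _ _ _ (by decide)]; exact h.2
    obtain ⟨b, hb, hab, hQ⟩ := improveStep_run hd (hw h.1.1 y (by decide : 7 < 10)) h8 h9
      (Store.write_same _ _ _ _)
    refine ⟨b, ⟨⟨hb, ?_⟩, ?_⟩, hab, hQ⟩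
    · rw [ForProgram.run_of_not_writes _ _ (improveStep_not_writes hd (by decide)), h8]
    · rw [ForProgram.run_of_not_writes _ _ (improveStep_not_writes hd (by decide)), h9]
  have hx : ∀ (k : Fin n) (s : Store) (a : State n),
      SearchState T₁ T₂ T A B L s a ∧ s 8 0 = k → ∃ b,
        (SearchState T₁ T₂ T A B L
          ((ForProgram.loop 3 9 (.loop 3 10 (improveStep A B L))).run s) b ∧
          (ForProgram.loop 3 9 (.loop 3 10 (improveStep A B L))).run s 8 0 = k) ∧
        Relation.ReflTransGen (Improve T₁ T₂) a b ∧
        (b = a → ∀ x < n + 3, ∀ y < n + 3, ¬ ImproveCond T₁ T₂ a.1 k x y) := by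
    intro k s a hsa
    refine run_sweep (c := 3) (i := 9) (P := .loop 3 10 (improveStep A B L))
      (fun s a => SearchState T₁ T₂ T A B L s a ∧ s 8 0 = k) hμ
      (fun x a => ∀ y < n + 3, ¬ ImproveCond T₁ T₂ a.1 k x y)
      (fun s a h => h.1.1.size_eq) (fun x hx s a h => ?_) hsa
    obtain ⟨b, hb, hab, hQ⟩ := hy k x (s.write 9 0 x) a ⟨⟨hw h.1 x (by decide), by
      rw [Store.write_array_of_ne _ _ _ (by decide)]; exact h.2⟩, by simp⟩
    exact ⟨b, hb.1, hab, hQ⟩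
  have hk : ∀ (s : Store) (a : State n), SearchState T₁ T₂ T A B L s a → ∃ b,
      SearchState T₁ T₂ T A B L
        ((ForProgram.loop 0 8 (.loop 3 9 (.loop 3 10 (improveStep A B L)))).run s) b ∧
      Relation.ReflTransGen (Improve T₁ T₂) a b ∧
        (Stable T₁ T₂ b.1 ∨ totalLevel T₁ T₂ b + 1 ≤ totalLevel T₁ T₂ a) := by
    intro s a hsa
    obtain ⟨b, hb, hab, hQ⟩ := run_sweep (c := 0) (i := 8)
      (P := .loop 3 9 (.loop 3 10 (improveStep A B L))) (SearchState T₁ T₂ T A B L) hμ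
      (fun k a => ∀ hk : k < n, ∀ x < n + 3, ∀ y < n + 3, ¬ ImproveCond T₁ T₂ a.1 ⟨k, hk⟩ x y)
      (fun s a h => h.1.size_eq) (fun k hk s a h => by
        obtain ⟨b, hb, hab, hQ⟩ := hx ⟨k, hk⟩ (s.write 8 0 k) a ⟨hw h k (by decide), by simp⟩
        exact ⟨b, hb.1, hab, fun h _ => hQ h⟩) hsa
    refine ⟨b, hb, hab, sweep_terminal_or_lt hμ (Q := fun b => Stable T₁ T₂ b.1) hab fun h => ?_⟩
    exact stable_of_not_improveCond fun k => hQ h k (by simp) k.2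
  have hrep : ∀ (s : Store) (a : State n), SearchState T₁ T₂ T A B L s a → ∃ b,
      SearchState T₁ T₂ T A B L
        ((ForProgram.loop 3 18 (.loop 0 8 (.loop 3 9 (.loop 3 10 (improveStep A B L))))).run s) b ∧
      Relation.ReflTransGen (Improve T₁ T₂) a b ∧
        (Stable T₁ T₂ b.1 ∨ totalLevel T₁ T₂ b + (n + 3) * 1 ≤ totalLevel T₁ T₂ a) := fun s a hsa =>
    run_repeat (SearchState T₁ T₂ T A B L) (fun b => Stable T₁ T₂ b.1)
      (fun a b ha hab => Stable.eq_of_improve ha hab) (fun s a h => h.1.size_eq)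
      (fun v _ s a h => hk _ a (hw h v (by decide))) hsa
  obtain ⟨b, hb, hab, hQ⟩ := run_repeat (c := 3) (i := 17)
    (P := .loop 3 18 (.loop 0 8 (.loop 3 9 (.loop 3 10 (improveStep A B L)))))
    (SearchState T₁ T₂ T A B L) (fun b => Stable T₁ T₂ b.1)
    (fun a b ha hab => Stable.eq_of_improve ha hab) (fun s a h => h.1.size_eq)
    (fun v _ s a h => hrep _ a (hw h v (by decide))) h0
  refine ⟨b, hb, hQ.resolve_right ?_, fun k => ?_⟩
  · have := totalLevel_lt (T₁ := T₁) (T₂ := T₂) (T, [])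
    rw [mul_one]
    omega
  · have h1 := (Improve.spec hab h0.2.2.2.2).2 k
    have h2 := edgeLevel_le (T₁ := T₁) (T₂ := T₂) T k
    rw [List.count_nil] at h1
    simp only at h1
    omega

/-- The store represents a state of the second part of the algorithm, whose goal is `R`. -/
def RouteState (R : LabelledTriangulation n) (s : Store) (a : State n) : Prop :=
  s 0 1 = n ∧ Represents s 2 3 a.1 ∧ Represents s 4 5 R ∧ Lists s 1 (a.2.map Fin.val) ∧
    Set.range a.1.diag = Set.range R.diag

lemma RouteState.write {s : Store} {a : State n} (h : RouteState R s a) {C : ℕ} (v : ℕ)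
    (hC : 7 < C) : RouteState R (s.write C 0 v) a :=
  ⟨by rw [Store.write_cell_of_ne _ _ _ _ one_ne_zero, h.1],
    h.2.1.write 0 v (by omega) (by omega), h.2.2.1.write 0 v (by omega) (by omega),
    h.2.2.2.1.write 0 v (by omega), h.2.2.2.2⟩

lemma advanceStep_run {s : Store} {a : State n} (h : RouteState R s a) {j k : Fin n}
    (hk : s 8 0 = k) (hj : s 19 0 = j) :
    ∃ b, RouteState R (advanceStep.run s) b ∧ Relation.ReflTransGen (Advance R k) a b ∧
      (b = a → ¬ Advances a.1 R k j) := by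
  obtain ⟨hn, hS, hR, hL, hSR⟩ := h
  have hc := holds_canAdvance hn hS hR hk hj
  rw [advanceStep, ForProgram.run]
  split_ifs with hif
  · have hadv := hc.1 hif
    obtain ⟨S', hf, h1, h2, h3⟩ := hadv.2.1.exists_swap
    have hb : Advance R k a (S', a.2 ++ [k, j, k, j, k]) := ⟨hSR, j, hadv, h1, h2, h3, hf, rfl⟩
    have hjk : (j : ℕ) ≠ k := fun hh => hadv.2.1.1 (Fin.ext hh)
    simp only [ForProgram.run]
    -- the store after the recording of the flips
    set s' := (push 1 (var 8)).run ((push 1 (var 19)).run ((push 1 (var 8)).run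
      ((push 1 (var 19)).run ((push 1 (var 8)).run s)))) with hs'
    have hfr : ∀ C, C ≠ 1 → s' C = s C := fun C hC => by
      rw [hs', push_run_array _ _ hC, push_run_array _ _ hC, push_run_array _ _ hC,
        push_run_array _ _ hC, push_run_array _ _ hC]
    have hl : Lists s' 1 ((a.2 ++ [k, j, k, j, k]).map Fin.val) := by
      have := ((((hL.push (var 8)).push (var 19)).push (var 8)).push (var 19)).push (var 8)
      simp only [eval_var, push_run_array _ _ (show 8 ≠ 1 by decide),
        push_run_array _ _ (show 19 ≠ 1 by decide), hk, hj] at this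
      simpa using this
    refine ⟨(S', a.2 ++ [k, j, k, j, k]), ⟨?_, fun g => ?_, fun g => ?_, ?_, ?_⟩, .single hb,
      fun hb => ?_⟩
    · simp [Store.write, hfr, hn]
    · simp only [SExpr.eval, eval_var, Store.write, hfr, hk, hj, ne_eq, OfNat.ofNat_ne_one,
        not_false_eq_true]
      by_cases hgk : g = k
      · subst hgk
        rw [h1]
        simpa [hjk, Ne.symm hjk] using hS j
      · have hgk' : (g : ℕ) ≠ k := fun hh => hgk (Fin.ext hh)
        by_cases hgj : g = j
        · subst hgj
          rw [h2]
          simpa using hS k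
        · have hgj' : (g : ℕ) ≠ j := fun hh => hgj (Fin.ext hh)
          rw [h3 g hgk hgj]
          simpa [hgk', hgj'] using hS g
    · simpa [Store.write, hfr] using hR g
    · exact (((((hl.write _ _ (by decide)).write _ _ (by decide)).write _ _ (by decide)).write _ _
        (by decide)).write _ _ (by decide)).write _ _ (by decide)
    · rw [← hSR]; exact hb.range_eq
    · have := congrArg (fun c => c.2.length) hb
      simp at this
  · exact ⟨a, ⟨hn, hS, hR, hL, hSR⟩, .refl, fun _ hcond => hif (hc.2 hcond)⟩

lemma routeLabel_run {s : Store} {a : State n} (h : RouteState R s a) {k : Fin n} {m : ℕ}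
    (hk : s 8 0 = k) (hm : s 20 0 = m) :
    ∃ b, RouteState R (routeLabel.run s) b ∧ Relation.ReflTransGen (Advance R k) a b ∧
      b.1.diag k = R.diag k ∧ routeLabel.run s 20 0 = m := by
  have hμ := fun a b => Advance.card_route_lt (R := R) (k := k) (a := a) (b := b)
  have hnw : ∀ C, 7 < C → C ≠ 21 → ¬ advanceStep.Writes C := by
    intro C hC hC'
    simp only [advanceStep, push, ForProgram.Writes]
    omega
  let Rep : Store → State n → Prop := fun s a => RouteState R s a ∧ s 8 0 = k
  have hsweep : ∀ (s : Store) (a : State n), Rep s a → ∃ b,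
      Rep ((ForProgram.loop 0 19 advanceStep).run s) b ∧
      Relation.ReflTransGen (Advance R k) a b ∧
        ((∀ j, ¬ Advances b.1 R k j) ∨ (route b.1 R k).card + 1 ≤ (route a.1 R k).card) := by
    intro s a hsa
    obtain ⟨b, hb, hab, hQ⟩ := run_sweep (c := 0) (i := 19) (P := advanceStep) Rep hμ
      (fun j a => ∀ hj : j < n, ¬ Advances a.1 R k ⟨j, hj⟩) (fun s a h => h.1.1)
      (fun j hj s a h => by
        have h8 : (s.write 19 0 j) 8 0 = k := by
          rw [Store.write_array_of_ne _ _ _ (by decide)]; exact h.2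
        obtain ⟨b, hb, hab, hQ⟩ := advanceStep_run (j := ⟨j, hj⟩) (h.1.write j (by decide : 7 < 19))
          h8 (Store.write_same _ _ _ _)
        refine ⟨b, ⟨hb, ?_⟩, hab, fun h _ => hQ h⟩
        rw [ForProgram.run_of_not_writes _ _ (hnw 8 (by decide) (by decide)), h8]) hsa
    exact ⟨b, hb, hab, sweep_terminal_or_lt hμ (Q := fun b => ∀ j, ¬ Advances b.1 R k j) hab
      fun h j => hQ h j (by simp) j.2⟩
  obtain ⟨b, hb, hab, hQ⟩ := run_repeat (c := 3) (i := 17) (P := .loop 0 19 advanceStep) Rep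
    (fun b => ∀ j, ¬ Advances b.1 R k j) (fun a b ha hab => by
      rcases Relation.ReflTransGen.cases_head hab with h | ⟨c, ⟨-, j, hj, -⟩, -⟩
      · exact h
      · exact absurd hj (ha j)) (fun s a h => h.1.1)
    (fun v _ s a h => hsweep _ a ⟨h.1.write v (by decide), by
      rw [Store.write_array_of_ne _ _ _ (by decide)]; exact h.2⟩)
    (show Rep s a from ⟨h, hk⟩)
  refine ⟨b, hb.1, hab, ?_, ?_⟩
  · have hroute : (route a.1 R k).card ≤ n := (Finset.card_le_univ _).trans (by simp)
    have hno := hQ.resolve_right (by omega)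
    by_contra hne
    obtain ⟨j, hj⟩ := exists_advances hb.1.2.2.2.2 hne
    exact hno j hj
  · have hw : ¬ routeLabel.Writes 20 := by
      have := hnw 20 (by decide) (by decide)
      simp [routeLabel, ForProgram.Writes, this]
    rw [ForProgram.run_of_not_writes _ _ hw, hm]

/-- The second part of the algorithm moves all labels to their places, with `O(m log m)` flips in a
subpolygon with `m` edges. -/
lemma routeProgram_run {s : Store} {a : State n} (h : RouteState R s a)
    (hR : Compatible T₁ T₂ R) (hst : Stable T₁ T₂ R) (ha : Recorded T₁ T₂ T a) :
    ∃ b, RouteState R (routeProgram.run s) b ∧ Recorded T₁ T₂ T b ∧ b.1 = R ∧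
      ∀ i, b.2.countP (· ∈ subpolygon T₁ T₂ i) ≤ a.2.countP (· ∈ subpolygon T₁ T₂ i) +
        5 * (2 * Nat.log 2 (regionVertices T₁ T₂ i).card + 5) * (subpolygon T₁ T₂ i).card := by
  -- the labels that have been moved to their places before stage `(m, v)`
  let done : ℕ → ℕ → Fin n → Finset (Fin n) := fun m v i => (subpolygon T₁ T₂ i).filter fun k =>
    (R.diag k).len < m ∨ ((R.diag k).len = m ∧ (k : ℕ) < v)
  let J : ℕ → ℕ → Store → Prop := fun m v s => ∃ b, RouteState R s b ∧ Recorded T₁ T₂ T b ∧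
    Placed b.1 R m v ∧ ∀ i, b.2.countP (· ∈ subpolygon T₁ T₂ i) ≤
      a.2.countP (· ∈ subpolygon T₁ T₂ i) +
        5 * (2 * Nat.log 2 (regionVertices T₁ T₂ i).card + 5) * (done m v i).card
  have hJ : J (n + 3) 0 (routeProgram.run s) := by
    refine run_loop_induction (fun m s => J m 0 s) h.1 ⟨a, h, ha, fun i hi => by omega,
      fun i => by omega⟩ fun m hm s hs => ?_
    have hin := run_loop_induction (c := 0) (i := 8)
      (P := .cond (bEq (.sub (.get 5 (var 8)) (.get 4 (var 8))) (var 20)) routeLabel)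
      (s := s.write 20 0 m) (n := n) (fun v s => J m v s ∧ s 20 0 = m) ?_ ?_ ?_
    · obtain ⟨⟨b, h1, h2, h3, h4⟩, -⟩ := hin
      refine ⟨b, h1, h2, fun i hi => h3 i (by have := i.2; omega), fun i => (h4 i).trans ?_⟩
      refine Nat.add_le_add_left (Nat.mul_le_mul_left _ (Finset.card_le_card fun k hk => ?_)) _
      simp only [done, Finset.mem_filter] at hk ⊢
      exact ⟨hk.1, by omega⟩
    · obtain ⟨b, h1, -⟩ := hs
      rw [Store.write_cell_of_ne _ _ _ _ one_ne_zero, h1.1]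
    · obtain ⟨b, h1, h2⟩ := hs
      exact ⟨⟨b, h1.write m (by decide), h2⟩, by simp⟩
    · rintro v hv s ⟨⟨b, h1, h2, h3, h4⟩, hsm⟩
      rw [add_zero] at hv
      have h1' := h1.write (C := 8) v (by decide)
      have h8 : (s.write 8 0 v) 8 0 = ((⟨v, hv⟩ : Fin n) : ℕ) := by simp
      have h20 : (s.write 8 0 v) 20 0 = m := by
        rw [Store.write_array_of_ne _ _ _ (by decide), hsm]
      have hlen : Holds (bEq (.sub (.get 5 (var 8)) (.get 4 (var 8))) (var 20))
          (s.write 8 0 v) ↔ (R.diag ⟨v, hv⟩).len = m := by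
        rw [holds_bEq]
        simp only [SExpr.eval, eval_var, h8, h20]
        have e := h1'.2.2.1 ⟨v, hv⟩
        simp only at e
        rw [e.1, e.2, Diagonal.len]
      rw [ForProgram.run]
      split_ifs with hif
      · have hm' := hlen.1 hif
        obtain ⟨d, hd, hbd, hdk, hd20⟩ := routeLabel_run h1' h8 h20
        rw [← hm'] at h3
        obtain ⟨s1, s2, s3, s4, s5⟩ := Advance.spec hR hbd h2 h1.2.2.2.2 h3
        rw [hm'] at s3
        have s3 : Placed d.1 R m v := s3
        refine ⟨⟨d, hd, s1, fun i hi => ?_, fun i => ?_⟩, hd20⟩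
        · by_cases hiv : (i : ℕ) = v
          · obtain rfl : i = ⟨v, hv⟩ := Fin.ext hiv
            exact hdk
          · exact s3 i (by omega)
        · by_cases hki : (⟨v, hv⟩ : Fin n) ∈ subpolygon T₁ T₂ i
          · have h5 := s5 i
            have h6 := hst.card_route_le (k := ⟨v, hv⟩) h2.2.2 hR
            rw [(mem_subpolygon.1 hki).2.regionVertices_eq] at h6
            have h7 : (done m v i).card + 1 ≤ (done m (v + 1) i).card := by
              rw [← Finset.card_insert_of_notMem (a := (⟨v, hv⟩ : Fin n))]
              · refine Finset.card_le_card fun k hk => ?_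
                simp only [done, Finset.mem_insert, Finset.mem_filter] at hk ⊢
                rcases hk with rfl | hk
                · exact ⟨hki, Or.inr ⟨hm', Nat.lt_succ_self v⟩⟩
                · exact ⟨hk.1, by omega⟩
              · simp only [done, Finset.mem_filter, not_and]
                intro _
                omega
            have h8 := Nat.mul_le_mul_left
              (5 * (2 * Nat.log 2 (regionVertices T₁ T₂ i).card + 5)) h7
            rw [mul_add, mul_one] at h8
            have := h4 i
            omega
          · rw [s4 i hki]
            refine (h4 i).trans ?_
            refine Nat.add_le_add_left
              (Nat.mul_le_mul_left _ (Finset.card_le_card fun k hk => ?_)) _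
            simp only [done, Finset.mem_filter] at hk ⊢
            exact ⟨hk.1, by omega⟩
      · have hm' : (R.diag ⟨v, hv⟩).len ≠ m := fun hh => hif (hlen.2 hh)
        refine ⟨⟨b, h1', h2, fun i hi => ?_, fun i => (h4 i).trans ?_⟩, h20⟩
        · by_cases hiv : (i : ℕ) = v
          · obtain rfl : i = ⟨v, hv⟩ := Fin.ext hiv
            exact h3 _ (by omega)
          · exact h3 i (by omega)
        · refine Nat.add_le_add_left (Nat.mul_le_mul_left _ (Finset.card_le_card fun k hk => ?_)) _
          simp only [done, Finset.mem_filter] at hk ⊢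
          exact ⟨hk.1, by omega⟩
  obtain ⟨b, h1, h2, h3, h4⟩ := hJ
  refine ⟨b, h1, h2, ?_, fun i => (h4 i).trans ?_⟩
  · ext k : 2
    refine h3 k (Or.inl ?_)
    have := (R.diag k).hi_le
    rw [Diagonal.len]
    omega
  · exact Nat.add_le_add_left (Nat.mul_le_mul_left _ (Finset.card_le_card
      (Finset.filter_subset _ _))) _

lemma reverseProgram_run {s : Store} {w w' : List ℕ} (hn : s 0 1 = n) (h : Lists s 1 w)
    (h' : Lists s 6 w') (hw' : w'.length ≤ (n + 3) * (n + 3)) :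
    Lists (reverseProgram.run s) 1 (w ++ w'.reverse) := by
  let P : ForProgram := .cond (bLt (.const 0) (.get 6 (.const 0)))
    (.seq (push 1 (.get 6 (.get 6 (.const 0))))
      (.set 6 (.const 0) (.sub (.get 6 (.const 0)) (.const 1))))
  -- what remains of the second word, in reverse order, is still to be appended to the first one
  let I : ℕ → Store → Prop := fun m s => s 0 1 = n ∧ ∃ u u', Lists s 1 u ∧ Lists s 6 u' ∧
    u ++ u'.reverse = w ++ w'.reverse ∧ u'.length ≤ (n + 3) * (n + 3) - m
  have hI : ∀ m s C v, 7 < C → I m s → I m (s.write C 0 v) := by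
    rintro m s C v hC ⟨h0, u, u', h1, h2, h3⟩
    exact ⟨by rw [Store.write_cell_of_ne _ _ _ _ one_ne_zero, h0], u, u',
      h1.write _ _ (by omega), h2.write _ _ (by omega), h3⟩
  have hstep : ∀ m s, I m s → I (m + 1) (P.run s) := by
    rintro m s ⟨h0, u, u', h1, h2, h3, h4⟩
    have hP : Holds (bLt (.const 0) (.get 6 (.const 0))) s ↔ 0 < u'.length := by
      rw [holds_bLt]
      simp only [SExpr.eval, h2.1]
    simp only [P, ForProgram.run]
    split_ifs with hif
    · obtain ⟨u₀, x, rfl⟩ := List.eq_nil_or_concat u' |>.resolve_left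
        (List.length_pos_iff.1 (hP.1 hif))
      rw [List.concat_eq_append] at *
      have hx : (SExpr.get 6 (.get 6 (.const 0))).eval s = x := by
        simp only [SExpr.eval, h2.1, List.length_append, List.length_singleton]
        rw [h2.2 u₀.length (by simp)]
        simp
      have hp := h1.push (.get 6 (.get 6 (.const 0)))
      rw [hx] at hp
      have h6 : (push 1 (.get 6 (.get 6 (.const 0)))).run s 6 = s 6 :=
        push_run_array _ _ (by decide)
      refine ⟨?_, u ++ [x], u₀, hp.write _ _ (by decide), ⟨?_, fun i hi => ?_⟩, ?_, ?_⟩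
      · rw [Store.write_array_of_ne _ _ _ (by decide), push_run_array _ _ (by decide), h0]
      · simp [SExpr.eval, h6, h2.1]
      · simp only [SExpr.eval]
        rw [Store.write_cell_of_ne _ _ _ _ (Nat.succ_ne_zero i), h6, h2.2 i (by simp; omega),
          List.getElem_append_left hi]
      · rw [← h3]; simp
      · rw [List.length_append, List.length_singleton] at h4
        omega
    · have : u'.length = 0 := by
        have := mt hP.2 hif
        omega
      exact ⟨h0, u, u', h1, h2, h3, by omega⟩
  have hinner : ∀ m s, I m s → I (m + (n + 3)) ((ForProgram.loop 3 18 P).run s) := by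
    intro m s hs
    refine run_loop_induction (fun v s => I (m + v) s) hs.1 hs fun v _ s hs => ?_
    exact hstep _ _ (hI _ _ 18 v (by decide) hs)
  have := run_loop_induction (c := 3) (i := 17) (P := .loop 3 18 P) (n := n)
    (fun v s => I (v * (n + 3)) s) hn ⟨hn, w, w', h, h', rfl, by simpa using hw'⟩ fun v _ s hs => by
      rw [add_mul, one_mul]
      exact hinner _ _ (hI _ _ 17 v (by decide) hs)
  obtain ⟨-, u, u', h1, -, h3, h4⟩ := this
  rw [Nat.sub_self, Nat.le_zero, List.length_eq_zero_iff] at h4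
  subst h4
  rw [← h3]
  rw [List.reverse_nil, List.append_nil]
  exact h1

end

end RAM

/-! ### Correctness of the algorithm -/

namespace RAM

open LabelledTriangulation

variable {n : ℕ}

lemma input_initialStore (T₁ T₂ : LabelledTriangulation n) :
    Input T₁ T₂ (initialStore (encodePair T₁ T₂)) := fun j => by
  simp [initialStore]

lemma lists_initialStore (w : List ℕ) {A : ℕ} (hA : A ≠ 0) : Lists (initialStore w) A [] :=
  ⟨by simp [initialStore, hA], by simp⟩

/-- The algorithm is correct: it outputs the flips from `T₁` to a stable triangulation with the
labels arranged as in the stable triangulation reached from `T₂`, followed by the reversal of the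
flips from `T₂` to the latter. -/
lemma mainProgram_run (T₁ T₂ : LabelledTriangulation n) :
    ∃ l : List (Fin n),
      Lists (mainProgram.run (initialStore (encodePair T₁ T₂))) 1 (l.map Fin.val) ∧
      FlipSeq l T₁ T₂ ∧ (∀ k ∈ l, ¬ Fixed T₁ T₂ k) ∧
      ∀ i, l.countP (· ∈ subpolygon T₁ T₂ i) ≤ (subpolygon T₁ T₂ i).card *
        (12 * Nat.log 2 (regionVertices T₁ T₂ i).card + 27) := by
  set s₀ := initialStore (encodePair T₁ T₂)
  have i0 : Input T₁ T₂ s₀ := input_initialStore T₁ T₂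
  set s₁ := rulerProgram.run s₀ with hs₁
  have w1 : ∀ C, C ≠ 7 → C ≠ 8 → s₁ C = s₀ C := fun C h7 h8 =>
    rulerProgram.run_of_not_writes s₀ (by simp [rulerProgram, ForProgram.Writes, h7, h8])
  have r1 : Ruler n s₁ := ruler_run i0.size_eq fun r => by simp [s₀, initialStore]
  have i1 := i0.congr (w1 0 (by decide) (by decide))
  set s₂ := copyProgram.run s₁ with hs₂
  have w2 : ∀ C, C ≠ 8 → C ≠ 2 → C ≠ 3 → C ≠ 4 → C ≠ 5 → s₂ C = s₁ C :=
    fun C h8 h2 h3 h4 h5 => copyProgram.run_of_not_writes s₁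
      (by simp [copyProgram, ForProgram.Writes, h8, h2, h3, h4, h5])
  have i2 := i1.congr (w2 0 (by decide) (by decide) (by decide) (by decide) (by decide))
  have r2 := r1.congr (w2 7 (by decide) (by decide) (by decide) (by decide) (by decide))
  have l2 : ∀ A, A = 1 ∨ A = 6 → Lists s₂ A [] := fun A hA =>
    (lists_initialStore (encodePair T₁ T₂) (by omega)).congr
      (by rw [w2 A (by omega) (by omega) (by omega) (by omega) (by omega),
        w1 A (by omega) (by omega)])
  obtain ⟨c2, c2'⟩ := copy_run i1
  have hwi : ∀ (A B L C : ℕ) (s : Store), C ≠ A → C ≠ B → C ≠ L → C < 8 →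
      (improveProgram A B L).run s C = s C := fun A B L C s hA hB hL h8 =>
    (improveProgram A B L).run_of_not_writes s (by
      simp only [improveProgram, improveStep, push, ForProgram.Writes]
      omega)
  obtain ⟨b₁, ⟨i3, r3, p3, q3, e3⟩, st₁, n₁⟩ := improveProgram_run (A := 2) (B := 3) (L := 1)
    (by unfold Distinct; omega) i2 r2 c2 (l2 1 (by simp)) (compatible_left T₁ T₂)
  set s₃ := (improveProgram 2 3 1).run s₂
  have w3 : ∀ C, C = 4 ∨ C = 5 ∨ C = 6 → s₃ C = s₂ C := fun C hC =>
    hwi _ _ _ C s₂ (by omega) (by omega) (by omega) (by omega)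
  obtain ⟨b₂, ⟨i4, r4, p4, q4, e4⟩, st₂, n₂⟩ := improveProgram_run (A := 4) (B := 5) (L := 6)
    (by unfold Distinct; omega) i3 r3 (c2'.congr (w3 4 (by simp)) (w3 5 (by simp)))
    ((l2 6 (by simp)).congr (w3 6 (by simp))) (compatible_right T₁ T₂)
  set s₄ := (improveProgram 4 5 6).run s₃
  have w4 : ∀ C, C = 1 ∨ C = 2 ∨ C = 3 → s₄ C = s₃ C := fun C hC =>
    hwi _ _ _ C s₃ (by omega) (by omega) (by omega) (by omega)
  -- stable triangulations have the same edges
  have hrange : Set.range b₁.1.diag = Set.range b₂.1.diag := by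
    refine Set.Subset.antisymm ?_ ?_
    · rintro _ ⟨g, rfl⟩
      exact st₁.exists_diag_eq e3.2.2 e4.2.2 st₂ g
    · rintro _ ⟨g, rfl⟩
      exact st₂.exists_diag_eq e4.2.2 e3.2.2 st₁ g
  obtain ⟨b, ⟨h5, -, -, q5, -⟩, e5, hb, n₃⟩ := routeProgram_run (R := b₂.1) (a := b₁) (s := s₄)
    ⟨i4.size_eq, p3.congr (w4 2 (by simp)) (w4 3 (by simp)), p4, q3.congr (w4 1 (by simp)), hrange⟩
    e4.2.2 st₂ e3
  have w5 : routeProgram.run s₄ 6 = s₄ 6 := routeProgram.run_of_not_writes s₄ (by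
    simp [routeProgram, routeLabel, advanceStep, push, ForProgram.Writes])
  have hcount : ∀ (l : List (Fin n)) (i : Fin n),
      (∀ k, l.count k ≤ 1 + Nat.log 2 (regionVertices T₁ T₂ k).card) →
      l.countP (· ∈ subpolygon T₁ T₂ i) ≤
        (subpolygon T₁ T₂ i).card * (1 + Nat.log 2 (regionVertices T₁ T₂ i).card) := by
    intro l i hl
    rw [countP_mem_eq_sum_count, ← smul_eq_mul]
    refine Finset.sum_le_card_nsmul _ _ _ fun k hk => ?_
    rw [← (mem_subpolygon.1 hk).2.regionVertices_eq]
    exact hl k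
  have hlen : (b₂.2.map Fin.val).length ≤ (n + 3) * (n + 3) := by
    have h1 : b₂.2.length = ∑ k, b₂.2.count k := by
      rw [← countP_mem_eq_sum_count, eq_comm, List.countP_eq_length]
      simp
    have h2 : ∑ k, b₂.2.count k ≤ ∑ _k : Fin n, (n + 2) := Finset.sum_le_sum fun k _ => by
      have h1 := n₂ k
      have h2 := Nat.log_le_self 2 (regionVertices T₁ T₂ k).card
      have h3 := card_regionVertices_le_size (T₁ := T₁) (T₂ := T₂) (k := k)
      omega
    simp only [Finset.sum_const, Finset.card_univ, Fintype.card_fin, smul_eq_mul] at h2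
    rw [List.length_map]
    nlinarith
  have h6 := reverseProgram_run h5 q5 (q4.congr w5) hlen
  refine ⟨b.2 ++ b₂.2.reverse, ?_, ?_, fun k hk => ?_, fun i => ?_⟩
  · rw [List.map_append, List.map_reverse]
    exact h6
  · refine FlipSeq.append e5.1 ?_
    rw [hb]
    exact e4.1.reverse
  · rw [List.mem_append, List.mem_reverse] at hk
    exact hk.elim (e5.2.1 k) (e4.2.1 k)
  · rw [List.countP_append, List.countP_reverse]
    have h1 := hcount b₁.2 i n₁
    have h2 := hcount b₂.2 i n₂
    have h3 := n₃ i
    -- `12 * D + 27 = 2 * (1 + D) + 5 * (2 * D + 5)`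
    nlinarith

lemma one_lt_bound_mainProgram : 1 < mainProgram.bound :=
  mainProgram.lt_bound_of_writes (by simp [mainProgram, reverseProgram, push, ForProgram.Writes])

lemma not_writes_mainProgram : ¬ mainProgram.Writes 0 := by
  simp [mainProgram, rulerProgram, copyProgram, improveProgram, improveStep, routeProgram,
    routeLabel, advanceStep, reverseProgram, push, ForProgram.Writes]

/-- The compiled algorithm runs in polynomial time. -/
lemma outputsWithin_mainProgram {T₁ T₂ : LabelledTriangulation n} {w : List ℕ}
    (h : Lists (mainProgram.run (initialStore (encodePair T₁ T₂))) 1 w) :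
    OutputsWithin (mainProgram.compile mainProgram.bound) (encodePair T₁ T₂) w
      (mainProgram.cost.eval n) := by
  obtain ⟨m, s', hexec, hs', hm⟩ := mainProgram.exec_compile mainProgram.bound
    (initialStore (encodePair T₁ T₂)) _ le_rfl (zero_lt_one.trans one_lt_bound_mainProgram)
    not_writes_mainProgram fun _ _ => rfl
  rw [(input_initialStore T₁ T₂).size_eq] at hm
  exact ⟨m, s', hm, hexec, h.congr (hs' 1 one_lt_bound_mainProgram)⟩

end RAM

theorem mainTheorem7 :
    ∃ (P : RAM.Program) (p : Polynomial ℕ) (C : ℝ),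
      ∀ (n : ℕ) (T₁ T₂ : LabelledTriangulation n),
        -- the algorithm returns, in polynomial time, a flip sequence `l` from `T₁` to `T₂`
        (∃ l : List (Fin n),
          RAM.OutputsWithin P (LabelledTriangulation.encodePair T₁ T₂)
            (l.map Fin.val) (p.eval n) ∧
          LabelledTriangulation.FlipSeq l T₁ T₂ ∧
          -- it never flips a fixed edge
          (∀ k, LabelledTriangulation.Fixed T₁ T₂ k → k ∉ l) ∧
          -- it uses `O(m log m)` flips in each subpolygon with `m` edges
          (∀ i, ¬ LabelledTriangulation.Fixed T₁ T₂ i →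
            ((l.countP (fun j => j ∈ LabelledTriangulation.subpolygon T₁ T₂ i) : ℕ) : ℝ) ≤
              C * ((LabelledTriangulation.subpolygon T₁ T₂ i).card : ℝ) *
                Real.log (((LabelledTriangulation.subpolygon T₁ T₂ i).card : ℝ) + 1)) ∧
          -- its length approximates the flip distance to within a factor `O(log n)`
          LabelledTriangulation.flipDist T₁ T₂ ≤ l.length ∧
          (l.length : ℝ) ≤
            C * Real.log ((n : ℝ) + 1) * (LabelledTriangulation.flipDist T₁ T₂ : ℝ)) ∧
        -- every flip sequence from `T₁` to `T₂` flips each non-fixed edge at least once, hence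
        -- it uses at least `m` flips in each subpolygon with `m` edges
        (∀ l : List (Fin n), LabelledTriangulation.FlipSeq l T₁ T₂ →
          (∀ k, ¬ LabelledTriangulation.Fixed T₁ T₂ k → k ∈ l) ∧
          (∀ i, ¬ LabelledTriangulation.Fixed T₁ T₂ i →
            (LabelledTriangulation.subpolygon T₁ T₂ i).card ≤
              l.countP (fun j => j ∈ LabelledTriangulation.subpolygon T₁ T₂ i))) := by
  refine ⟨RAM.mainProgram.compile RAM.mainProgram.bound, RAM.mainProgram.cost, 39 / Real.log 2,
    fun n T₁ T₂ => ⟨?_, fun l hl =>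
      ⟨fun k hk => by_contra fun h => hk (hl.fixed_of_not_mem h), fun i _ =>
        hl.card_subpolygon_le i⟩⟩⟩
  obtain ⟨l, hout, hl, hfix, hcount⟩ := RAM.mainProgram_run T₁ T₂
  have hC : 0 < 39 / Real.log 2 := div_pos (by norm_num) (Real.log_pos (by norm_num))
  have hbound : ∀ i, ¬ LabelledTriangulation.Fixed T₁ T₂ i →
      ((l.countP (fun j => j ∈ LabelledTriangulation.subpolygon T₁ T₂ i) : ℕ) : ℝ) ≤
        39 / Real.log 2 * ((LabelledTriangulation.subpolygon T₁ T₂ i).card : ℝ) *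
          Real.log (((LabelledTriangulation.subpolygon T₁ T₂ i).card : ℝ) + 1) := fun i hi =>
    le_trans (by exact_mod_cast hcount i) (LabelledTriangulation.natLog_bound_le
      (Finset.card_pos.2 ⟨i, LabelledTriangulation.mem_subpolygon.2 ⟨hi, fun _ _ => Iff.rfl⟩⟩)
      (Nat.log_mono_right (LabelledTriangulation.card_regionVertices_le ..)))
  refine ⟨l, RAM.outputsWithin_mainProgram hout, hl, fun k hk hkl => hfix k hkl hk, hbound,
    LabelledTriangulation.flipDist_le hl, ?_⟩
  refine (LabelledTriangulation.length_le_of_countP_le hfix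
    (B := 39 / Real.log 2 * Real.log ((n : ℝ) + 1)) fun i hi => (hbound i hi).trans ?_).trans
    (mul_le_mul_of_nonneg_left
      (by exact_mod_cast LabelledTriangulation.card_not_fixed_le_flipDist hl)
      (mul_nonneg hC.le (Real.log_nonneg (by simp))))
  have hcard : (LabelledTriangulation.subpolygon T₁ T₂ i).card ≤ n :=
    (Finset.card_le_univ _).trans (by simp)
  rw [mul_right_comm]
  refine mul_le_mul_of_nonneg_right (mul_le_mul_of_nonneg_left ?_ hC.le) (by positivity)
  exact Real.log_le_log (by positivity) (by exact_mod_cast Nat.add_le_add_right hcard 1)
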